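/- **Setting.** Let $\mathcal G$ be a locally compact Hausdorff étale groupoid with base space $X=\mathcal G^{(0)}$, range and source maps $r,s$, multiplication $m$ and spaces $\mathcal G^{(n)}$ of composable strings $x_0\xleftarrow{g_1}x_1\leftarrow\cdots\xleftarrow{g_n}x_n$. A *$\mathcal G$-sheaf* is a sheaf $\mathcal S$ of abelian groups on $X$ whose étale space carries a continuous action of $\mathcal G$ by homomorphisms $g:\mathcal S_{s(g)}\to\mathcal S_{r(g)}$. Put $\tau_n:\mathcal G^{(n)}\to X$, $(g_1,\dots,g_n)\mapsto x_0$, and $\mathcal S_n=\tau_n^*\mathcal S$. A sheaf $\mathcal S$ on a locally compact Hausdorff space $Y$ is *c-soft* if for every compact $K$, open $U\supseteq K$ and section $t$ of $\mathcal S$ over $U$ there is an open $V$ with $K\subseteq V\subseteq U$ such that $t|_V$ is the restriction of a global section. A *c-soft resolution* of a $\mathcal G$-sheaf $\mathcal A$ is an exact sequence of $\mathcal G$-sheaves $0\to\mathcal A\to\mathcal S^0\to\mathcal S^1\to\cdots$ with all $\mathcal S^q$ c-soft. Let $\Gamma_c$ denote compactly supported sections. The face maps $\partial_i:\mathcal G^{(p)}\to\mathcal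 G^{(p-1)}$ (omit $x_i$) are local homeomorphisms and induce maps $\Gamma_c(\mathcal G^{(p)};\mathcal S_p)\to\Gamma_c(\mathcal G^{(p-1)};\mathcal S_{p-1})$ by summation over the fibres, where for $i=0$ stalks are identified by the action of $g_1^{-1}:\mathcal S_{x_0}\to\mathcal S_{x_1}$. With their alternating sums and the differentials of $\mathcal S^\bullet$, the groups $\Gamma_c(\mathcal G^{(p)};\mathcal S^q_p)$ $(p,q\ge 0)$ form a double complex. Its direct sum total complex, $\bigoplus_{p-q=n}\Gamma_c(\mathcal G^{(p)};\mathcal S^q_p)$ in degree $n\in\mathbb Z$, has homology $H_n(\mathcal G;\mathcal A)$. Let $\mathcal G'\subseteq\mathcal G$ be an open subgroupoid with the same base space. Then $(\mathcal G')^{(p)}$ is open in $\mathcal G^{(p)}$; let $(\mathcal S_p)_{(\mathcal G')^{(p)}}\subseteq\mathcal S_p$ be the subsheaf obtained by replacing all stalks outside $(\mathcal G')^{(p)}$ by $0$. The *relative group* $H_n(\mathcal G/\mathcal G';\mathcal A)$ is the $n$th homology of the direct sum total complex of the quotient double complex with entries $\Gamma_c\big(\mathcal G^{(p)};\mathcal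 S^q_p/(\mathcal S^q_p)_{(\mathcal G')^{(p)}}\big)$. Let $\Delta=\mathcal G\setminus\mathcal G'$, and give $r(\Delta)$ the quotient topology from $r:\Delta\to r(\Delta)$. The inclusion $\mathcal G'\subseteq\mathcal G$ is *regular* if $r:\Delta\to r(\Delta)$ is open. Let $\mathcal H'=m\big((\Delta\times\Delta)\cap m^{-1}(\mathcal G')\big)$, with the quotient topology from $m:(\Delta\times\Delta)\cap m^{-1}(\mathcal G')\to\mathcal H'$, and let $\mathcal H=\mathcal H'\sqcup\Delta$ with the disjoint union topology. As sets, $\mathcal H=\mathcal G|_{r(\Delta)}$ and $\mathcal H'=\mathcal G'|_{r(\Delta)}$, which makes $\mathcal H'\subseteq\mathcal H$ groupoids with base space $r(\Delta)$ and gives a canonical continuous injective homomorphism $\iota:\mathcal H\to\mathcal G$. **Statement.** Let $\mathcal A$ be a $\mathcal G$-sheaf. 0. $\mathcal A$ has a c-soft resolution, and for every $n\in\mathbb Z$ the groups $H_n(\mathcal G;\mathcal A)$ and $H_n(\mathcal G/\mathcal G';\mathcal A)$ do not depend, up to isomorphism, on the c-soft resolution used to compute them. 1. Let $\mathcal S^\bullet$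 be a c-soft resolution of $\mathcal A$. Its restriction to $\mathcal G'$ is a c-soft resolution of the $\mathcal G'$-sheaf $\mathcal A$ (and every other c-soft resolution of this $\mathcal G'$-sheaf gives isomorphic groups $H_n(\mathcal G';\mathcal A)$). Extension of sections by zero and the projections to the quotient sheaves give a short exact sequence of total complexes $$0\to\bigoplus_{p-q=\bullet}\Gamma_c\big((\mathcal G')^{(p)};\mathcal S^q_p\big)\to\bigoplus_{p-q=\bullet}\Gamma_c\big(\mathcal G^{(p)};\mathcal S^q_p\big)\to\bigoplus_{p-q=\bullet}\Gamma_c\big(\mathcal G^{(p)};\mathcal S^q_p/(\mathcal S^q_p)_{(\mathcal G')^{(p)}}\big)\to0,$$ and hence, with its connecting homomorphisms, a long exact sequence $$\cdots\to H_{n+1}(\mathcal G/\mathcal G';\mathcal A)\to H_n(\mathcal G';\mathcal A)\to H_n(\mathcal G;\mathcal A)\to H_n(\mathcal G/\mathcal G';\mathcal A)\to H_{n-1}(\mathcal G';\mathcal A)\to\cdots\qquad(n\in\mathbb Z).$$ 2. Suppose that the inclusion $\mathcal G'\subseteq\mathcal G$ is regular. Then $\mathcal H$ is a locally compact Hausdorff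 étale groupoid (with $\mathcal H'$ an open subgroupoid), for every c-soft resolution $\mathcal S^\bullet$ of $\mathcal A$ the pullback $\iota^*\mathcal S^\bullet$ is a c-soft resolution of the $\mathcal H$-sheaf $\iota^*\mathcal A$, and pullback of sections along $\iota:\mathcal H^{(p)}\to\mathcal G^{(p)}$ is a map of the double complexes that define the relative groups which induces isomorphisms $$H_n(\mathcal G/\mathcal G';\mathcal A)\cong H_n(\mathcal H/\mathcal H';\iota^*\mathcal A)\qquad(n\in\mathbb Z).$$ Moreover $H_n(\mathcal H/\mathcal H';\iota^*\mathcal A)$, computed from any c-soft resolution of $\iota^*\mathcal A$, is isomorphic to $H_n(\mathcal G/\mathcal G';\mathcal A)$. -/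

import Mathlib

open CategoryTheory Topology

universe u

namespace EtaleHomology

/-! ### Local homeomorphisms -/

theorem isLocalHomeomorph_of_sections {E B : Type*} [TopologicalSpace E] [TopologicalSpace B]
    (p : E → B) (hc : Continuous p) (hi : ∀ e, ∃ U ∈ 𝓝 e, Set.InjOn p U)
    (hs : ∀ e, ∃ σ : B → E, ContinuousAt σ (p e) ∧ σ (p e) = e ∧ ∀ᶠ b in 𝓝 (p e), p (σ b) = b) :
    IsLocalHomeomorph p := by
  have ho : IsOpenMap p := by
    rw [isOpenMap_iff_nhds_le]
    intro e
    obtain ⟨σ, hσ, hσe, hσp⟩ := hs e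
    have h1 : Filter.Tendsto σ (𝓝 (p e)) (𝓝 e) := by
      have := hσ.tendsto
      rwa [hσe] at this
    calc 𝓝 (p e) = Filter.map (p ∘ σ) (𝓝 (p e)) := by
          conv_lhs => rw [← Filter.map_id (f := 𝓝 (p e))]
          exact Filter.map_congr (hσp.mono fun b hb => hb.symm)
      _ = Filter.map p (Filter.map σ (𝓝 (p e))) := Filter.map_map.symm
      _ ≤ Filter.map p (𝓝 e) := Filter.map_mono h1
  rw [isLocalHomeomorph_iff_isOpenEmbedding_restrict]
  intro e
  obtain ⟨U, hU, hUi⟩ := hi e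
  refine ⟨interior U, interior_mem_nhds.2 hU, ?_⟩
  refine .of_continuous_injective_isOpenMap (hc.comp continuous_subtype_val) ?_
    (ho.comp isOpen_interior.isOpenMap_subtype_val)
  exact Set.injOn_iff_injective.1 (hUi.mono interior_subset)

theorem exists_injOn {E B : Type*} [TopologicalSpace E] [TopologicalSpace B]
    {p : E → B} (hp : IsLocalHomeomorph p) (e : E) : ∃ U ∈ 𝓝 e, Set.InjOn p U := by
  obtain ⟨φ, he, rfl⟩ := hp e
  exact ⟨φ.source, φ.open_source.mem_nhds he, φ.injOn⟩

theorem exists_localSection {E B : Type*} [TopologicalSpace E] [TopologicalSpace B]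
    {p : E → B} (hp : IsLocalHomeomorph p) (e : E) :
    ∃ σ : B → E, ContinuousAt σ (p e) ∧ σ (p e) = e ∧ ∀ᶠ b in 𝓝 (p e), p (σ b) = b := by
  have hs := hp.apply_self_mem_localInverseAt_source (x := e)
  refine ⟨hp.localInverseAt e, (hp.localInverseAt e).continuousAt hs,
    hp.localInverseAt_apply_self, ?_⟩
  filter_upwards [(hp.localInverseAt e).open_source.mem_nhds hs] with b hb
  exact hp.apply_localInverseAt_of_mem hb

/-! ### Sheaves of abelian groups, as étale spaces -/

/-- The disjoint union of a family of stalks. -/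
@[ext]
structure Total {X : Type u} (F : X → Type u) : Type u where
  base : X
  val : F base

theorem Total.mk_cast {X : Type u} {F : X → Type u} {x y : X} (h : x = y) (v : F x) :
    (⟨y, h ▸ v⟩ : Total F) = ⟨x, v⟩ := by
  subst h; rfl

/-- A sheaf of abelian groups on `X`, given by its étale space: a family of abelian groups (the
stalks) and a topology on their disjoint union, such that the projection to `X` is a local
homeomorphism and fibrewise subtraction is continuous on the fibre product. -/
structure AbSheaf (X : Type u) [TopologicalSpace X] where
  stalk : X → Type u
  [grp : ∀ x, AddCommGroup (stalk x)]
  [top : TopologicalSpace (Total stalk)]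
  isLocalHomeomorph_base : IsLocalHomeomorph (Total.base : Total stalk → X)
  continuous_sub : Continuous fun p : {p : Total stalk × Total stalk // p.2.base = p.1.base} =>
    (⟨p.1.1.base, p.1.1.val - p.2 ▸ p.1.2.val⟩ : Total stalk)

attribute [instance] AbSheaf.grp AbSheaf.top

section LocalLemmas

variable {X : Type u} [TopologicalSpace X] {F : X → Type u} [TopologicalSpace (Total F)]

theorem eventually_eq_of_eq (hF : IsLocalHomeomorph (Total.base : Total F → X))
    {Z : Type*} [TopologicalSpace Z] {b : Z → X} {s t : ∀ z, F (b z)} {z₀ : Z}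
    (hs : ContinuousAt (fun z => (⟨b z, s z⟩ : Total F)) z₀)
    (ht : ContinuousAt (fun z => (⟨b z, t z⟩ : Total F)) z₀) (h : s z₀ = t z₀) :
    ∀ᶠ z in 𝓝 z₀, s z = t z := by
  obtain ⟨U, hU, hi⟩ := exists_injOn hF ⟨b z₀, s z₀⟩
  have hU' : U ∈ 𝓝 (⟨b z₀, t z₀⟩ : Total F) := by rwa [← h]
  filter_upwards [hs.preimage_mem_nhds hU, ht.preimage_mem_nhds hU'] with z h1 h2
  have := hi h1 h2 rfl
  simpa using this

theorem exists_section_through (hF : IsLocalHomeomorph (Total.base : Total F → X))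
    [∀ x, Inhabited (F x)] (x : X) (v : F x) :
    ∃ s : ∀ y, F y, s x = v ∧ ∀ᶠ y in 𝓝 x, ContinuousAt (fun y => (⟨y, s y⟩ : Total F)) y := by
  classical
  have hsrc := hF.apply_self_mem_localInverseAt_source (x := (⟨x, v⟩ : Total F))
  set φ := hF.localInverseAt (⟨x, v⟩ : Total F) with hφ
  have hb : ∀ y ∈ φ.source, (φ y).base = y := fun y hy => hF.apply_localInverseAt_of_mem hy
  let s : ∀ y, F y := fun y => if h : (φ y).base = y then h ▸ (φ y).val else default
  have hsφ : ∀ y ∈ φ.source, (⟨y, s y⟩ : Total F) = φ y := by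
    intro y hy
    simp only [s, dif_pos (hb y hy)]
    exact Total.mk_cast _ _
  refine ⟨s, ?_, ?_⟩
  · have := hsφ x hsrc
    have h2 : φ x = ⟨x, v⟩ := hF.localInverseAt_apply_self
    rw [h2] at this
    simpa using this
  · filter_upwards [φ.open_source.mem_nhds hsrc] with y hy
    refine (φ.continuousAt hy).congr ?_
    filter_upwards [φ.open_source.mem_nhds hy] with z hz
    exact (hsφ z hz).symm

end LocalLemmas

theorem continuous_sub_of {X : Type u} {F : X → Type u} [TopologicalSpace (Total F)]
    [∀ x, AddCommGroup (F x)]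
    (H : ∀ (Z : Type u) [TopologicalSpace Z] (b : Z → X) (s t : ∀ z, F (b z)) (z₀ : Z),
      ContinuousAt (fun z => (⟨b z, s z⟩ : Total F)) z₀ →
      ContinuousAt (fun z => (⟨b z, t z⟩ : Total F)) z₀ →
      ContinuousAt (fun z => (⟨b z, s z - t z⟩ : Total F)) z₀) :
    Continuous fun p : {p : Total F × Total F // p.2.base = p.1.base} =>
      (⟨p.1.1.base, p.1.1.val - p.2 ▸ p.1.2.val⟩ : Total F) := by
  rw [continuous_iff_continuousAt]
  intro p
  refine H {p : Total F × Total F // p.2.base = p.1.base} (fun p => p.1.1.base)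
    (fun p => p.1.1.val) (fun p => p.2 ▸ p.1.2.val) p ?_ ?_
  · exact (continuous_fst.comp continuous_subtype_val).continuousAt
  · simp only [Total.mk_cast]
    exact (continuous_snd.comp continuous_subtype_val).continuousAt

namespace AbSheaf

section Basic

variable {X : Type u} [TopologicalSpace X] (S : AbSheaf X)

theorem continuous_base : Continuous (Total.base : Total S.stalk → X) :=
  S.isLocalHomeomorph_base.continuous

variable {S}

theorem continuousAt_sub {Z : Type*} [TopologicalSpace Z] {b : Z → X} {s t : ∀ z, S.stalk (b z)}
    {z₀ : Z} (hs : ContinuousAt (fun z => (⟨b z, s z⟩ : Total S.stalk)) z₀)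
    (ht : ContinuousAt (fun z => (⟨b z, t z⟩ : Total S.stalk)) z₀) :
    ContinuousAt (fun z => (⟨b z, s z - t z⟩ : Total S.stalk)) z₀ := by
  let g : Z → {p : Total S.stalk × Total S.stalk // p.2.base = p.1.base} :=
    fun z => ⟨(⟨b z, s z⟩, ⟨b z, t z⟩), rfl⟩
  have hg : ContinuousAt g z₀ :=
    Topology.IsInducing.subtypeVal.continuousAt_iff.2 (hs.prodMk ht)
  exact S.continuous_sub.continuousAt.comp hg

theorem continuousAt_zero {Z : Type*} [TopologicalSpace Z] {b : Z → X} {z₀ : Z}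
    (hb : ContinuousAt b z₀) :
    ContinuousAt (fun z => (⟨b z, 0⟩ : Total S.stalk)) z₀ := by
  let _ : ∀ x, Inhabited (S.stalk x) := fun x => ⟨0⟩
  obtain ⟨s, -, hs⟩ := exists_section_through S.isLocalHomeomorph_base (b z₀) 0
  have h1 := continuousAt_sub hs.self_of_nhds hs.self_of_nhds
  simp only [sub_self] at h1
  exact h1.comp (f := b) hb

theorem continuousAt_base_of {Z : Type*} [TopologicalSpace Z] {b : Z → X}
    {s : ∀ z, S.stalk (b z)} {z₀ : Z}
    (hs : ContinuousAt (fun z => (⟨b z, s z⟩ : Total S.stalk)) z₀) : ContinuousAt b z₀ :=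
  S.continuous_base.continuousAt.comp hs

theorem continuousAt_add {Z : Type*} [TopologicalSpace Z] {b : Z → X} {s t : ∀ z, S.stalk (b z)}
    {z₀ : Z} (hs : ContinuousAt (fun z => (⟨b z, s z⟩ : Total S.stalk)) z₀)
    (ht : ContinuousAt (fun z => (⟨b z, t z⟩ : Total S.stalk)) z₀) :
    ContinuousAt (fun z => (⟨b z, s z + t z⟩ : Total S.stalk)) z₀ := by
  have h := continuousAt_sub hs
    (continuousAt_sub (continuousAt_zero (continuousAt_base_of hs)) ht)
  simpa only [zero_sub, sub_neg_eq_add] using h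

theorem continuousAt_sum {Z : Type*} [TopologicalSpace Z] {b : Z → X} {z₀ : Z}
    (hb : ContinuousAt b z₀) {ι : Type*} (I : Finset ι) (s : ι → ∀ z, S.stalk (b z))
    (hs : ∀ i ∈ I, ContinuousAt (fun z => (⟨b z, s i z⟩ : Total S.stalk)) z₀) :
    ContinuousAt (fun z => (⟨b z, ∑ i ∈ I, s i z⟩ : Total S.stalk)) z₀ := by
  classical
  induction I using Finset.induction_on with
  | empty => simpa using continuousAt_zero hb
  | insert a I ha ih =>
    simp only [Finset.sum_insert ha]
    exact continuousAt_add (hs a (by simp)) (ih fun i hi => hs i (by simp [hi]))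

/-- A (global) section of `S`: a continuous choice of elements of the stalks. -/
def IsSection (S : AbSheaf X) (t : ∀ x, S.stalk x) : Prop :=
  Continuous fun x => (⟨x, t x⟩ : Total S.stalk)

theorem IsSection.isClosed_ne_zero {t : ∀ x, S.stalk x} (ht : S.IsSection t) :
    IsClosed {x | t x ≠ 0} := by
  rw [← isOpen_compl_iff, isOpen_iff_mem_nhds]
  intro x hx
  have hx' : t x = 0 := by simpa using hx
  filter_upwards [eventually_eq_of_eq S.isLocalHomeomorph_base (b := fun y : X => y)
    (s := t) (t := fun _ => 0) ht.continuousAt (continuousAt_zero continuousAt_id) hx'] with y hy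
  simpa using hy

/-- The group `Γ_c(X; S)` of compactly supported sections (the support `{x | t x ≠ 0}` of a
section is automatically closed). -/
def sectionsC (S : AbSheaf X) : AddSubgroup (∀ x, S.stalk x) where
  carrier := {t | S.IsSection t ∧ IsCompact {x | t x ≠ 0}}
  zero_mem' := ⟨continuous_iff_continuousAt.2 fun _ => continuousAt_zero continuousAt_id, by simp⟩
  add_mem' := by
    rintro s t ⟨hs, hs'⟩ ⟨ht, ht'⟩
    have h : S.IsSection (s + t) := continuous_iff_continuousAt.2 fun _ =>
      continuousAt_add (b := fun x : X => x) hs.continuousAt ht.continuousAt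
    refine ⟨h, (hs'.union ht').of_isClosed_subset h.isClosed_ne_zero ?_⟩
    intro x hx
    by_contra hc
    simp only [Set.mem_union, Set.mem_ofPred_eq, not_or, not_not] at hc
    exact hx (by simp [hc.1, hc.2])
  neg_mem' := by
    rintro s ⟨hs, hs'⟩
    have h : S.IsSection (-s) := by
      refine continuous_iff_continuousAt.2 fun x => ?_
      have := continuousAt_sub (b := fun x : X => x) (z₀ := x)
        (continuousAt_zero (S := S) continuousAt_id) hs.continuousAt
      simpa only [zero_sub] using! this
    exact ⟨h, by simpa using hs'⟩

/-- `S` is `c`-soft: a section over an open neighbourhood `U` of a compact set `K` agrees near `K`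
with a global section. (The values of `s` outside `U` are irrelevant.) -/
def IsCSoft (S : AbSheaf X) : Prop :=
  ∀ (K U : Set X) (s : ∀ x, S.stalk x), IsCompact K → IsOpen U → K ⊆ U →
    ContinuousOn (fun x => (⟨x, s x⟩ : Total S.stalk)) U →
    ∃ (V : Set X) (t : ∀ x, S.stalk x), IsOpen V ∧ K ⊆ V ∧ V ⊆ U ∧ S.IsSection t ∧
      ∀ x ∈ V, s x = t x

/-- Transport along an equality of base points. -/
def tr (S : AbSheaf X) {x y : X} (h : x = y) : S.stalk x →+ S.stalk y :=
  h ▸ AddMonoidHom.id _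

@[simp] theorem tr_rfl {x : X} (h : x = x) (v : S.stalk x) : S.tr h v = v := rfl

theorem mk_tr {x y : X} (h : x = y) (v : S.stalk x) :
    (⟨y, S.tr h v⟩ : Total S.stalk) = ⟨x, v⟩ := by
  subst h; rfl

end Basic

/-! ### Pullbacks and quotients of sheaves -/

section Pullback

variable {X Y : Type u} [TopologicalSpace X] [TopologicalSpace Y]

/-- The stalks of the pullback sheaf. -/
def PullbackStalk (S : AbSheaf X) (f : Y → X) (y : Y) : Type u := S.stalk (f y)

instance (S : AbSheaf X) (f : Y → X) (y : Y) : AddCommGroup (S.PullbackStalk f y) :=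
  inferInstanceAs (AddCommGroup (S.stalk (f y)))

/-- The canonical map from the étale space of the pullback to the étale space of `S`. -/
def pullbackProj (S : AbSheaf X) (f : Y → X) (e : Total (S.PullbackStalk f)) : Total S.stalk :=
  ⟨f e.base, e.val⟩

/-- The topology of the fibre product `Y ×_X S`. -/
instance pullbackTop (S : AbSheaf X) (f : Y → X) : TopologicalSpace (Total (S.PullbackStalk f)) :=
  TopologicalSpace.induced (fun e => (e.base, S.pullbackProj f e)) inferInstance

theorem continuousAt_pullback_iff (S : AbSheaf X) (f : Y → X) {Z : Type*} [TopologicalSpace Z]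
    {g : Z → Total (S.PullbackStalk f)} {z₀ : Z} :
    ContinuousAt g z₀ ↔ ContinuousAt (fun z => (g z).base) z₀ ∧
      ContinuousAt (fun z => S.pullbackProj f (g z)) z₀ := by
  have hi : IsInducing (fun e : Total (S.PullbackStalk f) => (e.base, S.pullbackProj f e)) := ⟨rfl⟩
  rw [hi.continuousAt_iff]
  exact ⟨fun h => ⟨h.fst, h.snd⟩, fun h => h.1.prodMk h.2⟩

theorem continuous_pullbackProj (S : AbSheaf X) (f : Y → X) :
    Continuous (S.pullbackProj f) :=
  continuous_iff_continuousAt.2 fun _ => ((S.continuousAt_pullback_iff f).1 continuousAt_id).2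

theorem continuous_pullback_base (S : AbSheaf X) (f : Y → X) :
    Continuous (Total.base : Total (S.PullbackStalk f) → Y) :=
  continuous_iff_continuousAt.2 fun _ => ((S.continuousAt_pullback_iff f).1 continuousAt_id).1

theorem continuous_pullback_mk (S : AbSheaf X) (f : Y → X) {Z : Type*} [TopologicalSpace Z]
    {b : Z → Y} {v : ∀ z, S.PullbackStalk f (b z)} (hb : Continuous b)
    (hv : Continuous fun z => (⟨f (b z), v z⟩ : Total S.stalk)) :
    Continuous fun z => (⟨b z, v z⟩ : Total (S.PullbackStalk f)) :=
  continuous_iff_continuousAt.2 fun _ =>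
    (S.continuousAt_pullback_iff f).2 ⟨hb.continuousAt, hv.continuousAt⟩

/-- The pullback (inverse image) sheaf `f^* S` along a continuous map; its stalk at `y` is
`S_{f y}` and its étale space is the fibre product of `Y` with that of `S`. -/
def pullback (S : AbSheaf X) (f : Y → X) (hf : Continuous f) : AbSheaf Y where
  stalk := S.PullbackStalk f
  isLocalHomeomorph_base := by
    refine isLocalHomeomorph_of_sections _ (S.continuous_pullback_base f) ?_ ?_
    · intro e
      obtain ⟨U, hU, hi⟩ := exists_injOn S.isLocalHomeomorph_base (S.pullbackProj f e)
      refine ⟨_, (S.continuous_pullbackProj f).continuousAt.preimage_mem_nhds hU, ?_⟩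
      rintro ⟨y, v⟩ h1 ⟨y', v'⟩ h2 (h : y = y')
      subst h
      have := hi h1 h2 rfl
      exact congrArg (Total.mk y) (eq_of_heq (Total.mk.inj this).2)
    · rintro ⟨y, v⟩
      let _ : ∀ x, Inhabited (S.stalk x) := fun x => ⟨0⟩
      obtain ⟨s, hs, hc⟩ := exists_section_through S.isLocalHomeomorph_base (f y) v
      refine ⟨fun z => ⟨z, s (f z)⟩, ?_, by simp [hs], by simp⟩
      rw [continuousAt_pullback_iff]
      exact ⟨continuousAt_id, hc.self_of_nhds.comp (f := f) hf.continuousAt⟩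
  continuous_sub := by
    refine continuous_sub_of fun Z _ b s t z₀ hs ht => ?_
    rw [continuousAt_pullback_iff] at hs ht ⊢
    exact ⟨hs.1, continuousAt_sub (S := S) (b := fun z => f (b z)) hs.2 ht.2⟩

end Pullback

section Quotient

variable {X : Type u} [TopologicalSpace X]

/-- A subsheaf of abelian groups: an open family of subgroups of the stalks. -/
structure Sub (S : AbSheaf X) where
  sub : ∀ x, AddSubgroup (S.stalk x)
  isOpen : IsOpen {e : Total S.stalk | e.val ∈ sub e.base}

variable {S : AbSheaf X} (N : S.Sub)

/-- The map of étale spaces `S → S / N`. -/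
def Sub.proj (e : Total S.stalk) : Total fun x => S.stalk x ⧸ N.sub x :=
  ⟨e.base, QuotientAddGroup.mk e.val⟩

instance Sub.quotientTop : TopologicalSpace (Total fun x => S.stalk x ⧸ N.sub x) :=
  TopologicalSpace.coinduced N.proj inferInstance

theorem Sub.continuous_proj : Continuous N.proj := continuous_coinduced_rng

theorem Sub.isOpenMap_proj : IsOpenMap N.proj := by
  intro V hV
  rw [isOpen_coinduced, isOpen_iff_mem_nhds]
  rintro ⟨x, v⟩ ⟨⟨x', w⟩, hw, he⟩
  obtain rfl : x' = x := congrArg Total.base he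
  have he' : (QuotientAddGroup.mk w : S.stalk x' ⧸ N.sub x') = QuotientAddGroup.mk v := by
    simpa [Sub.proj] using he
  have hn : -v + w ∈ N.sub x' := QuotientAddGroup.eq.1 he'.symm
  let _ : ∀ x, Inhabited (S.stalk x) := fun x => ⟨0⟩
  obtain ⟨ν, hν, hc⟩ := exists_section_through S.isLocalHomeomorph_base x' (-v + w)
  have hνN : ∀ᶠ y in 𝓝 x', ν y ∈ N.sub y :=
    hc.self_of_nhds.preimage_mem_nhds (N.isOpen.mem_nhds (by simpa [hν] using hn))
  have hadd : ContinuousAt (fun e : Total S.stalk => (⟨e.base, e.val + ν e.base⟩ : Total S.stalk))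
      ⟨x', v⟩ := by
    refine continuousAt_add (b := fun e : Total S.stalk => e.base) continuousAt_id ?_
    exact hc.self_of_nhds.comp (f := fun e : Total S.stalk => e.base) (x := ⟨x', v⟩)
      S.continuous_base.continuousAt
  have hV' : V ∈ 𝓝 (⟨x', v + ν x'⟩ : Total S.stalk) := by
    rw [hν]; simpa using hV.mem_nhds hw
  have hb := (S.continuous_base.continuousAt (x := ⟨x', v⟩)).preimage_mem_nhds hνN
  filter_upwards [hadd.preimage_mem_nhds hV', hb] with e h1 h2
  refine ⟨_, h1, ?_⟩
  have h3 : (QuotientAddGroup.mk (e.val + ν e.base) : S.stalk e.base ⧸ N.sub e.base) =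
      QuotientAddGroup.mk e.val := by
    refine (QuotientAddGroup.eq.2 ?_).symm
    simpa using h2
  simp only [Sub.proj, h3]

theorem Sub.isLocalHomeomorph_base_quotient :
    IsLocalHomeomorph (Total.base : Total (fun x => S.stalk x ⧸ N.sub x) → X) := by
  have hc : Continuous (Total.base : Total (fun x => S.stalk x ⧸ N.sub x) → X) :=
    continuous_coinduced_dom.2 S.continuous_base
  have hsurj : ∀ e, ∃ e', N.proj e' = e := by
    rintro ⟨x, v⟩
    obtain ⟨w, rfl⟩ := QuotientAddGroup.mk_surjective v
    exact ⟨⟨x, w⟩, rfl⟩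
  refine isLocalHomeomorph_of_sections _ hc ?_ ?_
  · intro e
    obtain ⟨e, rfl⟩ := hsurj e
    obtain ⟨U, hU, hi⟩ := exists_injOn S.isLocalHomeomorph_base e
    refine ⟨_, N.isOpenMap_proj.image_mem_nhds hU, ?_⟩
    rintro _ ⟨e1, h1, rfl⟩ _ ⟨e2, h2, rfl⟩ h
    rw [hi h1 h2 h]
  · intro e
    obtain ⟨e, rfl⟩ := hsurj e
    obtain ⟨σ, h1, h2, h3⟩ := exists_localSection S.isLocalHomeomorph_base e
    exact ⟨fun b => N.proj (σ b), N.continuous_proj.continuousAt.comp h1, congrArg N.proj h2, h3⟩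

/-- The quotient sheaf `S / N`, with stalks `S_x / N_x`. -/
def Sub.quotient : AbSheaf X where
  stalk x := S.stalk x ⧸ N.sub x
  top := N.quotientTop
  isLocalHomeomorph_base := N.isLocalHomeomorph_base_quotient
  continuous_sub := by
    refine continuous_sub_of fun Z _ b s t z₀ hs ht => ?_
    let _ : ∀ x, Inhabited (S.stalk x) := fun x => ⟨0⟩
    have hb : ContinuousAt b z₀ :=
      N.isLocalHomeomorph_base_quotient.continuous.continuousAt.comp hs
    obtain ⟨v, hv⟩ := QuotientAddGroup.mk_surjective (s z₀)
    obtain ⟨w, hw⟩ := QuotientAddGroup.mk_surjective (t z₀)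
    obtain ⟨α, hα, hαc⟩ := exists_section_through S.isLocalHomeomorph_base (b z₀) v
    obtain ⟨β, hβ, hβc⟩ := exists_section_through S.isLocalHomeomorph_base (b z₀) w
    have lift : ∀ γ : ∀ x, S.stalk x,
        ContinuousAt (fun y => (⟨y, γ y⟩ : Total S.stalk)) (b z₀) →
        ContinuousAt (fun z => (⟨b z, QuotientAddGroup.mk (γ (b z))⟩ :
          Total fun x => S.stalk x ⧸ N.sub x)) z₀ := fun γ hγ =>
      (N.continuous_proj.continuousAt.comp hγ).comp (f := b) hb
    have h1 := eventually_eq_of_eq N.isLocalHomeomorph_base_quotient hs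
      (lift α hαc.self_of_nhds) (by rw [hα, hv])
    have h2 := eventually_eq_of_eq N.isLocalHomeomorph_base_quotient ht
      (lift β hβc.self_of_nhds) (by rw [hβ, hw])
    refine (lift (fun x => α x - β x) (continuousAt_sub (b := fun x : X => x)
      hαc.self_of_nhds hβc.self_of_nhds)).congr ?_
    filter_upwards [h1, h2] with z e1 e2
    rw [e1, e2]
    rfl

/-- The subsheaf `S_U ⊆ S` for `U` open: the stalks outside `U` are set to zero. -/
def extByZero (S : AbSheaf X) (U : Set X) (hU : IsOpen U) : S.Sub where
  sub x :=
    { carrier := {v | x ∉ U → v = 0}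
      zero_mem' := fun _ => rfl
      add_mem' := fun hv hw hx => by rw [hv hx, hw hx, add_zero]
      neg_mem' := fun hv hx => by rw [hv hx, neg_zero] }
  isOpen := by
    rw [isOpen_iff_mem_nhds]
    rintro ⟨x, v⟩ hv
    by_cases hx : x ∈ U
    · filter_upwards [S.continuous_base.continuousAt.preimage_mem_nhds
        (hU.mem_nhds (show (⟨x, v⟩ : Total S.stalk).base ∈ U from hx))] with e he h
      exact absurd he h
    · obtain rfl : v = 0 := hv hx
      filter_upwards [eventually_eq_of_eq S.isLocalHomeomorph_base
        (b := fun e : Total S.stalk => e.base) (s := fun e => e.val) (t := fun e => 0)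
        (z₀ := ⟨x, 0⟩) continuousAt_id (continuousAt_zero S.continuous_base.continuousAt) rfl]
        with e he _
      exact he

end Quotient

end AbSheaf

/-! ### Pushing forward compactly supported sections along local homeomorphisms -/

theorem finsum_sigma_of_finite {ι : Type*} {β : ι → Type*} {M : Type*} [AddCommMonoid M]
    (F : (Σ i, β i) → M) (hF : (Function.support F).Finite) :
    ∑ᶠ p, F p = ∑ᶠ i, ∑ᶠ b, F ⟨i, b⟩ := by
  classical
  let s := hF.toFinset
  let I := s.image Sigma.fst
  let t : ∀ i, Finset (β i) := fun i => s.preimage (Sigma.mk i) sigma_mk_injective.injOn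
  have h1 : ∀ i, ∑ᶠ b, F ⟨i, b⟩ = ∑ b ∈ t i, F ⟨i, b⟩ := fun i =>
    finsum_eq_sum_of_support_subset _ fun b hb => by simpa [t, s] using hb
  have h2 : ∑ᶠ i, ∑ᶠ b, F ⟨i, b⟩ = ∑ i ∈ I, ∑ᶠ b, F ⟨i, b⟩ := by
    refine finsum_eq_sum_of_support_subset _ fun i hi => ?_
    rw [Function.mem_support, h1] at hi
    obtain ⟨b, hb, -⟩ := Finset.exists_ne_zero_of_sum_ne_zero hi
    exact Finset.mem_coe.2 (Finset.mem_image.2 ⟨⟨i, b⟩, by simpa [t] using hb, rfl⟩)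
  rw [h2, finsum_eq_sum_of_support_subset F (s := I.sigma t), Finset.sum_sigma]
  · exact Finset.sum_congr rfl fun i _ => (h1 i).symm
  · rintro ⟨i, b⟩ h
    have hs : (⟨i, b⟩ : Σ i, β i) ∈ s := hF.mem_toFinset.2 h
    exact Finset.mem_coe.2 (Finset.mem_sigma.2
      ⟨Finset.mem_image.2 ⟨_, hs, rfl⟩, by simpa [t] using hs⟩)

/-- A Hausdorff space together with a sheaf of abelian groups. -/
structure SheafSpace : Type (u + 1) where
  carrier : Type u
  [top : TopologicalSpace carrier]
  [t2 : T2Space carrier]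
  sheaf : AbSheaf carrier

attribute [instance] SheafSpace.top SheafSpace.t2

namespace SheafSpace

/-- A morphism `(Y, T) → (Z, T')`: a local homeomorphism `f : Y → Z` and a morphism of sheaves
`T → f^* T'`. -/
@[ext]
structure Hom (P Q : SheafSpace.{u}) : Type u where
  f : P.carrier → Q.carrier
  isLocalHomeomorph : IsLocalHomeomorph f
  φ : ∀ y, P.sheaf.stalk y →+ Q.sheaf.stalk (f y)
  continuous_φ : Continuous fun e : Total P.sheaf.stalk =>
    (⟨f e.base, φ e.base e.val⟩ : Total Q.sheaf.stalk)

instance : Category SheafSpace.{u} where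
  Hom := Hom
  id P := ⟨id, (Homeomorph.refl _).isLocalHomeomorph, fun _ => AddMonoidHom.id _, continuous_id⟩
  comp F H := ⟨H.f ∘ F.f, H.isLocalHomeomorph.comp F.isLocalHomeomorph,
    fun y => (H.φ (F.f y)).comp (F.φ y), H.continuous_φ.comp F.continuous_φ⟩

variable {P Q R : SheafSpace.{u}}

theorem finite_fibre (F : Hom P Q) {t : ∀ y, P.sheaf.stalk y} (ht : t ∈ P.sheaf.sectionsC)
    (z : Q.carrier) : {y : {y // F.f y = z} | t y ≠ 0}.Finite := by
  have h : (F.f ⁻¹' {z} ∩ {y | t y ≠ 0}).Finite := by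
    have hc : IsCompact (F.f ⁻¹' {z} ∩ {y | t y ≠ 0}) :=
      ht.2.inter_left (isClosed_singleton.preimage F.isLocalHomeomorph.continuous)
    refine hc.finite ?_
    rw [isDiscrete_iff_forall_mem_exists_isOpen]
    rintro y ⟨hy, hty⟩
    obtain ⟨U, hU, hi⟩ := exists_injOn F.isLocalHomeomorph y
    refine ⟨interior U, isOpen_interior, Set.eq_singleton_iff_unique_mem.2
      ⟨⟨mem_interior_iff_mem_nhds.2 hU, hy, hty⟩, ?_⟩⟩
    rintro y' ⟨hy'U, hy', -⟩
    exact hi (interior_subset hy'U) (mem_of_mem_nhds hU) (Eq.trans hy' (Eq.symm hy))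
  refine Set.Finite.of_finite_image (f := Subtype.val) (h.subset ?_) Subtype.val_injective.injOn
  rintro _ ⟨y, hy, rfl⟩
  exact ⟨y.2, hy⟩

/-- The push-forward of a compactly supported section `t`, summing over the fibres of `f`:
`z ↦ ∑_{f y = z} φ_y (t y)`. -/
noncomputable def push (F : Hom P Q) (t : ∀ y, P.sheaf.stalk y) (z : Q.carrier) :
    Q.sheaf.stalk z :=
  ∑ᶠ y : {y // F.f y = z}, Q.sheaf.tr y.2 (F.φ y (t y))

theorem finite_support_push (F : Hom P Q) {t : ∀ y, P.sheaf.stalk y}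
    (ht : t ∈ P.sheaf.sectionsC) (z : Q.carrier) :
    (Function.support fun y : {y // F.f y = z} => Q.sheaf.tr y.2 (F.φ y (t y))).Finite := by
  refine (finite_fibre F ht z).subset fun y hy h => hy ?_
  simp only [h, map_zero]

theorem push_ne_zero (F : Hom P Q) {t : ∀ y, P.sheaf.stalk y} {z : Q.carrier}
    (h : push F t z ≠ 0) : ∃ y, t y ≠ 0 ∧ F.f y = z := by
  by_contra hc
  push Not at hc
  refine h (finsum_eq_zero_of_forall_eq_zero fun y => ?_)
  have : t y = 0 := by
    by_contra h'
    exact hc y h' y.2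
  simp only [this, map_zero]

theorem continuousAt_push (F : Hom P Q) {t : ∀ y, P.sheaf.stalk y}
    (ht : t ∈ P.sheaf.sectionsC) (z₀ : Q.carrier) :
    ContinuousAt (fun z => (⟨z, push F t z⟩ : Total Q.sheaf.stalk)) z₀ := by
  classical
  let A : Finset P.carrier := (finite_fibre F ht z₀).toFinset.image Subtype.val
  have hA : ∀ y, y ∈ A ↔ F.f y = z₀ ∧ t y ≠ 0 := by
    intro y
    simp only [A, Finset.mem_image, Set.Finite.mem_toFinset, Set.mem_ofPred_eq]
    exact ⟨fun ⟨y', h, e⟩ => e ▸ ⟨y'.2, h⟩, fun h => ⟨⟨y, h.1⟩, h.2, rfl⟩⟩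
  -- disjoint neighbourhoods of the points of the fibre
  obtain ⟨V, hV, hVd⟩ := A.finite_toSet.t2_separation
  have hsec := fun y : P.carrier => exists_localSection F.isLocalHomeomorph y
  choose σ hσc hσe hσf using hsec
  let sec : P.carrier → ∀ z, Q.sheaf.stalk z := fun y z =>
    if h : F.f (σ y z) = z then Q.sheaf.tr h (F.φ _ (t (σ y z))) else 0
  have hsec : ∀ y ∈ A, ContinuousAt (fun z => (⟨z, sec y z⟩ : Total Q.sheaf.stalk)) z₀ := by
    intro y hy
    obtain ⟨rfl, -⟩ := (hA y).1 hy
    have h1 : ContinuousAt (fun z => (⟨F.f (σ y z), F.φ _ (t (σ y z))⟩ : Total Q.sheaf.stalk))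
        (F.f y) :=
      (F.continuous_φ.comp ht.1).continuousAt.comp (hσc y)
    refine h1.congr ?_
    filter_upwards [hσf y] with z hz
    simp only [sec, dif_pos hz, AbSheaf.mk_tr]
  refine (AbSheaf.continuousAt_sum (b := fun z => z) continuousAt_id A sec hsec).congr ?_
  choose U hU hUi using fun y => exists_injOn F.isLocalHomeomorph y
  let W : P.carrier → Set P.carrier := fun y => V y ∩ interior (U y)
  have hWo : ∀ y, IsOpen (W y) := fun y => (hV y).2.inter isOpen_interior
  have hWy : ∀ y, y ∈ W y := fun y => ⟨(hV y).1, mem_interior_iff_mem_nhds.2 (hU y)⟩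
  have e1 : ∀ᶠ z in 𝓝 z₀, ∀ y ∈ A, F.f (σ y z) = z ∧ σ y z ∈ W y := by
    rw [Filter.eventually_all_finset]
    intro y hy
    obtain ⟨rfl, -⟩ := (hA y).1 hy
    exact (hσf y).and ((hσc y).preimage_mem_nhds (by rw [hσe]; exact (hWo y).mem_nhds (hWy y)))
  have e2 : ∀ᶠ z in 𝓝 z₀, z ∉ F.f '' ({y | t y ≠ 0} \ ⋃ y ∈ A, W y) := by
    have hK : IsCompact ({y | t y ≠ 0} \ ⋃ y ∈ A, W y) :=
      ht.2.diff (isOpen_biUnion fun y _ => hWo y)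
    refine (hK.image F.isLocalHomeomorph.continuous).isClosed.isOpen_compl.mem_nhds ?_
    rintro ⟨y, ⟨hy, hyW⟩, hyz⟩
    exact hyW (Set.mem_iUnion₂.2 ⟨y, (hA y).2 ⟨hyz, hy⟩, hWy y⟩)
  filter_upwards [e1, e2] with z h1 h2
  congr 1
  let p : {y // y ∈ A} → {y // F.f y = z} := fun y => ⟨σ y.1 z, (h1 y.1 y.2).1⟩
  have hp : Function.Injective p := by
    rintro ⟨y, hy⟩ ⟨y', hy'⟩ h
    have h' : σ y z = σ y' z := congrArg Subtype.val h
    by_contra hne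
    have hd := hVd hy hy' fun h => hne (Subtype.ext h)
    exact Set.disjoint_left.1 hd (h1 y hy).2.1 (by rw [h']; exact (h1 y' hy').2.1)
  rw [push, finsum_eq_sum_of_support_subset _ (s := A.attach.image p),
    Finset.sum_image fun _ _ _ _ h => hp h, ← Finset.sum_attach]
  · refine Finset.sum_congr rfl fun y _ => ?_
    simp only [sec, dif_pos (h1 y.1 y.2).1, p]
  · rintro ⟨y', rfl⟩ hy'
    have hty' : t y' ≠ 0 := fun h => hy' (by simp only [h, map_zero])
    by_contra hc
    refine h2 ⟨y', ⟨hty', fun hmem => hc ?_⟩, rfl⟩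
    obtain ⟨y, hy, hyW⟩ := Set.mem_iUnion₂.1 hmem
    refine Finset.mem_coe.2 (Finset.mem_image.2 ⟨⟨y, hy⟩, Finset.mem_attach _ _, ?_⟩)
    exact Subtype.ext (hUi y (interior_subset (h1 y hy).2.2) (interior_subset hyW.2) (h1 y hy).1)

theorem push_mem (F : Hom P Q) {t : ∀ y, P.sheaf.stalk y} (ht : t ∈ P.sheaf.sectionsC) :
    push F t ∈ Q.sheaf.sectionsC := by
  have h : Q.sheaf.IsSection (push F t) := continuous_iff_continuousAt.2 (continuousAt_push F ht)
  refine ⟨h, (ht.2.image F.isLocalHomeomorph.continuous).of_isClosed_subset h.isClosed_ne_zero ?_⟩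
  intro z hz
  obtain ⟨y, hy, rfl⟩ := push_ne_zero F hz
  exact ⟨y, hy, rfl⟩

/-- The push-forward as a homomorphism `Γ_c(Y; T) → Γ_c(Z; T')`. -/
noncomputable def pushHom (F : Hom P Q) : P.sheaf.sectionsC →+ Q.sheaf.sectionsC :=
  AddMonoidHom.mk' (fun t => ⟨push F t.1, push_mem F t.2⟩) fun s t => by
    refine Subtype.ext (funext fun z => ?_)
    change push F (s.1 + t.1) z = push F s.1 z + push F t.1 z
    rw [push, push, push, ← finsum_add_distrib (finite_support_push F s.2 z)
      (finite_support_push F t.2 z)]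
    exact finsum_congr fun y => by simp only [Pi.add_apply, map_add]

/-- The functor of compactly supported sections, covariant for local homeomorphisms. -/
noncomputable def sectionsFunctor : SheafSpace.{u} ⥤ AddCommGrpCat.{u} where
  obj P := AddCommGrpCat.of P.sheaf.sectionsC
  map F := AddCommGrpCat.ofHom (pushHom F)
  map_id P := by
    refine AddCommGrpCat.hom_ext (AddMonoidHom.ext fun t => Subtype.ext (funext fun z => ?_))
    change push (𝟙 P : Hom P P) t.1 z = t.1 z
    let _ : Unique {y : P.carrier // (𝟙 P : Hom P P).f y = z} :=
      ⟨⟨⟨z, rfl⟩⟩, fun y => Subtype.ext y.2⟩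
    rw [push, finsum_unique]
    rfl
  map_comp {P Q R} F H := by
    refine AddCommGrpCat.hom_ext (AddMonoidHom.ext fun t => Subtype.ext (funext fun w => ?_))
    change push (F ≫ H : Hom P R) t.1 w = push H (push F t.1) w
    let e : (Σ z : {z // Hom.f H z = w}, {y // Hom.f F y = z}) ≃
        {y // Hom.f (F ≫ H) y = w} :=
      { toFun := fun p => ⟨p.2.1, (congrArg H.f p.2.2).trans p.1.2⟩
        invFun := fun y => ⟨⟨F.f y.1, y.2⟩, ⟨y.1, rfl⟩⟩
        left_inv := by
          rintro ⟨⟨z, hz⟩, ⟨y, hy⟩⟩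
          dsimp only at hy
          subst hy
          rfl
        right_inv := fun _ => rfl }
    have hfin := finite_support_push (F ≫ H : Hom P R) t.2 w
    rw [push, ← finsum_comp_equiv e, finsum_sigma_of_finite _
      (hfin.preimage e.injective.injOn), push]
    refine finsum_congr ?_
    rintro ⟨z, rfl⟩
    rw [push, AbSheaf.tr_rfl, AddMonoidHom.map_finsum _ (finite_support_push F t.2 z)]
    refine finsum_congr ?_
    rintro ⟨y, hy⟩
    dsimp only at hy
    subst hy
    rfl

end SheafSpace

/-! ### Étale groupoids -/

/-- A groupoid with object (base) space `X` and set of arrows `G`. An arrow `g` has range `r g` and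
source `s g`, and `mul g h` is defined when `s g = r h`. -/
structure Grpd (X G : Type u) where
  r : G → X
  s : G → X
  one : X → G
  inv : G → G
  mul : ∀ g h : G, s g = r h → G
  r_one : ∀ x, r (one x) = x
  s_one : ∀ x, s (one x) = x
  r_inv : ∀ g, r (inv g) = s g
  s_inv : ∀ g, s (inv g) = r g
  r_mul : ∀ g h e, r (mul g h e) = r g
  s_mul : ∀ g h e, s (mul g h e) = s h
  mul_assoc : ∀ g h k (e : s g = r h) (e' : s h = r k),
    mul (mul g h e) k ((s_mul g h e).trans e') = mul g (mul h k e') (e.trans (r_mul h k e').symm)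
  one_mul : ∀ g, mul (one (r g)) g (s_one _) = g
  mul_one : ∀ g, mul g (one (s g)) (r_one _).symm = g
  inv_mul : ∀ g, mul (inv g) g (s_inv g) = one (s g)
  mul_inv : ∀ g, mul g (inv g) (r_inv g).symm = one (r g)

namespace Grpd

section Algebra

variable {X G : Type u} (𝒢 : Grpd X G)

theorem inv_mul_mul {g h k : G} (e : 𝒢.s g = 𝒢.r h) (hk : 𝒢.mul g h e = k) :
    𝒢.mul (𝒢.inv g) k ((𝒢.s_inv g).trans (by rw [← hk, 𝒢.r_mul])) = h := by
  subst hk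
  rw [← 𝒢.mul_assoc _ _ _ (𝒢.s_inv g) e]
  have : ∀ (u : G) (x : X) (hu : u = 𝒢.one x) (hx : x = 𝒢.r h) (e' : 𝒢.s u = 𝒢.r h),
      𝒢.mul u h e' = h := by
    rintro u x rfl rfl _
    exact 𝒢.one_mul h
  exact this _ _ (𝒢.inv_mul g) e _

theorem inv_inv (g : G) : 𝒢.inv (𝒢.inv g) = g := by
  have h1 := 𝒢.inv_mul_mul (𝒢.s_inv g) (𝒢.inv_mul g)
  have : ∀ (x : X) (hx : x = 𝒢.s (𝒢.inv (𝒢.inv g))) (e : 𝒢.s (𝒢.inv (𝒢.inv g)) = 𝒢.r (𝒢.one x)),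
      𝒢.mul (𝒢.inv (𝒢.inv g)) (𝒢.one x) e = 𝒢.inv (𝒢.inv g) := by
    rintro x rfl e
    exact 𝒢.mul_one _
  rw [this _ (by rw [𝒢.s_inv, 𝒢.r_inv])] at h1
  exact h1

end Algebra

/-- `𝒢` is a locally compact Hausdorff étale groupoid. (The base space is then also locally compact
and Hausdorff, as `one` embeds it in the arrow space as a closed subspace.) -/
structure IsEtale {X G : Type u} [TopologicalSpace X] [TopologicalSpace G] (𝒢 : Grpd X G) :
    Prop where
  t2 : T2Space G
  locallyCompact : LocallyCompactSpace G
  isLocalHomeomorph_r : IsLocalHomeomorph 𝒢.r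
  continuous_s : Continuous 𝒢.s
  continuous_one : Continuous 𝒢.one
  continuous_inv : Continuous 𝒢.inv
  continuous_mul : Continuous fun p : {p : G × G // 𝒢.s p.1 = 𝒢.r p.2} => 𝒢.mul p.1.1 p.1.2 p.2

/-- A continuous homomorphism of topological groupoids. -/
structure Hom {Y H X G : Type u} [TopologicalSpace Y] [TopologicalSpace H] [TopologicalSpace X]
    [TopologicalSpace G] (ℋ : Grpd Y H) (𝒢 : Grpd X G) where
  obj : Y → X
  arr : H → G
  continuous_obj : Continuous obj
  continuous_arr : Continuous arr
  r_arr : ∀ g, 𝒢.r (arr g) = obj (ℋ.r g)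
  s_arr : ∀ g, 𝒢.s (arr g) = obj (ℋ.s g)
  arr_one : ∀ x, arr (ℋ.one x) = 𝒢.one (obj x)
  arr_mul : ∀ g h e, arr (ℋ.mul g h e) =
    𝒢.mul (arr g) (arr h) ((s_arr g).trans ((congrArg obj e).trans (r_arr h).symm))

/-- The space `𝒢^(n)` of composable strings `x_0 ← x_1 ← ⋯ ← x_n`. A string of arrows `g_1, …, g_n`
is recorded together with all its partial products: `arr i j` is the arrow from `x_j` to `x_i`,
so that `g_i = arr (i-1) i`, `arr i j = g_{i+1} ⋯ g_j` for `i ≤ j`, and `arr j i` is the inverse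
of `arr i j`. -/
@[ext]
structure Str {X G : Type u} (𝒢 : Grpd X G) (n : ℕ) : Type u where
  obj : Fin (n + 1) → X
  arr : Fin (n + 1) → Fin (n + 1) → G
  r_arr : ∀ i j, 𝒢.r (arr i j) = obj i
  s_arr : ∀ i j, 𝒢.s (arr i j) = obj j
  arr_self : ∀ i, arr i i = 𝒢.one (obj i)
  arr_mul : ∀ i j k, 𝒢.mul (arr i j) (arr j k) ((s_arr i j).trans (r_arr j k).symm) = arr i k

namespace Str

section

variable {X G : Type u} {𝒢 : Grpd X G} {n m k : ℕ}

/-- The string `x_{φ 0} ← ⋯ ← x_{φ m}` obtained from `x_0 ← ⋯ ← x_n` and a map of indices `φ`; for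
the injection `φ` that omits `i` this is the `i`-th face map. -/
def reindex (φ : Fin (m + 1) → Fin (n + 1)) (a : Str 𝒢 n) : Str 𝒢 m where
  obj i := a.obj (φ i)
  arr i j := a.arr (φ i) (φ j)
  r_arr _ _ := a.r_arr _ _
  s_arr _ _ := a.s_arr _ _
  arr_self _ := a.arr_self _
  arr_mul _ _ _ := a.arr_mul _ _ _

/-- The string with `arr j k = b_j⁻¹ b_k`. -/
def ofStar (𝒢 : Grpd X G) (x : X) (b : Fin (n + 1) → G) (hb : ∀ j, 𝒢.r (b j) = x) : Str 𝒢 n where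
  obj j := 𝒢.s (b j)
  arr j k := 𝒢.mul (𝒢.inv (b j)) (b k) ((𝒢.s_inv _).trans ((hb j).trans (hb k).symm))
  r_arr j k := by rw [𝒢.r_mul, 𝒢.r_inv]
  s_arr j k := by rw [𝒢.s_mul]
  arr_self j := 𝒢.inv_mul _
  arr_mul i j k := by
    have e0 : 𝒢.s (b j) = 𝒢.r (𝒢.inv (b j)) := (𝒢.r_inv _).symm
    refine (𝒢.mul_assoc _ _ _ _ (e0.trans (𝒢.r_mul _ _ _).symm)).trans ?_
    congr 1
    have e1 : 𝒢.s (𝒢.inv (b j)) = 𝒢.r (b k) := by rw [𝒢.s_inv, hb, hb]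
    have := 𝒢.inv_mul_mul (g := 𝒢.inv (b j)) e1 rfl
    conv_rhs => rw [← this]
    congr 1
    exact (𝒢.inv_inv _).symm

theorem ofStar_arr (a : Str 𝒢 n) (i : Fin (n + 1)) :
    ofStar 𝒢 (a.obj i) (a.arr i) (a.r_arr i) = a := by
  refine Str.ext (funext fun j => a.s_arr i j) (funext fun j => funext fun k => ?_)
  exact 𝒢.inv_mul_mul ((a.s_arr i j).trans (a.r_arr j k).symm) (a.arr_mul i j k)

theorem eq_of_arr_eq {a b : Str 𝒢 n} (i : Fin (n + 1)) (h : a.obj i = b.obj i)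
    (h' : ∀ j, a.arr i j = b.arr i j) : a = b := by
  rw [← ofStar_arr a i, ← ofStar_arr b i]
  have h' : a.arr i = b.arr i := funext h'
  congr 1

end

section

variable {X G : Type u} [TopologicalSpace X] [TopologicalSpace G] {𝒢 : Grpd X G} {n m : ℕ}

/-- The subspace topology. -/
instance : TopologicalSpace (Str 𝒢 n) :=
  TopologicalSpace.induced (fun a => (a.obj, a.arr)) inferInstance

theorem isInducing_objArr : IsInducing (fun a : Str 𝒢 n => (a.obj, a.arr)) := ⟨rfl⟩

theorem continuous_obj (i : Fin (n + 1)) : Continuous fun a : Str 𝒢 n => a.obj i :=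
  (continuous_apply i).comp (continuous_fst.comp isInducing_objArr.continuous)

theorem continuous_arr (i j : Fin (n + 1)) : Continuous fun a : Str 𝒢 n => a.arr i j :=
  (continuous_apply_apply i j).comp (continuous_snd.comp isInducing_objArr.continuous)

theorem continuousAt_of {Z : Type*} [TopologicalSpace Z] {f : Z → Str 𝒢 n} {z : Z}
    (h₁ : ∀ i, ContinuousAt (fun z => (f z).obj i) z)
    (h₂ : ∀ i j, ContinuousAt (fun z => (f z).arr i j) z) : ContinuousAt f z :=
  isInducing_objArr.continuousAt_iff.2 ((continuousAt_pi.2 h₁).prodMk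
    (continuousAt_pi.2 fun i => continuousAt_pi.2 fun j => h₂ i j))

theorem continuous_reindex (φ : Fin (m + 1) → Fin (n + 1)) :
    Continuous (reindex φ : Str 𝒢 n → Str 𝒢 m) :=
  continuous_iff_continuousAt.2 fun _ => continuousAt_of
    (fun _ => (continuous_obj _).continuousAt) fun _ _ => (continuous_arr _ _).continuousAt

end

end Str

namespace IsEtale

variable {X G : Type u} [TopologicalSpace X] [TopologicalSpace G] {𝒢 : Grpd X G}
  {n m : ℕ}

theorem t2_base (h : 𝒢.IsEtale) : T2Space X := by
  have := h.t2
  refine T2Space.of_injective_continuous (f := 𝒢.one) (fun x y hxy => ?_) h.continuous_one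
  rw [← 𝒢.r_one x, hxy, 𝒢.r_one]

theorem t2_str (h : 𝒢.IsEtale) : T2Space (Str 𝒢 n) := by
  have := h.t2
  have := h.t2_base
  refine T2Space.of_injective_continuous (f := fun a : Str 𝒢 n => (a.obj, a.arr))
    (fun a b hab => ?_) Str.isInducing_objArr.continuous
  exact Str.ext (congrArg Prod.fst hab) (congrArg Prod.snd hab)

theorem continuousAt_mul (h : 𝒢.IsEtale) {Z : Type*} [TopologicalSpace Z] {f g : Z → G} {z : Z}
    (e : ∀ z, 𝒢.s (f z) = 𝒢.r (g z)) (hf : ContinuousAt f z) (hg : ContinuousAt g z) :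
    ContinuousAt (fun z => 𝒢.mul (f z) (g z) (e z)) z := by
  let p : Z → {p : G × G // 𝒢.s p.1 = 𝒢.r p.2} := fun z => ⟨(f z, g z), e z⟩
  have hp : ContinuousAt p z :=
    Topology.IsInducing.subtypeVal.continuousAt_iff.2 (hf.prodMk hg)
  exact h.continuous_mul.continuousAt.comp hp

theorem isLocalHomeomorph_obj (h : 𝒢.IsEtale) (i : Fin (n + 1)) :
    IsLocalHomeomorph fun a : Str 𝒢 n => a.obj i := by
  classical
  refine isLocalHomeomorph_of_sections _ (Str.continuous_obj i) ?_ ?_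
  · intro a
    choose U hU hi using fun j => exists_injOn h.isLocalHomeomorph_r (a.arr i j)
    refine ⟨{b | ∀ j, b.arr i j ∈ U j}, ?_, ?_⟩
    · have : ∀ᶠ b in 𝓝 a, ∀ j, b.arr i j ∈ U j := Filter.eventually_all.2 fun j =>
        (Str.continuous_arr i j).continuousAt.preimage_mem_nhds (hU j)
      exact this
    · intro b hb c hc hbc
      refine Str.eq_of_arr_eq i hbc fun j => hi j (hb j) (hc j) ?_
      rw [b.r_arr, c.r_arr]
      exact hbc
  · intro a
    choose σ hσ hσe hσr using fun j => exists_localSection h.isLocalHomeomorph_r (a.arr i j)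
    simp only [a.r_arr] at hσ hσe hσr
    let V : Set X := {x | ∀ j, 𝒢.r (σ j x) = x}
    have hV : V ∈ 𝓝 (a.obj i) := Filter.eventually_all.2 hσr
    let c : X → X := fun x => if x ∈ V then x else a.obj i
    let b : X → Fin (n + 1) → G := fun x j =>
      if x ∈ V then (if j = i then 𝒢.one x else σ j x) else a.arr i j
    have hb : ∀ x j, 𝒢.r (b x j) = c x := by
      intro x j
      by_cases hx : x ∈ V
      · by_cases hj : j = i
        · simp only [b, c, if_pos hx, if_pos hj, 𝒢.r_one]
        · simp only [b, c, if_pos hx, if_neg hj, hx j]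
      · simp only [b, c, if_neg hx, a.r_arr]
    have hbc : ∀ j, ContinuousAt (fun x => b x j) (a.obj i) := by
      intro j
      by_cases hj : j = i
      · refine h.continuous_one.continuousAt.congr ?_
        filter_upwards [hV] with x hx
        simp only [b, if_pos hx, if_pos hj]
      · refine (hσ j).congr ?_
        filter_upwards [hV] with x hx
        simp only [b, if_pos hx, if_neg hj]
    have hba : b (a.obj i) = a.arr i := by
      funext j
      by_cases hj : j = i
      · subst hj
        simp only [b, if_pos (mem_of_mem_nhds hV), if_true, a.arr_self]
      · simp only [b, if_pos (mem_of_mem_nhds hV), if_neg hj, hσe]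
    refine ⟨fun x => Str.ofStar 𝒢 (c x) (b x) (hb x), Str.continuousAt_of (fun j => ?_)
      fun j k => ?_, ?_, ?_⟩
    · exact h.continuous_s.continuousAt.comp (hbc j)
    · exact h.continuousAt_mul (f := fun x => 𝒢.inv (b x j)) (g := fun x => b x k) _
        (h.continuous_inv.continuousAt.comp (hbc j)) (hbc k)
    · refine Str.eq_of_arr_eq i ?_ fun j => ?_
      · change 𝒢.s (b (a.obj i) i) = a.obj i
        rw [hba, a.s_arr]
      · change 𝒢.mul (𝒢.inv (b (a.obj i) i)) (b (a.obj i) j) _ = a.arr i j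
        refine 𝒢.inv_mul_mul (by rw [hba, a.s_arr, a.r_arr]) ?_
        have := a.arr_mul i i j
        simpa only [hba] using this
    · filter_upwards [hV] with x hx
      change 𝒢.s (b x i) = x
      simp only [b, if_pos hx, if_true, 𝒢.s_one]

theorem isLocalHomeomorph_reindex (h : 𝒢.IsEtale) (φ : Fin (m + 1) → Fin (n + 1)) :
    IsLocalHomeomorph (Str.reindex φ : Str 𝒢 n → Str 𝒢 m) :=
  IsLocalHomeomorph.of_comp (g := fun a : Str 𝒢 m => a.obj 0) (h.isLocalHomeomorph_obj (φ 0))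
    (h.isLocalHomeomorph_obj 0) (Str.continuous_reindex φ)

end IsEtale

namespace Hom

variable {Y H X G : Type u} [TopologicalSpace Y] [TopologicalSpace H] [TopologicalSpace X]
  [TopologicalSpace G] {ℋ : Grpd Y H} {𝒢 : Grpd X G} (F : ℋ.Hom 𝒢) {n : ℕ}

/-- The map `ℋ^(n) → 𝒢^(n)` induced by a homomorphism. -/
def str (a : Str ℋ n) : Str 𝒢 n where
  obj i := F.obj (a.obj i)
  arr i j := F.arr (a.arr i j)
  r_arr i j := by rw [F.r_arr, a.r_arr]
  s_arr i j := by rw [F.s_arr, a.s_arr]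
  arr_self i := by rw [a.arr_self, F.arr_one]
  arr_mul i j k := by rw [← F.arr_mul _ _ ((a.s_arr i j).trans (a.r_arr j k).symm), a.arr_mul]

theorem continuous_str : Continuous (F.str : Str ℋ n → Str 𝒢 n) :=
  continuous_iff_continuousAt.2 fun _ => Str.continuousAt_of
    (fun _ => (F.continuous_obj.comp (Str.continuous_obj _)).continuousAt)
    fun _ _ => (F.continuous_arr.comp (Str.continuous_arr _ _)).continuousAt

theorem isLocalHomeomorph_str (hH : ℋ.IsEtale) (hG : 𝒢.IsEtale) (hF : IsLocalHomeomorph F.obj) :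
    IsLocalHomeomorph (F.str : Str ℋ n → Str 𝒢 n) :=
  IsLocalHomeomorph.of_comp (g := fun a : Str 𝒢 n => a.obj 0)
    (hF.comp (hH.isLocalHomeomorph_obj 0)) (hG.isLocalHomeomorph_obj 0) F.continuous_str

end Hom

end Grpd

/-! ### Equivariant sheaves -/

/-- A `𝒢`-sheaf: a sheaf of abelian groups on the base space together with a continuous action of
`𝒢` on its étale space over the base, by homomorphisms between stalks. An arrow `g` from `x` to `y`
acts as a homomorphism `S_x → S_y`. -/
structure GSheaf {X G : Type u} [TopologicalSpace X] [TopologicalSpace G] (𝒢 : Grpd X G) where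
  sheaf : AbSheaf X
  act : ∀ {x y : X} (g : G), 𝒢.s g = x → 𝒢.r g = y → (sheaf.stalk x →+ sheaf.stalk y)
  act_one : ∀ (x : X) (v : sheaf.stalk x), act (𝒢.one x) (𝒢.s_one x) (𝒢.r_one x) v = v
  act_mul : ∀ (g h : G) (e : 𝒢.s g = 𝒢.r h) (v : sheaf.stalk (𝒢.s h)),
    act (𝒢.mul g h e) (𝒢.s_mul g h e) (𝒢.r_mul g h e) v = act g e rfl (act h rfl rfl v)
  continuous_act : Continuous fun p : {p : G × Total sheaf.stalk // 𝒢.s p.1 = p.2.base} =>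
    (⟨𝒢.r p.1.1, act p.1.1 p.2 rfl p.1.2.val⟩ : Total sheaf.stalk)

namespace GSheaf

section

variable {X G : Type u} [TopologicalSpace X] [TopologicalSpace G] {𝒢 : Grpd X G}

theorem act_one' (S : GSheaf 𝒢) {x : X} {g : G} (hg : g = 𝒢.one x) (hs : 𝒢.s g = x)
    (hr : 𝒢.r g = x) (v : S.sheaf.stalk x) : S.act g hs hr v = v := by
  subst hg
  exact S.act_one x v

theorem act_mul' (S : GSheaf 𝒢) {x y z : X} {g h k : G} (e : 𝒢.s g = 𝒢.r h)
    (hk : 𝒢.mul g h e = k) (h1 : 𝒢.s h = x) (h2 : 𝒢.r h = y) (h3 : 𝒢.s g = y) (h4 : 𝒢.r g = z)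
    (h5 : 𝒢.s k = x) (h6 : 𝒢.r k = z) (v : S.sheaf.stalk x) :
    S.act k h5 h6 v = S.act g h3 h4 (S.act h h1 h2 v) := by
  subst hk h1 h2 h4
  exact S.act_mul g h e v

theorem continuous_act' (S : GSheaf 𝒢) {Z : Type*} [TopologicalSpace Z] {x y : Z → X} {g : Z → G}
    {v : ∀ z, S.sheaf.stalk (x z)} (hs : ∀ z, 𝒢.s (g z) = x z) (hr : ∀ z, 𝒢.r (g z) = y z)
    (hg : Continuous g) (hv : Continuous fun z => (⟨x z, v z⟩ : Total S.sheaf.stalk)) :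
    Continuous fun z => (⟨y z, S.act (g z) (hs z) (hr z) (v z)⟩ : Total S.sheaf.stalk) := by
  obtain rfl : (fun z => 𝒢.r (g z)) = y := funext hr
  let p : Z → {p : G × Total S.sheaf.stalk // 𝒢.s p.1 = p.2.base} :=
    fun z => ⟨(g z, ⟨x z, v z⟩), hs z⟩
  have hp : Continuous p := (hg.prodMk hv).subtype_mk _
  exact S.continuous_act.comp hp

/-- A morphism of `𝒢`-sheaves. -/
structure Hom (S T : GSheaf 𝒢) where
  φ : ∀ x, S.sheaf.stalk x →+ T.sheaf.stalk x
  continuous_φ : Continuous fun e : Total S.sheaf.stalk =>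
    (⟨e.base, φ e.base e.val⟩ : Total T.sheaf.stalk)
  equivariant : ∀ {x y : X} (g : G) (hs : 𝒢.s g = x) (hr : 𝒢.r g = y) (v : S.sheaf.stalk x),
    φ y (S.act g hs hr v) = T.act g hs hr (φ x v)

/-- The sheaf `S_n = τ_n^* S` on `𝒢^(n)`, where `τ_n` sends `x_0 ← ⋯ ← x_n` to `x_0`. -/
def onStr (S : GSheaf 𝒢) (n : ℕ) : AbSheaf (Grpd.Str 𝒢 n) :=
  S.sheaf.pullback (fun a => a.obj 0) (Grpd.Str.continuous_obj 0)

end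

section

variable {Y H X G : Type u} [TopologicalSpace Y] [TopologicalSpace H] [TopologicalSpace X]
  [TopologicalSpace G] {ℋ : Grpd Y H} {𝒢 : Grpd X G}

/-- The pullback of a `𝒢`-sheaf along a continuous homomorphism `ℋ → 𝒢`. -/
def pullback (S : GSheaf 𝒢) (h : ℋ.IsEtale) (F : ℋ.Hom 𝒢) : GSheaf ℋ where
  sheaf := S.sheaf.pullback F.obj F.continuous_obj
  act {x y} g hs hr := S.act (x := F.obj x) (y := F.obj y) (F.arr g)
    ((F.s_arr g).trans (congrArg F.obj hs)) ((F.r_arr g).trans (congrArg F.obj hr))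
  act_one x v := S.act_one' (F.arr_one x) _ _ v
  act_mul g h e v := S.act_mul' _ (F.arr_mul g h e).symm _ _ _ _ _ _ v
  continuous_act := by
    have hpr : Continuous fun p : {p : H × Total (S.sheaf.PullbackStalk F.obj) //
        ℋ.s p.1 = p.2.base} => p.1.2 := continuous_snd.comp continuous_subtype_val
    have harr : Continuous fun p : {p : H × Total (S.sheaf.PullbackStalk F.obj) //
        ℋ.s p.1 = p.2.base} => F.arr p.1.1 :=
      F.continuous_arr.comp (continuous_fst.comp continuous_subtype_val)
    refine S.sheaf.continuous_pullback_mk F.obj ?_ ?_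
    · exact h.isLocalHomeomorph_r.continuous.comp (continuous_fst.comp continuous_subtype_val)
    · exact S.continuous_act' _ _ harr ((S.sheaf.continuous_pullbackProj F.obj).comp hpr)

/-- The pullback of a morphism of `𝒢`-sheaves. -/
def Hom.pullback {S T : GSheaf 𝒢} (α : S.Hom T) (h : ℋ.IsEtale) (F : ℋ.Hom 𝒢) :
    (S.pullback h F).Hom (T.pullback h F) where
  φ y := α.φ (F.obj y)
  continuous_φ := S.sheaf.continuous_pullback_base F.obj |> fun hb =>
    T.sheaf.continuous_pullback_mk F.obj hb
      (α.continuous_φ.comp (S.sheaf.continuous_pullbackProj F.obj))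
  equivariant g _ _ v := α.equivariant (F.arr g) _ _ v

end

end GSheaf

/-- A complex `S^0 → S^1 → ⋯` of `𝒢`-sheaves. -/
structure GComplex {X G : Type u} [TopologicalSpace X] [TopologicalSpace G] (𝒢 : Grpd X G) where
  S : ℕ → GSheaf 𝒢
  d : ∀ q, (S q).Hom (S (q + 1))
  d_d : ∀ q x (v : (S q).sheaf.stalk x), (d (q + 1)).φ x ((d q).φ x v) = 0

/-- The pullback of a complex of `𝒢`-sheaves along a continuous homomorphism. -/
def GComplex.pullback {Y H X G : Type u} [TopologicalSpace Y] [TopologicalSpace H]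
    [TopologicalSpace X] [TopologicalSpace G] {ℋ : Grpd Y H} {𝒢 : Grpd X G} (C : GComplex 𝒢)
    (h : ℋ.IsEtale) (F : ℋ.Hom 𝒢) : GComplex ℋ where
  S q := (C.S q).pullback h F
  d q := (C.d q).pullback h F
  d_d q x v := C.d_d q (F.obj x) v

/-- `0 → A → S^0 → S^1 → ⋯` can be completed to a resolution of `A` by `c`-soft `𝒢`-sheaves:
each `S^q` is `c`-soft, and for some morphism `A → S^0` the sequence is exact on all stalks. -/
def GComplex.IsCSoftResolution {X G : Type u} [TopologicalSpace X] [TopologicalSpace G]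
    {𝒢 : Grpd X G} (C : GComplex 𝒢) (A : GSheaf 𝒢) : Prop :=
  (∀ q, (C.S q).sheaf.IsCSoft) ∧
    ∃ ε : A.Hom (C.S 0), ∀ x, Function.Injective (ε.φ x) ∧
      Function.Exact (ε.φ x) ((C.d 0).φ x) ∧
      ∀ q, Function.Exact ((C.d q).φ x) ((C.d (q + 1)).φ x)

/-! ### The simplicial groups of compactly supported sections -/

section Nerve

open Opposite

variable {X G : Type u} [TopologicalSpace X] [TopologicalSpace G] {𝒢 : Grpd X G}

/-- The space `𝒢^(n)` with the sheaf `S_n`. -/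
def GSheaf.strSpace (S : GSheaf 𝒢) (h : 𝒢.IsEtale) (n : ℕ) : SheafSpace.{u} :=
  have := h.t2_str (n := n)
  ⟨Grpd.Str 𝒢 n, S.onStr n⟩

/-- The morphism `(𝒢^(n), S_n) → (𝒢^(m), S_m)` induced by a map of indices `φ`. As `S_n` has stalk
`S_{x_0}` at `x_0 ← ⋯ ← x_n`, and `S_m` has stalk `S_{x_{φ 0}}` at the image of this string, the
morphism of sheaves is the action of the arrow from `x_0` to `x_{φ 0}`. -/
def GSheaf.strHom (S : GSheaf 𝒢) (h : 𝒢.IsEtale) {n m : ℕ} (φ : Fin (m + 1) → Fin (n + 1)) :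
    SheafSpace.Hom (S.strSpace h n) (S.strSpace h m) where
  f := Grpd.Str.reindex φ
  isLocalHomeomorph := h.isLocalHomeomorph_reindex φ
  φ a := S.act (x := a.obj 0) (y := a.obj (φ 0)) (a.arr (φ 0) 0) (a.s_arr _ _) (a.r_arr _ _)
  continuous_φ :=
    have hb := S.sheaf.continuous_pullback_base fun a : Grpd.Str 𝒢 n => a.obj 0
    S.sheaf.continuous_pullback_mk (fun a : Grpd.Str 𝒢 m => a.obj 0)
      ((Grpd.Str.continuous_reindex φ).comp hb)
      (S.continuous_act' _ _ ((Grpd.Str.continuous_arr (φ 0) 0).comp hb)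
        (S.sheaf.continuous_pullbackProj _))

/-- The simplicial object `n ↦ (𝒢^(n), S_n)`. -/
def GSheaf.nerve (S : GSheaf 𝒢) (h : 𝒢.IsEtale) : SimplicialObject SheafSpace.{u} where
  obj n := S.strSpace h n.unop.len
  map φ := S.strHom h φ.unop.toOrderHom
  map_id n := by
    refine SheafSpace.Hom.ext rfl (heq_of_eq (funext fun a => AddMonoidHom.ext fun v => ?_))
    exact S.act_one' (a.arr_self 0) _ _ v
  map_comp φ ψ := by
    refine SheafSpace.Hom.ext rfl (heq_of_eq (funext fun a => AddMonoidHom.ext fun v => ?_))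
    exact S.act_mul' _ (a.arr_mul _ _ _) _ _ _ _ _ _ v

/-- The morphism of simplicial objects induced by a morphism of `𝒢`-sheaves. -/
def GSheaf.Hom.nerve {S T : GSheaf 𝒢} (α : S.Hom T) (h : 𝒢.IsEtale) : S.nerve h ⟶ T.nerve h where
  app n :=
    { f := id
      isLocalHomeomorph := (Homeomorph.refl _).isLocalHomeomorph
      φ := fun a => α.φ (a.obj 0)
      continuous_φ :=
        have hb := S.sheaf.continuous_pullback_base fun a : Grpd.Str 𝒢 n.unop.len => a.obj 0
        have hp := S.sheaf.continuous_pullbackProj fun a : Grpd.Str 𝒢 n.unop.len => a.obj 0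
        T.sheaf.continuous_pullback_mk (fun a : Grpd.Str 𝒢 n.unop.len => a.obj 0) hb
          (α.continuous_φ.comp hp) }
  naturality n m φ := by
    refine SheafSpace.Hom.ext rfl (heq_of_eq (funext fun a => AddMonoidHom.ext fun v => ?_))
    exact α.equivariant _ _ _ v

/-- The morphism of simplicial objects induced by a homomorphism `ℋ → 𝒢` that is a local
homeomorphism on base spaces. -/
def GSheaf.nerveMap {Y H : Type u} [TopologicalSpace Y] [TopologicalSpace H] {ℋ : Grpd Y H}
    (S : GSheaf 𝒢) (hH : ℋ.IsEtale) (hG : 𝒢.IsEtale) (F : ℋ.Hom 𝒢)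
    (hF : IsLocalHomeomorph F.obj) : (S.pullback hH F).nerve hH ⟶ S.nerve hG where
  app n :=
    { f := F.str
      isLocalHomeomorph := F.isLocalHomeomorph_str hH hG hF
      φ := fun _ => AddMonoidHom.id _
      continuous_φ :=
        have hb := (S.pullback hH F).sheaf.continuous_pullback_base
          fun a : Grpd.Str ℋ n.unop.len => a.obj 0
        have hp := (S.pullback hH F).sheaf.continuous_pullbackProj
          fun a : Grpd.Str ℋ n.unop.len => a.obj 0
        S.sheaf.continuous_pullback_mk (fun a : Grpd.Str 𝒢 n.unop.len => a.obj 0)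
          (F.continuous_str.comp hb) ((S.sheaf.continuous_pullbackProj F.obj).comp hp) }
  naturality _ _ _ := rfl

end Nerve

/-! ### Open subgroupoids and relative homology -/

/-- The morphism induced on quotient sheaves by a morphism that respects the given subsheaves. -/
def SheafSpace.Hom.quotient {P Q : SheafSpace.{u}} (F : SheafSpace.Hom P Q) (N : P.sheaf.Sub)
    (N' : Q.sheaf.Sub) (hF : ∀ y, ∀ v ∈ N.sub y, F.φ y v ∈ N'.sub (F.f y)) :
    SheafSpace.Hom ⟨P.carrier, N.quotient⟩ ⟨Q.carrier, N'.quotient⟩ where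
  f := F.f
  isLocalHomeomorph := F.isLocalHomeomorph
  φ y := QuotientAddGroup.map (N.sub y) (N'.sub (F.f y)) (F.φ y) (hF y)
  continuous_φ := continuous_coinduced_dom.2 (N'.continuous_proj.comp F.continuous_φ)

theorem SheafSpace.Hom.map_extByZero {P Q : SheafSpace.{u}} (F : SheafSpace.Hom P Q)
    {U : Set P.carrier} {hU : IsOpen U} {U' : Set Q.carrier} {hU' : IsOpen U'}
    (h : ∀ y ∈ U, F.f y ∈ U') (y : P.carrier) (v : P.sheaf.stalk y)
    (hv : v ∈ (P.sheaf.extByZero U hU).sub y) :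
    F.φ y v ∈ (Q.sheaf.extByZero U' hU').sub (F.f y) := fun hy => by
  rw [show v = 0 from hv fun hy' => hy (h y hy'), map_zero]

/-- The projection to a quotient sheaf. -/
def SheafSpace.Hom.toQuotient (P : SheafSpace.{u}) (N : P.sheaf.Sub) :
    SheafSpace.Hom P ⟨P.carrier, N.quotient⟩ where
  f := id
  isLocalHomeomorph := (Homeomorph.refl _).isLocalHomeomorph
  φ y := QuotientAddGroup.mk' (N.sub y)
  continuous_φ := N.continuous_proj

theorem SheafSpace.Hom.ext_quotient {P Q : SheafSpace.{u}} (N : P.sheaf.Sub)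
    {F H : SheafSpace.Hom ⟨P.carrier, N.quotient⟩ Q} (hf : F.f = H.f)
    (h : ∀ y (v : P.sheaf.stalk y), (⟨F.f y, F.φ y (QuotientAddGroup.mk (s := N.sub y) v)⟩ :
      Total Q.sheaf.stalk) = ⟨H.f y, H.φ y (QuotientAddGroup.mk (s := N.sub y) v)⟩) : F = H := by
  obtain ⟨f, hf₁, φ, hφ⟩ := F
  obtain ⟨f', hf₁', φ', hφ'⟩ := H
  obtain rfl : f = f' := hf
  refine SheafSpace.Hom.ext rfl (heq_of_eq (funext fun y => AddMonoidHom.ext fun v => ?_))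
  obtain ⟨v, rfl⟩ := QuotientAddGroup.mk_surjective (s := N.sub y) v
  exact eq_of_heq (Total.mk.inj (h y v)).2

theorem SheafSpace.Hom.eq_zero_of_quotient {P Q : SheafSpace.{u}} (N : P.sheaf.Sub)
    (F : SheafSpace.Hom ⟨P.carrier, N.quotient⟩ Q)
    (h : ∀ y (v : P.sheaf.stalk y), F.φ y (QuotientAddGroup.mk (s := N.sub y) v) = 0)
    (y : P.carrier) (v : N.quotient.stalk y) : F.φ y v = 0 := by
  obtain ⟨v, rfl⟩ := QuotientAddGroup.mk_surjective (s := N.sub y) v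
  exact h y v

/-- An open subgroupoid of `𝒢` with the same base space. -/
structure OpenSubgroupoid {X G : Type u} [TopologicalSpace G] (𝒢 : Grpd X G) where
  carrier : Set G
  isOpen : IsOpen carrier
  one_mem : ∀ x, 𝒢.one x ∈ carrier
  inv_mem : ∀ g ∈ carrier, 𝒢.inv g ∈ carrier
  mul_mem : ∀ g ∈ carrier, ∀ h ∈ carrier, ∀ e, 𝒢.mul g h e ∈ carrier

namespace OpenSubgroupoid

variable {X G : Type u} [TopologicalSpace X] [TopologicalSpace G] {𝒢 : Grpd X G}
  (𝒢' : OpenSubgroupoid 𝒢)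

/-- The subgroupoid as a groupoid, with the subspace topology on its arrows. -/
def grpd : Grpd X 𝒢'.carrier where
  r g := 𝒢.r g
  s g := 𝒢.s g
  one x := ⟨𝒢.one x, 𝒢'.one_mem x⟩
  inv g := ⟨𝒢.inv g, 𝒢'.inv_mem g g.2⟩
  mul g h e := ⟨𝒢.mul g h e, 𝒢'.mul_mem g g.2 h h.2 e⟩
  r_one := 𝒢.r_one
  s_one := 𝒢.s_one
  r_inv g := 𝒢.r_inv g
  s_inv g := 𝒢.s_inv g
  r_mul g h e := 𝒢.r_mul g h e
  s_mul g h e := 𝒢.s_mul g h e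
  mul_assoc g h k e e' := Subtype.ext (𝒢.mul_assoc g h k e e')
  one_mul g := Subtype.ext (𝒢.one_mul g)
  mul_one g := Subtype.ext (𝒢.mul_one g)
  inv_mul g := Subtype.ext (𝒢.inv_mul g)
  mul_inv g := Subtype.ext (𝒢.mul_inv g)

variable {𝒢'} in
theorem isEtale (h : 𝒢.IsEtale) : 𝒢'.grpd.IsEtale where
  t2 := have := h.t2; inferInstance
  locallyCompact := have := h.locallyCompact; 𝒢'.isOpen.locallyCompactSpace
  isLocalHomeomorph_r :=
    h.isLocalHomeomorph_r.comp 𝒢'.isOpen.isOpenEmbedding_subtypeVal.isLocalHomeomorph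
  continuous_s := h.continuous_s.comp continuous_subtype_val
  continuous_one := h.continuous_one.subtype_mk _
  continuous_inv := (h.continuous_inv.comp continuous_subtype_val).subtype_mk _
  continuous_mul := by
    refine Continuous.subtype_mk ?_ _
    have hp : Continuous fun p : {p : 𝒢'.carrier × 𝒢'.carrier // 𝒢'.grpd.s p.1 = 𝒢'.grpd.r p.2} =>
        (⟨(p.1.1.1, p.1.2.1), p.2⟩ : {p : G × G // 𝒢.s p.1 = 𝒢.r p.2}) := by
      refine Continuous.subtype_mk ?_ _
      exact (continuous_subtype_val.comp (continuous_fst.comp continuous_subtype_val)).prodMk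
        (continuous_subtype_val.comp (continuous_snd.comp continuous_subtype_val))
    exact h.continuous_mul.comp hp

/-- The inclusion homomorphism. -/
def incl : 𝒢'.grpd.Hom 𝒢 where
  obj := id
  arr := Subtype.val
  continuous_obj := continuous_id
  continuous_arr := continuous_subtype_val
  r_arr _ := rfl
  s_arr _ := rfl
  arr_one _ := rfl
  arr_mul _ _ _ := rfl

/-- The open subspace `(𝒢')^(n)` of `𝒢^(n)`. -/
def str (n : ℕ) : Set (Grpd.Str 𝒢 n) := {a | ∀ i j, a.arr i j ∈ 𝒢'.carrier}

theorem isOpen_str (n : ℕ) : IsOpen (𝒢'.str n) := by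
  have : 𝒢'.str n = ⋂ i, ⋂ j, {a | a.arr i j ∈ 𝒢'.carrier} := by
    ext a; simp [str]
  rw [this]
  exact isOpen_iInter_of_finite fun i => isOpen_iInter_of_finite fun j =>
    𝒢'.isOpen.preimage (Grpd.Str.continuous_arr i j)

/-- The subsheaf of `S_n` obtained by setting all stalks outside `(𝒢')^(n)` to zero. -/
def sub (S : GSheaf 𝒢) (n : ℕ) : (S.onStr n).Sub :=
  (S.onStr n).extByZero (𝒢'.str n) (𝒢'.isOpen_str n)

/-- The simplicial object `n ↦ (𝒢^(n), S_n / (S_n)_{(𝒢')^(n)})`, the quotient sheaf being the one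
that is supported on the closed subspace `𝒢^(n) ∖ (𝒢')^(n)`. -/
def relNerve (S : GSheaf 𝒢) (h : 𝒢.IsEtale) : SimplicialObject SheafSpace.{u} where
  obj n :=
    have := h.t2_str (n := n.unop.len)
    ⟨Grpd.Str 𝒢 n.unop.len, (𝒢'.sub S n.unop.len).quotient⟩
  map {n m} φ := (S.strHom h φ.unop.toOrderHom).quotient (𝒢'.sub S n.unop.len)
    (𝒢'.sub S m.unop.len) ((S.strHom h φ.unop.toOrderHom).map_extByZero fun _ ha i j => ha _ _)
  map_id n := by
    refine SheafSpace.Hom.ext rfl (heq_of_eq (funext fun a => AddMonoidHom.ext fun v => ?_))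
    obtain ⟨v, rfl⟩ := QuotientAddGroup.mk_surjective v
    exact congrArg QuotientAddGroup.mk (S.act_one' (a.arr_self 0) _ _ v)
  map_comp φ ψ := by
    refine SheafSpace.Hom.ext rfl (heq_of_eq (funext fun a => AddMonoidHom.ext fun v => ?_))
    obtain ⟨v, rfl⟩ := QuotientAddGroup.mk_surjective v
    exact congrArg QuotientAddGroup.mk (S.act_mul' _ (a.arr_mul _ _ _) _ _ _ _ _ _ v)

/-- The morphism of simplicial objects induced by a morphism of `𝒢`-sheaves. -/
def relNerveHom {S T : GSheaf 𝒢} (α : S.Hom T) (h : 𝒢.IsEtale) :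
    𝒢'.relNerve S h ⟶ 𝒢'.relNerve T h where
  app n := ((α.nerve h).app n).quotient (𝒢'.sub S n.unop.len) (𝒢'.sub T n.unop.len)
    (SheafSpace.Hom.map_extByZero ((α.nerve h).app n) fun _ ha => ha)
  naturality n m φ := by
    refine SheafSpace.Hom.ext_quotient (P := S.strSpace h n.unop.len) (𝒢'.sub S n.unop.len) rfl
      fun a v => ?_
    exact congrArg (fun w => (𝒢'.sub T m.unop.len).proj ⟨_, w⟩) (α.equivariant _ _ _ v)

/-- The quotient morphism `(𝒢^(n), S_n) → (𝒢^(n), S_n / (S_n)_{(𝒢')^(n)})`. -/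
def toRelNerve (S : GSheaf 𝒢) (h : 𝒢.IsEtale) : S.nerve h ⟶ 𝒢'.relNerve S h where
  app n := SheafSpace.Hom.toQuotient (S.strSpace h n.unop.len) (𝒢'.sub S n.unop.len)
  naturality _ _ _ := rfl

end OpenSubgroupoid

/-! ### Homology -/

section Homology

variable {X G : Type u} [TopologicalSpace X] [TopologicalSpace G] {𝒢 : Grpd X G}

theorem SheafSpace.sectionsFunctor_map_eq_zero {P Q : SheafSpace.{u}} (F : P ⟶ Q)
    (hF : ∀ y v, Hom.φ F y v = 0) : sectionsFunctor.map F = 0 := by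
  refine AddCommGrpCat.hom_ext (AddMonoidHom.ext fun t => Subtype.ext (funext fun z => ?_))
  refine finsum_eq_zero_of_forall_eq_zero fun y => ?_
  rw [hF, map_zero]

/-- A complex `N 0 → N 1 → ⋯` of simplicial objects gives a complex of simplicial abelian groups
`p ↦ Γ_c((N q)_p)`. -/
noncomputable def sectionsComplex (N : ℕ → SimplicialObject SheafSpace.{u})
    (d : ∀ q, N q ⟶ N (q + 1))
    (hd : ∀ q n y v, SheafSpace.Hom.φ ((d q ≫ d (q + 1)).app n) y v = 0) :
    CochainComplex (SimplicialObject AddCommGrpCat.{u}) ℕ :=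
  CochainComplex.of (fun q => N q ⋙ SheafSpace.sectionsFunctor)
    (fun q => Functor.whiskerRight (d q) SheafSpace.sectionsFunctor)
    fun q => by
      rw [← Functor.whiskerRight_comp]
      exact NatTrans.ext (funext fun n => SheafSpace.sectionsFunctor_map_eq_zero _ (hd q n))

theorem sectionsComplex_d (N : ℕ → SimplicialObject SheafSpace.{u}) (d : ∀ q, N q ⟶ N (q + 1))
    (hd : ∀ q n y v, SheafSpace.Hom.φ ((d q ≫ d (q + 1)).app n) y v = 0) (q : ℕ) :
    (sectionsComplex N d hd).d q (q + 1) =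
      Functor.whiskerRight (d q) SheafSpace.sectionsFunctor := by
  simp [sectionsComplex]

/-- The double complex with entries `Γ_c((N q)_p)`; the differential in the `p`-direction is the
alternating sum of the maps induced by the face maps. -/
noncomputable def sectionsBicomplex (N : ℕ → SimplicialObject SheafSpace.{u})
    (d : ∀ q, N q ⟶ N (q + 1))
    (hd : ∀ q n y v, SheafSpace.Hom.φ ((d q ≫ d (q + 1)).app n) y v = 0) :
    HomologicalComplex₂ AddCommGrpCat.{u} (ComplexShape.up ℕ) (ComplexShape.down ℕ) :=
  ((AlgebraicTopology.alternatingFaceMapComplex AddCommGrpCat.{u}).mapHomologicalComplex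
    (ComplexShape.up ℕ)).obj (sectionsComplex N d hd)

/-- The morphism of double complexes induced by a morphism of complexes of simplicial objects. -/
noncomputable def sectionsBicomplexMap {N N' : ℕ → SimplicialObject SheafSpace.{u}}
    {d : ∀ q, N q ⟶ N (q + 1)} {d' : ∀ q, N' q ⟶ N' (q + 1)}
    {hd : ∀ q n y v, SheafSpace.Hom.φ ((d q ≫ d (q + 1)).app n) y v = 0}
    {hd' : ∀ q n y v, SheafSpace.Hom.φ ((d' q ≫ d' (q + 1)).app n) y v = 0}
    (α : ∀ q, N q ⟶ N' q) (hα : ∀ q, α q ≫ d' q = d q ≫ α (q + 1)) :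
    sectionsBicomplex N d hd ⟶ sectionsBicomplex N' d' hd' :=
  ((AlgebraicTopology.alternatingFaceMapComplex AddCommGrpCat.{u}).mapHomologicalComplex
    (ComplexShape.up ℕ)).map
    (CochainComplex.ofHom (X := sectionsComplex N d hd) (Y := sectionsComplex N' d' hd')
      (fun q => Functor.whiskerRight (α q) SheafSpace.sectionsFunctor)
      fun q => by
        rw [sectionsComplex_d, sectionsComplex_d]
        exact (Functor.whiskerRight_comp _ _ _).symm.trans
          ((congrArg (fun β => Functor.whiskerRight β SheafSpace.sectionsFunctor) (hα q)).trans
            (Functor.whiskerRight_comp _ _ _)))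

/-- The total complex of a double complex in bidegrees `(q, p)` has the entry of bidegree `(q, p)`
in degree `p - q`. -/
instance totalShape : TotalComplexShape (ComplexShape.up ℕ) (ComplexShape.down ℕ)
    (ComplexShape.down ℤ) where
  π i := (i.2 : ℤ) - i.1
  ε₁ _ := 1
  ε₂ i := (-1) ^ i.1
  rel₁ {q q'} h p := by
    have h : q + 1 = q' := h
    change ((p : ℤ) - q') + 1 = p - q
    omega
  rel₂ q {p p'} h := by
    have h : p' + 1 = p := h
    change ((p' : ℤ) - q) + 1 = p - q
    omega
  ε₂_ε₁ {q q'} {p p'} h _ := by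
    have h : q + 1 = q' := h
    subst h
    simp [pow_succ]

/-- The double complex with entries `Γ_c(𝒢^(p); S^q_p)`. -/
noncomputable def GComplex.bicomplex (C : GComplex 𝒢) (h : 𝒢.IsEtale) :
    HomologicalComplex₂ AddCommGrpCat.{u} (ComplexShape.up ℕ) (ComplexShape.down ℕ) :=
  sectionsBicomplex (fun q => (C.S q).nerve h) (fun q => (C.d q).nerve h)
    fun q _ a v => C.d_d q (a.obj 0) v

/-- For a `c`-soft resolution `C` of `A`, this is the homology group `H_n(𝒢; A)`, computed
from `C`. -/
noncomputable def GComplex.homology (C : GComplex 𝒢) (h : 𝒢.IsEtale) (n : ℤ) :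
    AddCommGrpCat.{u} :=
  ((C.bicomplex h).total (ComplexShape.down ℤ)).homology n

namespace OpenSubgroupoid

variable (𝒢' : OpenSubgroupoid 𝒢)

/-- The double complex with entries `Γ_c(𝒢^(p); S^q_p / (S^q_p)_{(𝒢')^(p)})`. -/
noncomputable def relBicomplex (C : GComplex 𝒢) (h : 𝒢.IsEtale) :
    HomologicalComplex₂ AddCommGrpCat.{u} (ComplexShape.up ℕ) (ComplexShape.down ℕ) :=
  sectionsBicomplex (fun q => 𝒢'.relNerve (C.S q) h) (fun q => 𝒢'.relNerveHom (C.d q) h)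
    fun q n => SheafSpace.Hom.eq_zero_of_quotient (P := (C.S q).strSpace h n.unop.len)
      (𝒢'.sub (C.S q) n.unop.len) _ fun a v => congrArg QuotientAddGroup.mk (C.d_d q (a.obj 0) v)

/-- For a `c`-soft resolution `C` of `A`, this is the relative homology group `H_n(𝒢/𝒢'; A)`,
computed from `C`. -/
noncomputable def relHomology (C : GComplex 𝒢) (h : 𝒢.IsEtale) (n : ℤ) : AddCommGrpCat.{u} :=
  ((𝒢'.relBicomplex C h).total (ComplexShape.down ℤ)).homology n

/-- The restriction of a complex of `𝒢`-sheaves to the open subgroupoid `𝒢'`. -/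
def res (C : GComplex 𝒢) (h : 𝒢.IsEtale) : GComplex 𝒢'.grpd :=
  C.pullback (isEtale h) 𝒢'.incl

/-- The map of double complexes `Γ_c((𝒢')^(p); S^q_p) → Γ_c(𝒢^(p); S^q_p)` given by extension of
sections by zero. -/
noncomputable def inclBicomplex (C : GComplex 𝒢) (h : 𝒢.IsEtale) :
    (𝒢'.res C h).bicomplex (isEtale h) ⟶ C.bicomplex h :=
  sectionsBicomplexMap
    (fun q => (C.S q).nerveMap (isEtale h) h 𝒢'.incl (Homeomorph.refl X).isLocalHomeomorph)
    fun _ => rfl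

/-- The map of double complexes `Γ_c(𝒢^(p); S^q_p) → Γ_c(𝒢^(p); S^q_p / (S^q_p)_{(𝒢')^(p)})`. -/
noncomputable def quotBicomplex (C : GComplex 𝒢) (h : 𝒢.IsEtale) :
    C.bicomplex h ⟶ 𝒢'.relBicomplex C h :=
  sectionsBicomplexMap (fun q => 𝒢'.toRelNerve (C.S q) h) fun _ => rfl

/-- The map of total complexes that induces `H_n(𝒢'; A) → H_n(𝒢; A)`. -/
noncomputable def inclTotal (C : GComplex 𝒢) (h : 𝒢.IsEtale) :
    ((𝒢'.res C h).bicomplex (isEtale h)).total (ComplexShape.down ℤ) ⟶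
      (C.bicomplex h).total (ComplexShape.down ℤ) :=
  HomologicalComplex₂.total.map (𝒢'.inclBicomplex C h) _

/-- The map of total complexes that induces `H_n(𝒢; A) → H_n(𝒢/𝒢'; A)`. -/
noncomputable def quotTotal (C : GComplex 𝒢) (h : 𝒢.IsEtale) :
    (C.bicomplex h).total (ComplexShape.down ℤ) ⟶
      (𝒢'.relBicomplex C h).total (ComplexShape.down ℤ) :=
  HomologicalComplex₂.total.map (𝒢'.quotBicomplex C h) _

/-- For a homomorphism `F : ℋ → 𝒢`, the map of relative double complexes `Φ` is the pullback of
sections along the maps `ℋ^(p) → 𝒢^(p)` induced by `F`: the value at `a` of the pullback of a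
section `t` is represented by any element of the stalk that represents the value of `t` at the
image of `a`. -/
def IsPullbackOfSections {Y H : Type u} [TopologicalSpace Y] [TopologicalSpace H] {ℋ : Grpd Y H}
    (ℋ' : OpenSubgroupoid ℋ) (C : GComplex 𝒢) (hG : 𝒢.IsEtale) (hH : ℋ.IsEtale) (F : ℋ.Hom 𝒢)
    (Φ : 𝒢'.relBicomplex C hG ⟶ ℋ'.relBicomplex (C.pullback hH F) hH) : Prop :=
  ∀ (q p : ℕ) (t : (𝒢'.sub (C.S q) p).quotient.sectionsC) (a : Grpd.Str ℋ p)
    (v : (C.S q).sheaf.stalk (F.obj (a.obj 0))),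
    t.1 (F.str a) = QuotientAddGroup.mk (s := (𝒢'.sub (C.S q) p).sub (F.str a)) v →
    (((Φ.f q).f p).hom t : (ℋ'.sub ((C.pullback hH F).S q) p).quotient.sectionsC).1 a =
      QuotientAddGroup.mk (s := (ℋ'.sub ((C.pullback hH F).S q) p).sub a) v

end OpenSubgroupoid

end Homology

/-! ### The pair of groupoids associated with a regular inclusion -/

namespace OpenSubgroupoid

section

variable {X G : Type u} [TopologicalSpace G] {𝒢 : Grpd X G} (𝒢' : OpenSubgroupoid 𝒢)

/-- The complement `Δ = 𝒢 ∖ 𝒢'`. -/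
def compl : Set G := 𝒢'.carrierᶜ

theorem inv_mem_compl {g : G} (hg : g ∈ 𝒢'.compl) : 𝒢.inv g ∈ 𝒢'.compl := fun h =>
  hg (by simpa only [𝒢.inv_inv] using 𝒢'.inv_mem _ h)

end

variable {X G : Type u} [TopologicalSpace X] [TopologicalSpace G] {𝒢 : Grpd X G}
  (𝒢' : OpenSubgroupoid 𝒢)

/-- The set `r(Δ)`, which is the base space of `ℋ`. -/
def Base : Type u := {x : X // ∃ g ∈ 𝒢'.compl, 𝒢.r g = x}

/-- The range map `Δ → r(Δ)`. -/
def range (g : 𝒢'.compl) : 𝒢'.Base := ⟨𝒢.r g, g, g.2, rfl⟩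

/-- The quotient topology on `r(Δ)` with respect to `r : Δ → r(Δ)`. -/
instance : TopologicalSpace 𝒢'.Base := TopologicalSpace.coinduced 𝒢'.range inferInstance

/-- The inclusion `𝒢' ⊆ 𝒢` is regular: `r : Δ → r(Δ)` is open. -/
def IsRegular : Prop := IsOpenMap 𝒢'.range

/-- The set `ℋ = 𝒢|_{r(Δ)}` of arrows with range and source in `r(Δ)`. -/
def Arr : Type u := {g : G // (∃ a ∈ 𝒢'.compl, 𝒢.r a = 𝒢.r g) ∧ ∃ a ∈ 𝒢'.compl, 𝒢.r a = 𝒢.s g}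

/-- The space `(Δ × Δ) ∩ m⁻¹(𝒢')` of composable pairs in `Δ` with product in `𝒢'`. -/
abbrev Pairs : Type u :=
  {p : G × G // p.1 ∈ 𝒢'.compl ∧ p.2 ∈ 𝒢'.compl ∧
    ∃ e : 𝒢.s p.1 = 𝒢.r p.2, 𝒢.mul p.1 p.2 e ∈ 𝒢'.carrier}

/-- The multiplication `(Δ × Δ) ∩ m⁻¹(𝒢') → ℋ`, whose image is `ℋ' = 𝒢'|_{r(Δ)}`. -/
def pairMul (p : 𝒢'.Pairs) : 𝒢'.Arr :=
  ⟨𝒢.mul p.1.1 p.1.2 p.2.2.2.1, ⟨p.1.1, p.2.1, (𝒢.r_mul _ _ _).symm⟩,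
    ⟨𝒢.inv p.1.2, 𝒢'.inv_mem_compl p.2.2.1, by rw [𝒢.r_inv, 𝒢.s_mul]⟩⟩

/-- The inclusion of `Δ` in `ℋ`. -/
def ofCompl (g : 𝒢'.compl) : 𝒢'.Arr :=
  ⟨g.1, ⟨g.1, g.2, rfl⟩, ⟨𝒢.inv g.1, 𝒢'.inv_mem_compl g.2, 𝒢.r_inv _⟩⟩

/-- The topology of `ℋ = ℋ' ⊔ Δ`: the disjoint union of the quotient topology on `ℋ'` with respect
to `(Δ × Δ) ∩ m⁻¹(𝒢') → ℋ'` and of the subspace topology on `Δ`. -/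
instance : TopologicalSpace 𝒢'.Arr :=
  TopologicalSpace.coinduced (Sum.elim 𝒢'.pairMul 𝒢'.ofCompl) inferInstance

/-- The groupoid `ℋ = 𝒢|_{r(Δ)}`. -/
def excisive : Grpd 𝒢'.Base 𝒢'.Arr where
  r g := ⟨𝒢.r g.1, g.2.1⟩
  s g := ⟨𝒢.s g.1, g.2.2⟩
  one x := ⟨𝒢.one x.1, by rw [𝒢.r_one]; exact x.2, by rw [𝒢.s_one]; exact x.2⟩
  inv g := ⟨𝒢.inv g.1, by rw [𝒢.r_inv]; exact g.2.2, by rw [𝒢.s_inv]; exact g.2.1⟩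
  mul g h e := ⟨𝒢.mul g.1 h.1 (congrArg Subtype.val e), by rw [𝒢.r_mul]; exact g.2.1,
    by rw [𝒢.s_mul]; exact h.2.2⟩
  r_one x := Subtype.ext (𝒢.r_one x.1)
  s_one x := Subtype.ext (𝒢.s_one x.1)
  r_inv g := Subtype.ext (𝒢.r_inv g.1)
  s_inv g := Subtype.ext (𝒢.s_inv g.1)
  r_mul g h e := Subtype.ext (𝒢.r_mul g.1 h.1 _)
  s_mul g h e := Subtype.ext (𝒢.s_mul g.1 h.1 _)
  mul_assoc g h k e e' := Subtype.ext
    (𝒢.mul_assoc g.1 h.1 k.1 (congrArg Subtype.val e) (congrArg Subtype.val e'))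
  one_mul g := Subtype.ext (𝒢.one_mul g.1)
  mul_one g := Subtype.ext (𝒢.mul_one g.1)
  inv_mul g := Subtype.ext (𝒢.inv_mul g.1)
  mul_inv g := Subtype.ext (𝒢.mul_inv g.1)

/-- The open subgroupoid `ℋ' = 𝒢'|_{r(Δ)}` of `ℋ`. -/
def excisiveSub : OpenSubgroupoid 𝒢'.excisive where
  carrier := {g | g.1 ∈ 𝒢'.carrier}
  isOpen := by
    rw [isOpen_coinduced, isOpen_sum_iff]
    constructor
    · convert isOpen_univ
      exact Set.eq_univ_of_forall fun p => p.2.2.2.2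
    · convert isOpen_empty
      exact Set.eq_empty_of_forall_notMem fun g hg => g.2 hg
  one_mem x := 𝒢'.one_mem x.1
  inv_mem g hg := 𝒢'.inv_mem g.1 hg
  mul_mem g hg h hh _ := 𝒢'.mul_mem g.1 hg h.1 hh _

/-- The canonical homomorphism `ι : ℋ → 𝒢`. -/
def excisiveHom (h : 𝒢.IsEtale) : 𝒢'.excisive.Hom 𝒢 where
  obj := Subtype.val
  arr := Subtype.val
  continuous_obj := continuous_coinduced_dom.2
    (h.isLocalHomeomorph_r.continuous.comp continuous_subtype_val)
  continuous_arr := by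
    refine continuous_coinduced_dom.2 (continuous_sum_dom.2 ⟨?_, continuous_subtype_val⟩)
    have hp : Continuous fun p : 𝒢'.Pairs =>
        (⟨p.1, p.2.2.2.1⟩ : {p : G × G // 𝒢.s p.1 = 𝒢.r p.2}) :=
      continuous_subtype_val.subtype_mk _
    exact h.continuous_mul.comp hp
  r_arr _ := rfl
  s_arr _ := rfl
  arr_one _ := rfl
  arr_mul _ _ _ := rfl

end OpenSubgroupoid

end EtaleHomology

open EtaleHomology

set_option linter.unusedSectionVars false

namespace EtaleHomology

/-! ### Sections over compact sets and softness -/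

/-! Resolutions. For an abelian group `J` let `coind J` be the sheaf whose stalk at `x` consists of
germs, in the direction of the base, of arbitrary functions to `J` on the range fibres; arrows act
by translation. No continuity is imposed on the functions, so sections over open sets extend
globally (`isCSoft_coindSheaf`), and a morphism `B → coind J` is the same as an arbitrary family of
homomorphisms `B_x → J`, recovered by evaluation at units (`adj`, `Hom.ext_coind`). For injective
`J` the sheaf `coind J` is therefore injective. Choosing `J` to contain all stalks gives an
embedding; iterating gives the canonical resolution of `A`, and every resolution of `A` maps to it
over the identity of `A` (`exists_hom_resolution`).

Comparison. The mapping cone of such a map is an exact sequence of c-soft sheaves that begins in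
degree 0. Softness survives pullback to the strings, because `x_0` is a local homeomorphism on them
(`soft_pullback`), and a bounded below exact sequence of soft sheaves has exact compactly supported
sections (`exists_sectionsC_of_exact`). So for each fixed `p` the cone is acyclic. An element of a
direct sum total complex meets only finitely many values of `p`, and induction on their number shows
that the map of total complexes is an isomorphism on homology (`exists_of_mem_fil`,
`isIso_homologyMap`).

Open subgroupoids. A compactly supported section that vanishes off an open set is the extension by
zero of a compactly supported section on it, and compactly supported sections of the quotient lift
because extensions by zero of soft sheaves are soft (`soft_extByZero`). This gives the short exact
sequence of double complexes, hence of total complexes. Relative groups are independent of the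
resolution by the five lemma, applied to the comparison map and its restriction to the open
subgroupoid.

Excision. If a string is not in `𝒢'`, each of its objects is the range of some arrow of `Δ` in the
string (`exists_arr_mem_compl`), so the whole string lies in `ℋ`. The closed sets of strings outside
`𝒢'` and outside `ℋ'` thus coincide, and also have the same topology (`continuous_strLift`). The
relative sheaves are supported on these sets, so pullback along `ι` is already an isomorphism of
double complexes. Regularity is what makes `r : Δ → r(Δ)` a local homeomorphism; from its local
sections come those of the range map of `ℋ`, which is then étale. -/

theorem compact_induction {Y : Type*} [TopologicalSpace Y] [T2Space Y] {P Q : Set Y → Prop}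
    {K : Set Y} (hK : IsCompact K) (h0 : P ∅)
    (hloc : ∀ y ∈ K, ∃ U ∈ 𝓝 y, ∀ L, IsCompact L → L ⊆ U → L ⊆ K → Q L)
    (hstep : ∀ A L, IsCompact A → A ⊆ K → IsCompact L → L ⊆ K → P A → Q L → P (A ∪ L)) :
    P K := by
  classical
  choose! U hU hQ using hloc
  obtain ⟨t, htK, ht⟩ := hK.elim_nhds_subcover (fun y => interior (U y))
    fun y hy => interior_mem_nhds.2 (hU y hy)
  -- Shrinking lemma: `K` is a finite union of compact pieces, each inside one of the chosen
  -- neighbourhoods. `Q` holds for the pieces, and they are added to the part already treated one at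
  -- a time.
  obtain ⟨L, hL, hLU, hKL⟩ := hK.finite_compact_cover t (fun y => interior (U y))
    (fun _ _ => isOpen_interior) ht
  have hLK : ∀ y ∈ t, L y ⊆ K := fun y hy => by
    rw [hKL]
    exact Set.subset_biUnion_of_mem (u := L) hy
  have main : ∀ t' : Finset Y, t' ⊆ t → P (⋃ y ∈ t', L y) := by
    intro t'
    induction t' using Finset.induction_on with
    | empty => intro _; simpa using h0
    | insert a t' ha ih =>
      intro hs
      have ha' : a ∈ t := hs (Finset.mem_insert_self _ _)
      have ht' : t' ⊆ t := fun y hy => hs (Finset.mem_insert_of_mem hy)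
      rw [Finset.set_biUnion_insert, Set.union_comm]
      refine hstep _ _ (t'.isCompact_biUnion fun y _ => hL y)
        (Set.iUnion₂_subset fun y hy => hLK y (ht' hy)) (hL a) (hLK a ha') (ih ht') ?_
      exact hQ a (htK a ha') _ (hL a) ((hLU a).trans interior_subset) (hLK a ha')
  rw [hKL]
  exact main t subset_rfl

namespace AbSheaf

section Sections

variable {Y : Type u} [TopologicalSpace Y] {S T : AbSheaf Y}

/-- Continuity of a choice of elements of the stalks on a subset. -/
def SecOn (S : AbSheaf Y) (s : ∀ y, S.stalk y) (K : Set Y) : Prop :=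
  ContinuousOn (fun y => (⟨y, s y⟩ : Total S.stalk)) K

variable {s t : ∀ y, S.stalk y} {K L A B : Set Y}

theorem secOn_iff_restrict :
    S.SecOn s K ↔ Continuous fun y : K => (⟨y, s y⟩ : Total S.stalk) :=
  continuousOn_iff_continuous_domRestrict

theorem IsSection.secOn (h : S.IsSection s) (K : Set Y) : S.SecOn s K := h.continuousOn

theorem secOn_univ : S.SecOn s Set.univ ↔ S.IsSection s := continuousOn_univ

theorem SecOn.mono (h : S.SecOn s K) (hL : L ⊆ K) : S.SecOn s L := ContinuousOn.mono h hL

theorem SecOn.congr (h : S.SecOn s K) (ht : ∀ y ∈ K, t y = s y) : S.SecOn t K :=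
  ContinuousOn.congr h fun y hy => by rw [ht y hy]

theorem isSection_zero : S.IsSection fun _ => 0 :=
  continuous_iff_continuousAt.2 fun _ => continuousAt_zero continuousAt_id

theorem SecOn.sub (hs : S.SecOn s K) (ht : S.SecOn t K) :
    S.SecOn (fun y => s y - t y) K := by
  rw [secOn_iff_restrict] at *
  exact continuous_iff_continuousAt.2 fun y => continuousAt_sub (b := fun y : K => (y : Y))
    hs.continuousAt ht.continuousAt

theorem SecOn.add (hs : S.SecOn s K) (ht : S.SecOn t K) :
    S.SecOn (fun y => s y + t y) K := by
  rw [secOn_iff_restrict] at *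
  exact continuous_iff_continuousAt.2 fun y => continuousAt_add (b := fun y : K => (y : Y))
    hs.continuousAt ht.continuousAt

theorem SecOn.map {α : ∀ y, S.stalk y →+ T.stalk y}
    (hα : Continuous fun e : Total S.stalk => (⟨e.base, α e.base e.val⟩ : Total T.stalk))
    (hs : S.SecOn s K) : T.SecOn (fun y => α y (s y)) K :=
  hα.comp_continuousOn hs

open Classical in
theorem SecOn.paste (hA : IsClosed A) (hB : IsClosed B) (hs : S.SecOn s A) (ht : S.SecOn t B)
    (h : ∀ y ∈ A, y ∈ B → s y = t y) : S.SecOn (fun y => if y ∈ A then s y else t y) (A ∪ B) := by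
  refine ContinuousOn.union_of_isClosed (hs.congr fun y hy => by rw [if_pos hy])
    (ht.congr fun y hy => ?_) hA hB
  split_ifs with h'
  · exact h y h' hy
  · rfl

theorem eventually_eq_within {y : Y}
    (hs : ContinuousWithinAt (fun y => (⟨y, s y⟩ : Total S.stalk)) K y)
    (ht : ContinuousWithinAt (fun y => (⟨y, t y⟩ : Total S.stalk)) K y) (h : s y = t y) :
    ∀ᶠ z in 𝓝[K] y, s z = t z := by
  obtain ⟨U, hU, hi⟩ := exists_injOn S.isLocalHomeomorph_base ⟨y, s y⟩
  have hU' : U ∈ 𝓝 (⟨y, t y⟩ : Total S.stalk) := by rwa [← h]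
  filter_upwards [hs.preimage_mem_nhdsWithin hU, ht.preimage_mem_nhdsWithin hU'] with z h1 h2
  simpa using hi h1 h2 rfl

theorem SecOn.isCompact_ne_zero [T2Space Y] (hK : IsCompact K) (hs : S.SecOn s K) :
    IsCompact (K ∩ {y | s y ≠ 0}) := by
  refine hK.of_isClosed_subset ?_ Set.inter_subset_left
  rw [← isOpen_compl_iff, isOpen_iff_mem_nhds]
  intro y hy
  by_cases hyK : y ∈ K
  · have h0 : s y = 0 := by
      by_contra h
      exact hy ⟨hyK, h⟩
    have := eventually_eq_within (hs y hyK) (isSection_zero.secOn K y hyK) h0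
    filter_upwards [eventually_nhdsWithin_iff.1 this] with z hz hz'
    exact hz'.2 (hz hz'.1)
  · filter_upwards [hK.isClosed.isOpen_compl.mem_nhds hyK] with z hz hz'
    exact hz hz'.1

theorem exists_secOn_through (y : Y) (v : S.stalk y) :
    ∃ (s : ∀ y, S.stalk y) (U : Set Y), IsOpen U ∧ y ∈ U ∧ s y = v ∧ S.SecOn s U := by
  let _ : ∀ x, Inhabited (S.stalk x) := fun x => ⟨0⟩
  obtain ⟨s, hs, hc⟩ := exists_section_through S.isLocalHomeomorph_base y v
  obtain ⟨U, hU, hUo, hy⟩ := mem_nhds_iff.1 hc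
  exact ⟨s, U, hUo, hy, hs, fun z hz =>
    ContinuousAt.continuousWithinAt (show ContinuousAt _ z from hU hz)⟩

/-- Extensions near a point exist because the étale space is locally homeomorphic to the base. Given
extensions near compact sets `A` and `L`, let `W` be the open set where both are defined and agree.
It contains `A ∩ L`, so `A \ W` and `L \ W` are disjoint compact sets with disjoint neighbourhoods,
and the extensions glue after shrinking their domains. -/
theorem exists_extend_nhds [T2Space Y] (hK : IsCompact K) (hs : S.SecOn s K) :
    ∃ (V : Set Y) (t : ∀ y, S.stalk y), IsOpen V ∧ K ⊆ V ∧ S.SecOn t V ∧ ∀ y ∈ K, t y = s y := by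
  classical
  let P : Set Y → Prop := fun K => ∃ (V : Set Y) (t : ∀ y, S.stalk y),
    IsOpen V ∧ K ⊆ V ∧ S.SecOn t V ∧ ∀ y ∈ K, t y = s y
  refine compact_induction (P := P) (Q := P) hK ?_ ?_ ?_
  · exact ⟨∅, fun _ => 0, isOpen_empty, subset_rfl, continuousOn_empty _, by simp⟩
  · intro y hy
    obtain ⟨σ, U, hU, hyU, hσ, hσU⟩ := exists_secOn_through y (s y)
    have h1 := eventually_eq_within (((hσU y hyU).continuousAt (hU.mem_nhds hyU)).continuousWithinAt
      (s := K)) (hs y hy) hσ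
    refine ⟨_, Filter.inter_mem (hU.mem_nhds hyU) (eventually_nhdsWithin_iff.1 h1), ?_⟩
    intro L _ hL hLK
    exact ⟨U, σ, hU, fun z hz => (hL hz).1, hσU, fun z hz => (hL hz).2 (hLK hz)⟩
  · rintro A L hA - hL - ⟨V₁, t₁, hV₁, hA₁, ht₁, hs₁⟩ ⟨V₂, t₂, hV₂, hL₂, ht₂, hs₂⟩
    let W : Set Y := {y | y ∈ V₁ ∧ y ∈ V₂ ∧ t₁ y = t₂ y}
    have hW : IsOpen W := by
      rw [isOpen_iff_mem_nhds]
      rintro y ⟨h1, h2, h3⟩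
      have := eventually_eq_within (K := Set.univ)
        ((ht₁ y h1).continuousAt (hV₁.mem_nhds h1)).continuousWithinAt
        ((ht₂ y h2).continuousAt (hV₂.mem_nhds h2)).continuousWithinAt h3
      rw [nhdsWithin_univ] at this
      filter_upwards [hV₁.mem_nhds h1, hV₂.mem_nhds h2, this] with z h1 h2 h3
      exact ⟨h1, h2, h3⟩
    obtain ⟨O₁, O₂, hO₁, hO₂, hAO, hLO, hd⟩ := SeparatedNhds.of_isCompact_isCompact
      (hA.diff hW) (hL.diff hW) (by
        rw [Set.disjoint_left]
        rintro y ⟨h1, h2⟩ ⟨h3, -⟩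
        exact h2 ⟨hA₁ h1, hL₂ h3, (hs₁ y h1).trans (hs₂ y h3).symm⟩)
    have hW₁ : W ⊆ V₁ := fun y hy => hy.1
    have hW₂ : W ⊆ V₂ := fun y hy => hy.2.1
    -- As `O₁` and `O₂` are disjoint, the shrunken domains `V₁'` and `V₂'` meet only inside `W`,
    -- where the two extensions agree.
    let V₁' := V₁ ∩ (O₁ ∪ W)
    let V₂' := V₂ ∩ (O₂ ∪ W)
    have ho₁ : IsOpen V₁' := hV₁.inter (hO₁.union hW)
    have ho₂ : IsOpen V₂' := hV₂.inter (hO₂.union hW)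
    have hcompat : ∀ y ∈ V₁', y ∈ V₂' → t₁ y = t₂ y := by
      rintro y ⟨-, h1⟩ ⟨-, h2⟩
      rcases h1 with h1 | h1
      · rcases h2 with h2 | h2
        · exact absurd h2 (Set.disjoint_left.1 hd h1)
        · exact h2.2.2
      · exact h1.2.2
    refine ⟨V₁' ∪ V₂', fun y => if y ∈ V₁' then t₁ y else t₂ y, ho₁.union ho₂, ?_, ?_, ?_⟩
    · rintro y (hy | hy)
      · refine Or.inl ⟨hA₁ hy, ?_⟩
        by_cases h : y ∈ W
        exacts [Or.inr h, Or.inl (hAO ⟨hy, h⟩)]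
      · refine Or.inr ⟨hL₂ hy, ?_⟩
        by_cases h : y ∈ W
        exacts [Or.inr h, Or.inl (hLO ⟨hy, h⟩)]
    · refine ContinuousOn.union_of_isOpen ?_ ?_ ho₁ ho₂
      · exact (ht₁.mono Set.inter_subset_left).congr fun y hy => by rw [if_pos hy]
      · refine (ht₂.mono Set.inter_subset_left).congr fun y hy => ?_
        split_ifs with h
        exacts [hcompat y h hy, rfl]
    · have e2 : ∀ y ∈ V₂', (if y ∈ V₁' then t₁ y else t₂ y) = t₂ y := fun y hy => by
        split_ifs with h
        exacts [hcompat y h hy, rfl]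
      rintro y (hy | hy)
      · have h1 : y ∈ V₁' := by
          refine ⟨hA₁ hy, ?_⟩
          by_cases h : y ∈ W
          exacts [Or.inr h, Or.inl (hAO ⟨hy, h⟩)]
        dsimp only
        rw [if_pos h1, hs₁ y hy]
      · have h2 : y ∈ V₂' := by
          refine ⟨hL₂ hy, ?_⟩
          by_cases h : y ∈ W
          exacts [Or.inr h, Or.inl (hLO ⟨hy, h⟩)]
        dsimp only
        rw [e2 y h2, hs₂ y hy]

open Classical in
/-- Extension by zero of a section over a compact set that vanishes on the boundary. -/
theorem cutoff_mem [T2Space Y] (hL : IsCompact L) (hs : S.SecOn s L)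
    (h0 : ∀ y ∈ L, y ∉ interior L → s y = 0) :
    (fun y => if y ∈ L then s y else 0) ∈ S.sectionsC := by
  have h : S.IsSection fun y => if y ∈ L then s y else 0 := by
    have := hs.paste (B := (interior L)ᶜ) hL.isClosed isOpen_interior.isClosed_compl
      (isSection_zero.secOn _) h0
    have hu : L ∪ (interior L)ᶜ = Set.univ := by
      rw [Set.eq_univ_iff_forall]
      intro y
      by_cases hy : y ∈ L
      exacts [Or.inl hy, Or.inr fun h => hy (interior_subset h)]
    rwa [hu, secOn_univ] at this
  refine ⟨h, hL.of_isClosed_subset h.isClosed_ne_zero fun y hy => ?_⟩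
  by_contra h'
  exact hy (if_neg h')

/-- The sections of `S` over compact sets with values in `N` extend to global sections with values
in `N`. -/
def Soft (S : AbSheaf Y) (N : ∀ y, AddSubgroup (S.stalk y)) : Prop :=
  ∀ (K : Set Y) (s : ∀ y, S.stalk y), IsCompact K → S.SecOn s K → (∀ y ∈ K, s y ∈ N y) →
    ∃ t, S.IsSection t ∧ (∀ y, t y ∈ N y) ∧ ∀ y ∈ K, t y = s y

/-- A section over a compact set extends to an open neighbourhood by `exists_extend_nhds`, which is
the situation of c-softness. -/
theorem IsCSoft.soft [T2Space Y] (h : S.IsCSoft) : S.Soft fun _ => ⊤ := by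
  intro K s hK hs _
  obtain ⟨U, t, hU, hKU, ht, hts⟩ := exists_extend_nhds hK hs
  obtain ⟨V, t', -, hKV, -, ht', he⟩ := h K U t hK hU hKU ht
  exact ⟨t', ht', fun _ => trivial, fun y hy => (he y (hKV hy)).symm.trans (hts y hy)⟩

theorem Soft.isCSoft [T2Space Y] [LocallyCompactSpace Y] (h : S.Soft fun _ => ⊤) : S.IsCSoft := by
  intro K U s hK hU hKU hs
  obtain ⟨L, hL, hKL, hLU⟩ := exists_compact_between hK hU hKU
  obtain ⟨t, ht, -, he⟩ := h L s hL (ContinuousOn.mono hs hLU) fun _ _ => trivial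
  exact ⟨interior L, t, isOpen_interior, hKL, interior_subset.trans hLU, ht,
    fun y hy => (he y (interior_subset hy)).symm⟩

theorem soft_bot : S.Soft fun _ => ⊥ := fun _ _ _ _ h0 =>
  ⟨fun _ => 0, isSection_zero, fun _ => AddSubgroup.mem_bot.2 rfl,
    fun y hy => (AddSubgroup.mem_bot.1 (h0 y hy)).symm⟩

/-- Local lifts exist on étale spaces. Two lifts over compact sets `A` and `L` differ over `A ∩ L`
by a section of the kernel; softness of the kernel extends this difference globally, and adding it
to the second lift makes the two glue. -/
theorem exists_lift_secOn [T2Space Y] {α : ∀ y, S.stalk y →+ T.stalk y}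
    (hα : Continuous fun e : Total S.stalk => (⟨e.base, α e.base e.val⟩ : Total T.stalk))
    (hN : S.Soft fun y => (α y).ker) {t : ∀ y, T.stalk y} (hK : IsCompact K) (ht : T.SecOn t K)
    (hr : ∀ y ∈ K, t y ∈ (α y).range) :
    ∃ s, S.SecOn s K ∧ ∀ y ∈ K, α y (s y) = t y := by
  classical
  let P : Set Y → Prop := fun K => ∃ s, S.SecOn s K ∧ ∀ y ∈ K, α y (s y) = t y
  refine compact_induction (P := P) (Q := P) hK ?_ ?_ ?_
  · exact ⟨fun _ => 0, continuousOn_empty _, by simp⟩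
  · intro y hy
    obtain ⟨v, hv⟩ := hr y hy
    obtain ⟨σ, U, hU, hyU, hσ, hσU⟩ := exists_secOn_through y v
    have h1 := eventually_eq_within
      (((hσU.map hα y hyU).continuousAt (hU.mem_nhds hyU)).continuousWithinAt (s := K))
      (ht y hy) (by simp only [hσ, hv])
    refine ⟨_, Filter.inter_mem (hU.mem_nhds hyU) (eventually_nhdsWithin_iff.1 h1), ?_⟩
    intro L _ hL hLK
    exact ⟨σ, hσU.mono fun z hz => (hL hz).1, fun z hz => (hL hz).2 (hLK hz)⟩
  · rintro A L hA - hL - ⟨s₁, h₁, e₁⟩ ⟨s₂, h₂, e₂⟩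
    obtain ⟨n, hn, hnN, hne⟩ := hN (A ∩ L) (fun y => s₁ y - s₂ y) (hA.inter hL)
      ((h₁.mono Set.inter_subset_left).sub (h₂.mono Set.inter_subset_right)) fun y hy => by
        rw [AddMonoidHom.mem_ker, map_sub, e₁ y hy.1, e₂ y hy.2, sub_self]
    refine ⟨_, h₁.paste (t := fun y => s₂ y + n y) hA.isClosed hL.isClosed
      (h₂.add (hn.secOn _)) ?_, ?_⟩
    · intro y h1 h2
      rw [hne y ⟨h1, h2⟩, add_sub_cancel]
    · rintro y hy
      split_ifs with h
      · exact e₁ y h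
      · rw [map_add, AddMonoidHom.mem_ker.1 (hnN y), add_zero, e₂ y (hy.resolve_left h)]

/-- Over `K` lift to the source, extend the lift to a global section, and map it down again. -/
theorem soft_range [T2Space Y] {α : ∀ y, S.stalk y →+ T.stalk y}
    (hα : Continuous fun e : Total S.stalk => (⟨e.base, α e.base e.val⟩ : Total T.stalk))
    (hS : S.Soft fun _ => ⊤) (hN : S.Soft fun y => (α y).ker) : T.Soft fun y => (α y).range := by
  intro K t hK ht hr
  obtain ⟨s, hs, he⟩ := exists_lift_secOn hα hN hK ht hr
  obtain ⟨s', hs', -, he'⟩ := hS K s hK hs fun _ _ => trivial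
  exact ⟨fun y => α y (s' y), secOn_univ.1 ((hs'.secOn _).map hα), fun y => ⟨_, rfl⟩,
    fun y hy =>
    (congrArg (α y) (he' y hy)).trans (he y hy)⟩

/-- Lift over a compact neighbourhood `L` of the support. On the boundary of `L` the lift has values
in the kernel; subtracting a global section of the kernel with these boundary values allows
extension by zero outside `L`. -/
theorem exists_lift_sectionsC [T2Space Y] [LocallyCompactSpace Y]
    {α : ∀ y, S.stalk y →+ T.stalk y}
    (hα : Continuous fun e : Total S.stalk => (⟨e.base, α e.base e.val⟩ : Total T.stalk))
    (hN : S.Soft fun y => (α y).ker) {t : ∀ y, T.stalk y} (ht : t ∈ T.sectionsC)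
    (hr : ∀ y, t y ∈ (α y).range) : ∃ s ∈ S.sectionsC, ∀ y, α y (s y) = t y := by
  classical
  obtain ⟨L, hL, hKL⟩ := exists_compact_superset ht.2
  obtain ⟨s, hs, he⟩ := exists_lift_secOn hα hN hL (ht.1.secOn L) fun y _ => hr y
  have h0 : ∀ y, y ∉ interior L → t y = 0 := fun y hy => by
    by_contra h
    exact hy (hKL h)
  obtain ⟨n, hn, hnN, hne⟩ := hN (L \ interior L) s (hL.diff isOpen_interior)
    (hs.mono Set.sdiff_subset) fun y hy => by
      rw [AddMonoidHom.mem_ker, he y hy.1, h0 y hy.2]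
  refine ⟨_, cutoff_mem hL (hs.sub (hn.secOn L)) fun y h1 h2 => ?_, fun y => ?_⟩
  · rw [hne y ⟨h1, h2⟩, sub_self]
  · split_ifs with h
    · rw [map_sub, AddMonoidHom.mem_ker.1 (hnN y), sub_zero, he y h]
    · rw [map_zero, h0 y fun h' => h (interior_subset h')]

/-- The compactly supported sections of an exact sequence `0 → D 0 → D 1 → ⋯` of soft sheaves form
an exact sequence. -/
theorem exists_sectionsC_of_exact [T2Space Y] [LocallyCompactSpace Y] (D : ℕ → AbSheaf Y)
    (d : ∀ q y, (D q).stalk y →+ (D (q + 1)).stalk y)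
    (hd : ∀ q, Continuous fun e : Total (D q).stalk =>
      (⟨e.base, d q e.base e.val⟩ : Total (D (q + 1)).stalk))
    (hsoft : ∀ q, (D q).Soft fun _ => ⊤) (hi : ∀ y, Function.Injective (d 0 y))
    (he : ∀ q y, Function.Exact (d q y) (d (q + 1) y)) (q : ℕ)
    {t : ∀ y, (D (q + 1)).stalk y} (ht : t ∈ (D (q + 1)).sectionsC)
    (h0 : ∀ y, d (q + 1) y (t y) = 0) : ∃ s ∈ (D q).sectionsC, ∀ y, d q y (s y) = t y := by
  -- Softness of the kernels propagates upwards from the zero kernel in degree 0: by exactness each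
  -- kernel is the range of the previous differential, to which `soft_range` applies.
  have hker : ∀ q, (D q).Soft fun y => (d q y).ker := by
    intro q
    induction q with
    | zero =>
      have : (fun y => (d 0 y).ker) = fun _ => ⊥ :=
        funext fun y => (AddMonoidHom.ker_eq_bot_iff _).2 (hi y)
      rw [this]
      exact soft_bot
    | succ q ih =>
      have : (fun y => (d (q + 1) y).ker) = fun y => (d q y).range :=
        funext fun y => (AddMonoidHom.exact_iff.1 (he q y))
      rw [this]
      exact soft_range (hd q) (hsoft q) ih
  exact exists_lift_sectionsC (hd q) (hker q) ht fun y => (he q y _).1 (h0 y)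

/-- The support of `s` in `K` is a compact subset of `U`, hence interior to a compact `L ⊆ U`.
Prescribe `s` on `K ∩ L` and zero on the boundary of `L`, extend by softness, and cut off at `L`. -/
theorem soft_extByZero [T2Space Y] [LocallyCompactSpace Y] (hS : S.Soft fun _ => ⊤) {U : Set Y}
    (hU : IsOpen U) : S.Soft (S.extByZero U hU).sub := by
  classical
  intro K s hK hs hsN
  have hsN : ∀ y ∈ K, y ∉ U → s y = 0 := hsN
  obtain ⟨L, hL, hKL, hLU⟩ := exists_compact_between (hs.isCompact_ne_zero hK) hU fun y hy => by
    by_contra h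
    exact hy.2 (hsN y hy.1 h)
  have h0 : ∀ y ∈ K, y ∉ interior L → s y = 0 := fun y hy h => by
    by_contra h'
    exact h (hKL ⟨hy, h'⟩)
  have h1 : S.SecOn _ _ := (hs.mono Set.inter_subset_left).paste (A := K ∩ L) (B := L \ interior L)
    (hK.isClosed.inter hL.isClosed) (hL.diff isOpen_interior).isClosed (isSection_zero.secOn _)
    fun y hy hy' => h0 y hy.1 hy'.2
  obtain ⟨t, ht, -, hte⟩ := hS _ _ ((hK.inter hL).union (hL.diff isOpen_interior)) h1
    fun _ _ => trivial
  have hts : ∀ y ∈ K, y ∈ L → t y = s y := fun y hy hy' => by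
    rw [hte y (Or.inl ⟨hy, hy'⟩), if_pos (show y ∈ K ∩ L from ⟨hy, hy'⟩)]
  refine ⟨_, (cutoff_mem hL (ht.secOn L) fun y hy hy' => ?_).1, fun y hy => ?_, fun y hy => ?_⟩
  · rw [hte y (Or.inr ⟨hy, hy'⟩)]
    split_ifs with h
    exacts [h0 y h.1 hy', rfl]
  · exact if_neg fun h => hy (hLU h)
  · split_ifs with h
    exacts [hts y hy h, (h0 y hy fun h' => h (interior_subset h')).symm]

/-- Softness is a local property. -/
theorem soft_of_local [T2Space Y] [LocallyCompactSpace Y]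
    (h : ∀ y : Y, ∃ U ∈ 𝓝 y, ∀ (K : Set Y) (s : ∀ y, S.stalk y), IsCompact K → K ⊆ U →
      S.SecOn s K → ∃ t, S.SecOn t U ∧ ∀ y ∈ K, t y = s y) : S.Soft fun _ => ⊤ := by
  classical
  intro K s hK hs _
  suffices h' : ∃ t, S.IsSection t ∧ ∀ y ∈ K, t y = s y by
    obtain ⟨t, ht, he⟩ := h'
    exact ⟨t, ht, fun _ => trivial, he⟩
  -- `Q L` asks for room around `L`: a compact `B` with `L` in its interior on which extension is
  -- possible, so that corrections made near `L` can be cut off at the boundary of `B`.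
  refine compact_induction (P := fun A => ∃ t, S.IsSection t ∧ ∀ y ∈ A, t y = s y)
    (Q := fun L => ∃ B, IsCompact B ∧ L ⊆ interior B ∧ ∀ (K : Set Y) (s : ∀ y, S.stalk y),
      IsCompact K → K ⊆ B → S.SecOn s K → ∃ t, S.SecOn t B ∧ ∀ y ∈ K, t y = s y) hK ?_ ?_ ?_
  · exact ⟨fun _ => 0, isSection_zero, by simp⟩
  · intro y _
    obtain ⟨U, hU, hUs⟩ := h y
    obtain ⟨B, hB, hBU, hBc⟩ := local_compact_nhds hU
    refine ⟨interior B, interior_mem_nhds.2 hB, fun L _ hL _ => ⟨B, hBc, hL, ?_⟩⟩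
    intro K s hK hKB hs
    obtain ⟨t, ht, he⟩ := hUs K s hK (hKB.trans hBU) hs
    exact ⟨t, ht.mono hBU, he⟩
  · rintro A L hA hAK hL hLK ⟨t, ht, he⟩ ⟨B, hB, hLB, hBs⟩
    -- The section `t` is right on `A`; its error `s - t` on `L` is extended over `B` with the value
    -- zero on `A ∩ B` and on the boundary of `B`. Extended by zero outside `B`, this correction
    -- leaves `A` untouched and repairs `L`.
    have hst := hs.sub (ht.secOn K)
    have hc : IsCompact ((A ∩ B) ∪ (B \ interior B)) :=
      (hA.inter hB).union (hB.diff isOpen_interior)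
    have h1 : S.SecOn _ _ := (hst.mono hLK).paste (B := (A ∩ B) ∪ (B \ interior B)) hL.isClosed
      hc.isClosed (isSection_zero.secOn _) (by
        rintro y hy (hy' | hy')
        · rw [he y hy'.1, sub_self]
        · exact absurd (hLB hy) hy'.2)
    obtain ⟨v, hv, hve⟩ := hBs _ _ (hL.union hc) (Set.union_subset (hLB.trans interior_subset)
      (Set.union_subset Set.inter_subset_right Set.sdiff_subset)) h1
    have hv1 : ∀ y ∈ L, v y = s y - t y := fun y hy => by
      rw [hve y (Or.inl hy), if_pos hy]
    have hv2 : ∀ y ∈ (A ∩ B) ∪ (B \ interior B), v y = 0 := fun y hy => by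
      rw [hve y (Or.inr hy)]
      split_ifs with h
      · rcases hy with hy | hy
        · rw [he y hy.1, sub_self]
        · exact absurd (hLB h) hy.2
      · rfl
    have hw := cutoff_mem hB hv fun y h1 h2 => hv2 y (Or.inr ⟨h1, h2⟩)
    refine ⟨_, secOn_univ.1 ((ht.secOn _).add (hw.1.secOn _)), ?_⟩
    rintro y (hy | hy)
    · split_ifs with h
      · rw [hv2 y (Or.inl ⟨hy, h⟩), add_zero, he y hy]
      · rw [add_zero, he y hy]
    · rw [if_pos (interior_subset (hLB hy)), hv1 y hy, add_sub_cancel]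

end Sections

/-! ### Softness of pullbacks. -/

section Pullback

variable {X Y : Type u} [TopologicalSpace X] [TopologicalSpace Y]

theorem secOn_pullback_iff {S : AbSheaf X} {f : Y → X} {hf : Continuous f}
    {s : ∀ y, S.stalk (f y)} {K : Set Y} :
    (S.pullback f hf).SecOn s K ↔ ContinuousOn (fun y => (⟨f y, s y⟩ : Total S.stalk)) K := by
  refine secOn_iff_restrict.trans (Iff.trans ?_ continuousOn_iff_continuous_domRestrict.symm)
  refine ⟨fun h => (S.continuous_pullbackProj f).comp h, fun h => ?_⟩
  exact S.continuous_pullback_mk f continuous_subtype_val h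

/-- The pullback of a soft sheaf along a locally injective continuous map is soft. -/
theorem soft_pullback [T2Space X] [T2Space Y] [LocallyCompactSpace Y] {S : AbSheaf X}
    (hS : S.Soft fun _ => ⊤) {f : Y → X} (hf : Continuous f)
    (hi : ∀ y, ∃ U ∈ 𝓝 y, Set.InjOn f U) : (S.pullback f hf).Soft fun _ => ⊤ := by
  classical
  refine soft_of_local fun y => ?_
  obtain ⟨U, hU, hUi⟩ := hi y
  refine ⟨U, hU, fun K s hK hKU hs => ?_⟩
  have := isCompact_iff_compactSpace.1 hK
  let e : K → X := fun y => f y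
  have hei : Function.Injective e := fun y z h => Subtype.ext (hUi (hKU y.2) (hKU z.2) h)
  -- On the compact set `K` the map `f` is injective, hence a closed embedding, so `s` transports to
  -- a section `σ` over the compact image `f K`. A global extension of `σ` is then pulled back.
  have he : IsClosedEmbedding e := (hf.comp continuous_subtype_val).isClosedEmbedding hei
  let σ : ∀ x, S.stalk x := fun x =>
    if h : ∃ y : K, e y = x then S.tr h.choose_spec (s h.choose) else 0
  have hσ : ∀ y : K, σ (e y) = s y := by
    intro y
    have h : ∃ y' : K, e y' = e y := ⟨y, rfl⟩
    have h2 : ∀ (y' : K) (h : e y' = e y), S.tr h (s y') = s y := by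
      intro y' h
      obtain rfl := hei h
      rfl
    simp only [σ, dif_pos h]
    exact h2 _ _
  have hσc : S.SecOn σ (Set.range e) := by
    rintro _ ⟨y, rfl⟩
    change Filter.Tendsto _ _ _
    rw [← he.isEmbedding.map_nhds_eq, Filter.tendsto_map'_iff]
    have h1 := (continuousOn_iff_continuous_domRestrict.1
      (secOn_pullback_iff.1 hs)).continuousAt (x := y)
    have h2 : ((fun x => (⟨x, σ x⟩ : Total S.stalk)) ∘ e) =
        K.domRestrict fun y => (⟨f y, s y⟩ : Total S.stalk) := by
      funext y
      exact congrArg (Total.mk (e y)) (hσ y)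
    have h3 : (⟨e y, σ (e y)⟩ : Total S.stalk) = ⟨f y, s y⟩ := congrArg (Total.mk (e y)) (hσ y)
    exact (congrArg₂ (fun g b => Filter.Tendsto g (𝓝 y) (𝓝 b)) h2 h3).mpr h1
  obtain ⟨t, ht, -, hte⟩ := hS _ _ (isCompact_range he.continuous) hσc fun _ _ => trivial
  refine ⟨fun y => t (f y), ?_, fun y hy => ?_⟩
  · exact secOn_pullback_iff.2 (Continuous.comp ht hf).continuousOn
  · exact (hte _ ⟨⟨y, hy⟩, rfl⟩).trans (hσ ⟨y, hy⟩)

end Pullback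

/-! ### Products of sheaves -/

section Prod

variable {Y : Type u} [TopologicalSpace Y] (S T : AbSheaf Y)

/-- The stalks of the product of two sheaves. -/
def ProdStalk (y : Y) : Type u := S.stalk y × T.stalk y

instance (y : Y) : AddCommGroup (S.ProdStalk T y) :=
  inferInstanceAs (AddCommGroup (S.stalk y × T.stalk y))

instance prodTop : TopologicalSpace (Total (S.ProdStalk T)) :=
  TopologicalSpace.induced (fun e => ((⟨e.base, e.val.1⟩, ⟨e.base, e.val.2⟩) :
    Total S.stalk × Total T.stalk)) inferInstance

theorem continuousAt_prod_iff {Z : Type*} [TopologicalSpace Z] {g : Z → Total (S.ProdStalk T)}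
    {z₀ : Z} : ContinuousAt g z₀ ↔
      ContinuousAt (fun z => (⟨(g z).base, (g z).val.1⟩ : Total S.stalk)) z₀ ∧
      ContinuousAt (fun z => (⟨(g z).base, (g z).val.2⟩ : Total T.stalk)) z₀ := by
  have hi : IsInducing (fun e : Total (S.ProdStalk T) =>
    ((⟨e.base, e.val.1⟩, ⟨e.base, e.val.2⟩) : Total S.stalk × Total T.stalk)) := ⟨rfl⟩
  rw [hi.continuousAt_iff]
  exact ⟨fun h => ⟨h.fst, h.snd⟩, fun h => h.1.prodMk h.2⟩

theorem continuous_prod_iff {Z : Type*} [TopologicalSpace Z] {g : Z → Total (S.ProdStalk T)} :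
    Continuous g ↔
      Continuous (fun z => (⟨(g z).base, (g z).val.1⟩ : Total S.stalk)) ∧
      Continuous (fun z => (⟨(g z).base, (g z).val.2⟩ : Total T.stalk)) := by
  simp only [continuous_iff_continuousAt, continuousAt_prod_iff, forall_and]

/-- The product of two sheaves. -/
def prod : AbSheaf Y where
  stalk := S.ProdStalk T
  isLocalHomeomorph_base := by
    have hid := (continuous_prod_iff S T).1 continuous_id
    refine isLocalHomeomorph_of_sections _ (S.continuous_base.comp hid.1) ?_ ?_
    · intro e
      obtain ⟨U, hU, hi⟩ := exists_injOn S.isLocalHomeomorph_base ⟨e.base, e.val.1⟩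
      obtain ⟨V, hV, hi'⟩ := exists_injOn T.isLocalHomeomorph_base ⟨e.base, e.val.2⟩
      refine ⟨_, Filter.inter_mem (hid.1.continuousAt.preimage_mem_nhds hU)
        (hid.2.continuousAt.preimage_mem_nhds hV), ?_⟩
      rintro ⟨y, v⟩ h1 ⟨y', v'⟩ h2 (h : y = y')
      subst h
      have e1 : v.1 = v'.1 := by simpa using hi h1.1 h2.1 rfl
      have e2 : v.2 = v'.2 := by simpa using hi' h1.2 h2.2 rfl
      exact congrArg (Total.mk y) (Prod.ext e1 e2)
    · rintro ⟨y, v⟩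
      obtain ⟨s, U, hU, hyU, hs, hsU⟩ := exists_secOn_through y v.1
      obtain ⟨t, V, hV, hyV, ht, htV⟩ := exists_secOn_through y v.2
      refine ⟨fun z => (⟨z, (s z, t z)⟩ : Total (S.ProdStalk T)), (continuousAt_prod_iff S T).2
        ⟨(hsU y hyU).continuousAt (hU.mem_nhds hyU), (htV y hyV).continuousAt (hV.mem_nhds hyV)⟩,
        ?_, by simp⟩
      exact congrArg (Total.mk y) (Prod.ext hs ht)
  continuous_sub := by
    refine continuous_sub_of fun Z _ b s t z₀ hs ht => ?_
    rw [continuousAt_prod_iff] at hs ht ⊢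
    exact ⟨continuousAt_sub hs.1 ht.1, continuousAt_sub hs.2 ht.2⟩

variable {S T}

theorem secOn_prod_iff {s : ∀ y, S.stalk y × T.stalk y} {K : Set Y} :
    (S.prod T).SecOn s K ↔ S.SecOn (fun y => (s y).1) K ∧ T.SecOn (fun y => (s y).2) K := by
  refine secOn_iff_restrict.trans (Iff.trans ?_
    (and_congr secOn_iff_restrict secOn_iff_restrict).symm)
  exact continuous_prod_iff S T (g := fun y : K => (⟨y, s y⟩ : Total (S.ProdStalk T)))

theorem soft_prod (hS : S.Soft fun _ => ⊤) (hT : T.Soft fun _ => ⊤) :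
    (S.prod T).Soft fun _ => ⊤ := by
  intro K s hK hs _
  obtain ⟨h1, h2⟩ := secOn_prod_iff.1 hs
  obtain ⟨t₁, ht₁, -, e₁⟩ := hS K _ hK h1 fun _ _ => trivial
  obtain ⟨t₂, ht₂, -, e₂⟩ := hT K _ hK h2 fun _ _ => trivial
  exact ⟨fun y => (t₁ y, t₂ y), secOn_univ.1 (secOn_prod_iff.2 ⟨ht₁.secOn _, ht₂.secOn _⟩),
    fun _ => trivial, fun y hy => Prod.ext (e₁ y hy) (e₂ y hy)⟩

theorem mem_sectionsC_prod_iff {s : ∀ y, S.stalk y × T.stalk y} :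
    s ∈ (S.prod T).sectionsC ↔
      (fun y => (s y).1) ∈ S.sectionsC ∧ (fun y => (s y).2) ∈ T.sectionsC := by
  have hsec : (S.prod T).IsSection s ↔
      S.IsSection (fun y => (s y).1) ∧ T.IsSection fun y => (s y).2 :=
    continuous_prod_iff S T (g := fun y => (⟨y, s y⟩ : Total (S.ProdStalk T)))
  have hu : {y | s y ≠ 0} = {y | (s y).1 ≠ 0} ∪ {y | (s y).2 ≠ 0} := by
    ext y
    simp only [Set.mem_ofPred_eq, Set.mem_union, ← not_and_or, Ne, Prod.ext_iff]
    rfl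
  constructor
  · rintro ⟨h1, h2⟩
    have h1' := hsec.1 h1
    refine ⟨⟨h1'.1, h2.of_isClosed_subset h1'.1.isClosed_ne_zero ?_⟩,
      ⟨h1'.2, h2.of_isClosed_subset h1'.2.isClosed_ne_zero ?_⟩⟩
    · exact fun y hy => hu.ge (Or.inl hy)
    · exact fun y hy => hu.ge (Or.inr hy)
  · rintro ⟨h1, h2⟩
    refine ⟨hsec.2 ⟨h1.1, h2.1⟩, ?_⟩
    exact hu ▸ h1.2.union h2.2

end Prod

end AbSheaf

end EtaleHomology

namespace EtaleHomology

/-! ### Coinduced equivariant sheaves -/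

namespace Grpd

section Algebra

variable {X G : Type u} (𝒢 : Grpd X G)

theorem mul_congr {g g' k k' : G} (hg : g = g') (hk : k = k') {e : 𝒢.s g = 𝒢.r k}
    {e' : 𝒢.s g' = 𝒢.r k'} : 𝒢.mul g k e = 𝒢.mul g' k' e' := by
  subst hg hk
  rfl

theorem mul_inv_mul {g k : G} (e : 𝒢.r k = 𝒢.r g) :
    𝒢.mul g (𝒢.mul (𝒢.inv g) k ((𝒢.s_inv g).trans e.symm))
      (by rw [𝒢.r_mul, 𝒢.r_inv]) = k :=
  (𝒢.mul_congr (𝒢.inv_inv g).symm rfl).trans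
    (𝒢.inv_mul_mul (g := 𝒢.inv g) ((𝒢.s_inv g).trans e.symm) rfl)

theorem inv_mul_eq {a b k : G} (e : 𝒢.s a = 𝒢.r b) (hk : 𝒢.r k = 𝒢.r a) :
    𝒢.mul (𝒢.inv (𝒢.mul a b e)) k (by rw [𝒢.s_inv, 𝒢.r_mul, hk]) =
      𝒢.mul (𝒢.inv b) (𝒢.mul (𝒢.inv a) k ((𝒢.s_inv a).trans hk.symm))
        (by rw [𝒢.s_inv, 𝒢.r_mul, 𝒢.r_inv, e]) := by
  have h1 : 𝒢.r (𝒢.mul (𝒢.inv a) k ((𝒢.s_inv a).trans hk.symm)) = 𝒢.r b := by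
    rw [𝒢.r_mul, 𝒢.r_inv, e]
  refine 𝒢.inv_mul_mul (by rw [𝒢.s_mul, 𝒢.r_mul, 𝒢.r_inv]) ?_
  refine (𝒢.mul_assoc _ _ _ e (by rw [𝒢.r_mul, 𝒢.r_inv])).trans ?_
  exact (𝒢.mul_congr rfl (𝒢.mul_inv_mul h1)).trans (𝒢.mul_inv_mul hk)

theorem inv_one (x : X) : 𝒢.inv (𝒢.one x) = 𝒢.one x := by
  have h1 := 𝒢.inv_mul_mul (g := 𝒢.one (𝒢.r (𝒢.one x))) (𝒢.s_one _) (𝒢.one_mul (𝒢.one x))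
  have h2 := 𝒢.mul_one (𝒢.inv (𝒢.one x))
  refine h2.symm.trans (Eq.trans (𝒢.mul_congr ?_ ?_) h1)
  · rw [𝒢.r_one]
  · rw [𝒢.s_inv, 𝒢.r_one]

theorem eq_inv_of_mul_eq_one {g k : G} {x : X} (e : 𝒢.s g = 𝒢.r k)
    (h : 𝒢.mul g k e = 𝒢.one x) : k = 𝒢.inv g := by
  have hx : x = 𝒢.s (𝒢.inv g) := by
    rw [𝒢.s_inv, ← 𝒢.r_mul g k e, h, 𝒢.r_one]
  subst hx
  exact (𝒢.inv_mul_mul e h).symm.trans (𝒢.mul_one _)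

theorem inv_mul_inv {g k : G} (e : 𝒢.r g = 𝒢.r k) :
    𝒢.inv (𝒢.mul (𝒢.inv g) k ((𝒢.s_inv g).trans e)) =
      𝒢.mul (𝒢.inv k) g ((𝒢.s_inv k).trans e.symm) := by
  refine (𝒢.eq_inv_of_mul_eq_one (x := 𝒢.s g) (by rw [𝒢.s_mul, 𝒢.r_mul, 𝒢.r_inv]) ?_).symm
  refine (𝒢.mul_assoc _ _ _ _ (by rw [𝒢.r_mul, 𝒢.r_inv])).trans ?_
  exact (𝒢.mul_congr rfl (𝒢.mul_inv_mul e)).trans (𝒢.inv_mul g)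

end Algebra

/-! ### Local sections of the range map. -/

section LocalSections

variable {X G : Type u} [TopologicalSpace X] [TopologicalSpace G] {𝒢 : Grpd X G}

/-- `σ` is a local section of the range map through `g`. -/
structure IsLoc (𝒢 : Grpd X G) (σ : X → G) (g : G) : Prop where
  apply : σ (𝒢.r g) = g
  eventually : ∀ᶠ z in 𝓝 (𝒢.r g), ContinuousAt σ z ∧ 𝒢.r (σ z) = z

theorem IsEtale.exists_isLoc (h : 𝒢.IsEtale) (g : G) : ∃ σ, 𝒢.IsLoc σ g := by
  have hs := h.isLocalHomeomorph_r.apply_self_mem_localInverseAt_source (x := g)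
  refine ⟨h.isLocalHomeomorph_r.localInverseAt g,
    h.isLocalHomeomorph_r.localInverseAt_apply_self, ?_⟩
  filter_upwards [(h.isLocalHomeomorph_r.localInverseAt g).open_source.mem_nhds hs] with b hb
  exact ⟨(h.isLocalHomeomorph_r.localInverseAt g).continuousAt hb,
    h.isLocalHomeomorph_r.apply_localInverseAt_of_mem hb⟩

theorem IsLoc.eventually_isLoc {σ : X → G} {g : G} (hσ : 𝒢.IsLoc σ g) :
    ∀ᶠ z in 𝓝 (𝒢.r g), 𝒢.r (σ z) = z ∧ 𝒢.IsLoc σ (σ z) := by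
  filter_upwards [hσ.eventually.eventually_nhds] with z hz
  have h1 := hz.self_of_nhds.2
  exact ⟨h1, by rw [h1], by rwa [h1]⟩

theorem IsEtale.eventually_eq (h : 𝒢.IsEtale) {Z : Type*} [TopologicalSpace Z] {z : Z}
    {f f' : Z → G} (hf : ContinuousAt f z) (hf' : ContinuousAt f' z) (h0 : f z = f' z)
    (hr : ∀ᶠ w in 𝓝 z, 𝒢.r (f w) = 𝒢.r (f' w)) : ∀ᶠ w in 𝓝 z, f w = f' w := by
  obtain ⟨U, hU, hi⟩ := exists_injOn h.isLocalHomeomorph_r (f z)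
  filter_upwards [hf.preimage_mem_nhds hU, hf'.preimage_mem_nhds (h0 ▸ hU), hr] with w h1 h2 h3
  exact hi h1 h2 h3

theorem IsLoc.continuousAt {σ : X → G} {g : G} (hσ : 𝒢.IsLoc σ g) : ContinuousAt σ (𝒢.r g) :=
  hσ.eventually.self_of_nhds.1

theorem IsLoc.eventually_eq (h : 𝒢.IsEtale) {σ τ : X → G} {g : G} (hσ : 𝒢.IsLoc σ g)
    (hτ : 𝒢.IsLoc τ g) : ∀ᶠ z in 𝓝 (𝒢.r g), σ z = τ z := by
  refine h.eventually_eq hσ.continuousAt hτ.continuousAt (hσ.apply.trans hτ.apply.symm) ?_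
  filter_upwards [hσ.eventually, hτ.eventually] with z h1 h2
  rw [h1.2, h2.2]

/-- The maps `σ ∘ r` and the identity agree at `g` and have the same range near `g`, where `r` is
injective. -/
theorem IsLoc.eventually_apply_r (h : 𝒢.IsEtale) {σ : X → G} {g : G} (hσ : 𝒢.IsLoc σ g) :
    ∀ᶠ k in 𝓝 g, σ (𝒢.r k) = k := by
  have hr : ContinuousAt 𝒢.r g := h.isLocalHomeomorph_r.continuous.continuousAt
  refine h.eventually_eq (hσ.continuousAt.comp hr) continuousAt_id hσ.apply ?_
  filter_upwards [hr.eventually hσ.eventually] with k hk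
  exact hk.2

end LocalSections

end Grpd

/-! ### Constant sheaves. -/

namespace AbSheaf

section Const

/-- An abelian group as a sheaf on a point. -/
def point (P : Type u) [AddCommGroup P] : AbSheaf PUnit.{u + 1} where
  stalk _ := P
  top := ⊥
  isLocalHomeomorph_base := by
    let _ : TopologicalSpace (Total fun _ : PUnit.{u + 1} => P) := ⊥
    have : DiscreteTopology (Total fun _ : PUnit.{u + 1} => P) := ⟨rfl⟩
    refine isLocalHomeomorph_of_sections _ continuous_of_discreteTopology (fun e => ?_) fun e => ?_
    · exact ⟨{e}, by simp, Set.injOn_singleton _ _⟩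
    · exact ⟨fun _ => e, continuousAt_const, rfl, by simp⟩
  continuous_sub := by
    let _ : TopologicalSpace (Total fun _ : PUnit.{u + 1} => P) := ⊥
    have : DiscreteTopology (Total fun _ : PUnit.{u + 1} => P) := ⟨rfl⟩
    exact continuous_of_discreteTopology

/-- The constant sheaf. -/
def const (X : Type u) [TopologicalSpace X] (P : Type u) [AddCommGroup P] : AbSheaf X :=
  (point P).pullback (fun _ => PUnit.unit) continuous_const

variable {X : Type u} [TopologicalSpace X] {P : Type u} [AddCommGroup P]

theorem isSection_const (f : P) : (const X P).IsSection fun _ => f :=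
  (point P).continuous_pullback_mk _ continuous_id continuous_const

theorem eventually_const (e : Total (const X P).stalk) :
    ∀ᶠ e' : Total (const X P).stalk in 𝓝 e, (e'.val : P) = e.val :=
  eventually_eq_of_eq (const X P).isLocalHomeomorph_base
    (b := fun e' : Total (const X P).stalk => e'.base) (s := fun e' => e'.val)
    (t := fun _ => (e.val : P)) continuousAt_id
    ((isSection_const (X := X) (P := P) e.val).comp (const X P).continuous_base).continuousAt rfl

end Const

end AbSheaf

namespace GSheaf

variable {X G : Type u} [TopologicalSpace X] [TopologicalSpace G] {𝒢 : Grpd X G}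

section Coind

variable (𝒢) (J : Type u) [AddCommGroup J]

/-- The functions that vanish on all arrows with range near a given point. -/
def coindSub : (AbSheaf.const X (G → J)).Sub where
  sub x :=
    { carrier := {f : G → J | ∀ᶠ y in 𝓝 x, ∀ g, 𝒢.r g = y → f g = 0}
      zero_mem' := Filter.Eventually.of_forall fun _ _ _ => rfl
      add_mem' := fun {f f'} hf hf' => by
        filter_upwards [hf, hf'] with y h1 h2 g hg
        exact (congrArg₂ (· + ·) (h1 g hg) (h2 g hg)).trans (add_zero 0)
      neg_mem' := fun {f} hf => by
        filter_upwards [hf] with y h1 g hg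
        exact (congrArg (- ·) (h1 g hg)).trans neg_zero }
  isOpen := by
    rw [isOpen_iff_mem_nhds]
    intro e he
    have he : ∀ᶠ y in 𝓝 e.base, ∀ g, 𝒢.r g = y → (e.val : G → J) g = 0 := he
    filter_upwards [AbSheaf.eventually_const e,
      (AbSheaf.const X (G → J)).continuous_base.continuousAt.eventually he.eventually_nhds]
      with e' h1 h2
    filter_upwards [h2] with y hy g hg
    exact (congrFun h1 g).trans (hy g hg)

/-- The sheaf of germs of functions on the fibres of the range map. -/
def coindSheaf : AbSheaf X := (coindSub 𝒢 J).quotient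

variable {J}

/-- The germ of a function. -/
def germ (x : X) (f : G → J) : (coindSheaf 𝒢 J).stalk x :=
  QuotientAddGroup.mk (s := (coindSub 𝒢 J).sub x) f

variable {𝒢}

theorem exists_germ {x : X} (v : (coindSheaf 𝒢 J).stalk x) : ∃ f, v = germ 𝒢 x f := by
  obtain ⟨f, rfl⟩ := QuotientAddGroup.mk_surjective (s := (coindSub 𝒢 J).sub x) v
  exact ⟨f, rfl⟩

theorem germ_eq_iff {x : X} {f f' : G → J} :
    germ 𝒢 x f = germ 𝒢 x f' ↔ ∀ᶠ y in 𝓝 x, ∀ g, 𝒢.r g = y → f g = f' g := by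
  refine QuotientAddGroup.eq.trans ?_
  change (∀ᶠ y in 𝓝 x, ∀ g, 𝒢.r g = y → -f g + f' g = 0) ↔ _
  simp only [neg_add_eq_zero]

theorem germ_add (x : X) (f f' : G → J) : germ 𝒢 x (f + f') = germ 𝒢 x f + germ 𝒢 x f' := rfl

theorem isSection_germ (f : G → J) : (coindSheaf 𝒢 J).IsSection fun x => germ 𝒢 x f :=
  (coindSub 𝒢 J).continuous_proj.comp (AbSheaf.isSection_const f)

theorem eventually_eq_germ {Z : Type*} [TopologicalSpace Z] {b : Z → X}
    {s : ∀ z, (coindSheaf 𝒢 J).stalk (b z)} {z : Z}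
    (hs : ContinuousAt (fun z => (⟨b z, s z⟩ : Total (coindSheaf 𝒢 J).stalk)) z) {f : G → J}
    (h : s z = germ 𝒢 (b z) f) : ∀ᶠ w in 𝓝 z, s w = germ 𝒢 (b w) f :=
  eventually_eq_of_eq (coindSheaf 𝒢 J).isLocalHomeomorph_base hs
    ((isSection_germ f).continuousAt.comp (f := b) (AbSheaf.continuousAt_base_of hs)) h

/-- As functions need not be continuous, representatives `F x` of the germs `s x` can be merged into
the one function `g ↦ F (r g) g`. Near a point `x` of `U` the germs `s y` all come from `F x`, so `F
y` and `F x` agree on arrows with range `y`, and the merged function represents `s` throughout `U`.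
The sheaf is in effect flabby. -/
theorem isCSoft_coindSheaf : (coindSheaf 𝒢 J).IsCSoft := by
  intro K U s _ hU hKU hs
  choose F hF using fun x => exists_germ (s x)
  refine ⟨U, fun x => germ 𝒢 x fun g => F (𝒢.r g) g, hU, hKU, subset_rfl, isSection_germ _, ?_⟩
  intro x hx
  rw [hF, germ_eq_iff]
  filter_upwards [eventually_eq_germ (b := fun x => x) ((hs x hx).continuousAt (hU.mem_nhds hx))
    (hF x)] with y hy g hg
  rw [hF y, germ_eq_iff] at hy
  subst hg
  exact (hy.self_of_nhds g rfl).symm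

/-- Evaluation of a germ at the unit. -/
def evalOne (x : X) : (coindSheaf 𝒢 J).stalk x →+ J :=
  QuotientAddGroup.lift ((coindSub 𝒢 J).sub x) (Pi.evalAddMonoidHom (fun _ : G => J) (𝒢.one x))
    fun _ hf => Filter.Eventually.self_of_nhds hf _ (𝒢.r_one x)

theorem evalOne_germ (x : X) (f : G → J) : evalOne x (germ 𝒢 x f) = f (𝒢.one x) := rfl

open Classical in
/-- Translation of a function by a local section. -/
noncomputable def translate (𝒢 : Grpd X G) (σ : X → G) : (G → J) →+ (G → J) where
  toFun f g := if e : 𝒢.r (σ (𝒢.r g)) = 𝒢.r g then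
    f (𝒢.mul (𝒢.inv (σ (𝒢.r g))) g ((𝒢.s_inv _).trans e)) else 0
  map_zero' := by
    funext g
    simp
  map_add' f f' := by
    funext g
    by_cases e : 𝒢.r (σ (𝒢.r g)) = 𝒢.r g <;> simp [e]

theorem translate_apply {σ : X → G} {f : G → J} {g k : G} (hσ : σ (𝒢.r g) = k)
    (e : 𝒢.r g = 𝒢.r k) :
    translate 𝒢 σ f g = f (𝒢.mul (𝒢.inv k) g ((𝒢.s_inv k).trans e.symm)) := by
  subst hσ
  exact dif_pos e.symm

/-- An arrow `k` with range `z` is sent to `σ(z)⁻¹ k`, with range `s (σ z)`, which tends to `s g` as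
`z` tends to `r g`. So the germ of the translate at `r g` depends only on the germ of `f` at `s g`.
-/
theorem translate_mem (h : 𝒢.IsEtale) {σ : X → G} {g : G} (hσ : 𝒢.IsLoc σ g) {f f' : G → J}
    (hf : germ 𝒢 (𝒢.s g) f = germ 𝒢 (𝒢.s g) f') :
    germ 𝒢 (𝒢.r g) (translate 𝒢 σ f) = germ 𝒢 (𝒢.r g) (translate 𝒢 σ f') := by
  rw [germ_eq_iff] at hf ⊢
  have hc : ContinuousAt (fun z => 𝒢.s (σ z)) (𝒢.r g) :=
    h.continuous_s.continuousAt.comp hσ.continuousAt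
  have hf' : ∀ᶠ z in 𝓝 (𝒢.r g), ∀ k, 𝒢.r k = 𝒢.s (σ z) → f k = f' k :=
    hc.eventually (p := fun y => ∀ k, 𝒢.r k = y → f k = f' k) (by simpa only [hσ.apply] using hf)
  filter_upwards [hf', hσ.eventually] with z h1 h2 k hk
  subst hk
  rw [translate_apply rfl h2.2.symm, translate_apply rfl h2.2.symm]
  exact h1 _ (by rw [𝒢.r_mul, 𝒢.r_inv])

theorem translate_congr {σ τ : X → G} {y : X} (h : ∀ᶠ z in 𝓝 y, σ z = τ z) (f : G → J) :
    germ 𝒢 y (translate 𝒢 σ f) = germ 𝒢 y (translate 𝒢 τ f) := by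
  rw [germ_eq_iff]
  filter_upwards [h] with z hz k hk
  subst hk
  by_cases e : 𝒢.r (τ (𝒢.r k)) = 𝒢.r k
  · rw [translate_apply hz e.symm, translate_apply rfl e.symm]
  · have h1 : translate 𝒢 τ f k = 0 := dif_neg e
    have h2 : translate 𝒢 σ f k = 0 := dif_neg (by rwa [hz])
    rw [h1, h2]

/-- The action on germs of functions. -/
noncomputable def coindAct (h : 𝒢.IsEtale) {x y : X} (g : G) (hs : 𝒢.s g = x) (hr : 𝒢.r g = y) :
    (coindSheaf 𝒢 J).stalk x →+ (coindSheaf 𝒢 J).stalk y :=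
  QuotientAddGroup.map ((coindSub 𝒢 J).sub x) ((coindSub 𝒢 J).sub y)
    (translate 𝒢 (h.exists_isLoc g).choose) fun f hf => by
      subst hs hr
      have h1 := translate_mem (f := 0) (f' := f) h (h.exists_isLoc g).choose_spec
        ((QuotientAddGroup.eq_zero_iff (N := (coindSub 𝒢 J).sub _) f).2 hf).symm
      exact (QuotientAddGroup.eq_zero_iff (N := (coindSub 𝒢 J).sub _) _).1 (h1.symm.trans
        (congrArg (germ 𝒢 (𝒢.r g)) (map_zero (translate 𝒢 _))))

/-- Any two local sections of `r` through `g` agree near `r g`, so the section chosen in the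
definition of the action may be replaced by any other. -/
theorem coindAct_germ (h : 𝒢.IsEtale) {x y : X} {g : G} (hs : 𝒢.s g = x) (hr : 𝒢.r g = y)
    {σ : X → G} (hσ : 𝒢.IsLoc σ g) (f : G → J) :
    coindAct h g hs hr (germ 𝒢 x f) = germ 𝒢 y (translate 𝒢 σ f) := by
  subst hr
  exact translate_congr ((h.exists_isLoc g).choose_spec.eventually_eq h hσ) f

/-- Translation by `g` carries the unit to `g⁻¹`. Hence evaluations at units of all translates of a
germ recover the function on the whole range fibre, which is why evaluation at units determines
morphisms to a coinduced sheaf. -/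
theorem evalOne_coindAct (h : 𝒢.IsEtale) {x y : X} {g : G} (hs : 𝒢.s g = x) (hr : 𝒢.r g = y)
    (f : G → J) : evalOne y (coindAct h g hs hr (germ 𝒢 x f)) = f (𝒢.inv g) := by
  obtain ⟨σ, hσ⟩ := h.exists_isLoc g
  rw [coindAct_germ h hs hr hσ, evalOne_germ]
  subst hr
  rw [translate_apply (k := g) (by rw [𝒢.r_one, hσ.apply]) (𝒢.r_one _)]
  congr 1
  refine Eq.trans (𝒢.mul_congr rfl ?_) (𝒢.mul_one _)
  rw [𝒢.s_inv]

open Classical in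
theorem exists_isLoc_mul (h : 𝒢.IsEtale) {σ τ : X → G} {g k : G} (e : 𝒢.s g = 𝒢.r k)
    (hσ : 𝒢.IsLoc σ g) (hτ : 𝒢.IsLoc τ k) : ∃ ρ, 𝒢.IsLoc ρ (𝒢.mul g k e) ∧
      ∀ᶠ z in 𝓝 (𝒢.r g), ∃ e', ρ z = 𝒢.mul (σ z) (τ (𝒢.s (σ z))) e' := by
  let P : X → Prop := fun z => 𝒢.s (σ z) = 𝒢.r (τ (𝒢.s (σ z)))
  let a : X → G := fun z => if P z then σ z else g
  let b : X → G := fun z => if P z then τ (𝒢.s (σ z)) else k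
  have hab : ∀ z, 𝒢.s (a z) = 𝒢.r (b z) := by
    intro z
    by_cases hz : P z
    · simp only [a, b, if_pos hz]; exact hz
    · simp only [a, b, if_neg hz]; exact e
  have hsσ : ContinuousAt (fun z => 𝒢.s (σ z)) (𝒢.r g) :=
    h.continuous_s.continuousAt.comp hσ.continuousAt
  have hk : 𝒢.r k = 𝒢.s (σ (𝒢.r g)) := by rw [hσ.apply, e]
  have hP : ∀ᶠ z in 𝓝 (𝒢.r g), P z := by
    have := hsσ.eventually (hk ▸ hτ.eventually)
    exact this.mono fun z hz => hz.2.symm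
  refine ⟨fun z => 𝒢.mul (a z) (b z) (hab z), ⟨?_, ?_⟩, ?_⟩
  · rw [𝒢.r_mul]
    refine 𝒢.mul_congr ?_ ?_
    · simp only [a, if_pos hP.self_of_nhds, hσ.apply]
    · simp only [b, if_pos hP.self_of_nhds]
      rw [← hk, hτ.apply]
  · rw [𝒢.r_mul]
    have hτ' := hsσ.eventually (hk ▸ hτ.eventually)
    filter_upwards [hP.eventually_nhds, hσ.eventually, hτ'] with z h1 h2 h3
    refine ⟨h.continuousAt_mul hab ?_ ?_, ?_⟩
    · exact h2.1.congr (h1.mono fun w hw => (if_pos hw).symm)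
    · have hc : ContinuousAt (fun w => τ (𝒢.s (σ w))) z :=
        ContinuousAt.comp (f := fun w => 𝒢.s (σ w)) h3.1
          (h.continuous_s.continuousAt.comp h2.1)
      exact hc.congr (h1.mono fun w hw => (if_pos hw).symm)
    · rw [𝒢.r_mul]
      simp only [a, if_pos h1.self_of_nhds, h2.2]
  · filter_upwards [hP] with z hz
    exact ⟨hz, 𝒢.mul_congr (if_pos hz) (if_pos hz)⟩

variable (J) in
/-- The coinduced `𝒢`-sheaf: germs of functions on the fibres of the range map, on which `𝒢` acts
by translation. -/
noncomputable def coind (h : 𝒢.IsEtale) : GSheaf 𝒢 where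
  sheaf := coindSheaf 𝒢 J
  act g hs hr := coindAct h g hs hr
  act_one x v := by
    obtain ⟨f, rfl⟩ := exists_germ v
    have h1 : 𝒢.IsLoc 𝒢.one (𝒢.one x) := ⟨by rw [𝒢.r_one], Filter.Eventually.of_forall fun z =>
      ⟨h.continuous_one.continuousAt, 𝒢.r_one z⟩⟩
    rw [coindAct_germ h _ _ h1, germ_eq_iff]
    refine Filter.Eventually.of_forall fun z k hk => ?_
    rw [translate_apply rfl (𝒢.r_one _).symm]
    exact congrArg f (𝒢.inv_mul_mul _ (𝒢.one_mul k))
  act_mul g k e v := by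
    obtain ⟨f, rfl⟩ := exists_germ v
    obtain ⟨σ, hσ⟩ := h.exists_isLoc g
    obtain ⟨τ, hτ⟩ := h.exists_isLoc k
    obtain ⟨ρ, hρ, hρe⟩ := exists_isLoc_mul h e hσ hτ
    rw [coindAct_germ h _ _ hρ, coindAct_germ h _ _ hτ]
    rw [coindAct_germ h _ _ hσ, germ_eq_iff]
    filter_upwards [hρe, hσ.eventually] with z hz h3 w hw
    obtain ⟨e', hz⟩ := hz
    subst hw
    have hw : 𝒢.r (σ (𝒢.r w)) = 𝒢.r w := h3.2
    rw [translate_apply hz (by rw [𝒢.r_mul, hw]), translate_apply rfl hw.symm]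
    have hr : 𝒢.r (𝒢.mul (𝒢.inv (σ (𝒢.r w))) w ((𝒢.s_inv _).trans hw)) = 𝒢.s (σ (𝒢.r w)) := by
      rw [𝒢.r_mul, 𝒢.r_inv]
    rw [translate_apply (k := τ (𝒢.s (σ (𝒢.r w)))) (congrArg τ hr) (hr.trans e')]
    exact congrArg f (𝒢.inv_mul_eq e' hw.symm)
  continuous_act := by
    rw [continuous_iff_continuousAt]
    rintro ⟨⟨g, ⟨x, v⟩⟩, hx⟩
    obtain ⟨f, rfl⟩ := exists_germ v
    obtain ⟨σ, hσ⟩ := h.exists_isLoc g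
    set W := {p : G × Total (coindSheaf 𝒢 J).stalk // 𝒢.s p.1 = p.2.base}
    have hc1 : Continuous fun p : W => p.1.1 := continuous_fst.comp continuous_subtype_val
    have hc2 : Continuous fun p : W => p.1.2 := continuous_snd.comp continuous_subtype_val
    have hr : Continuous fun p : W => 𝒢.r p.1.1 := h.isLocalHomeomorph_r.continuous.comp hc1
    -- Near the given point the action is given by the germs of a single function, the translate of
    -- `f` by `σ`: neighbouring elements of the étale space are germs of the same `f`, and `σ` is
    -- also a local section through each neighbouring arrow.
    refine ((isSection_germ (translate 𝒢 σ f)).comp hr).continuousAt.congr ?_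
    have e1 := eventually_eq_germ (b := fun p : W => p.1.2.base) (s := fun p => p.1.2.val)
      (z := ⟨(g, ⟨x, germ 𝒢 x f⟩), hx⟩) (f := f) hc2.continuousAt rfl
    have e2 := (hc1.continuousAt (x := ⟨(g, ⟨x, germ 𝒢 x f⟩), hx⟩)).eventually
      (hσ.eventually_apply_r h)
    have e3 := (hr.continuousAt (x := ⟨(g, ⟨x, germ 𝒢 x f⟩), hx⟩)).eventually
      hσ.eventually_isLoc
    filter_upwards [e1, e2, e3] with p h1 h2 h3
    have h4 : 𝒢.IsLoc σ p.1.1 := h2 ▸ h3.2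
    exact congrArg (Total.mk (𝒢.r p.1.1)) (Eq.trans (coindAct_germ h p.2 rfl h4 f).symm
      (congrArg _ h1.symm))

end Coind

/-! ### Morphisms into coinduced sheaves. -/

section Adjoint

variable {J : Type u} [AddCommGroup J] (B : GSheaf 𝒢) (β : ∀ x, B.sheaf.stalk x →+ J)

/-- The function on arrows given by a section and a family of homomorphisms. -/
def adjFun (b : ∀ x, B.sheaf.stalk x) (g : G) : J :=
  β (𝒢.s g) (B.act (𝒢.inv g) (𝒢.s_inv g) (𝒢.r_inv g) (b (𝒢.r g)))

variable {B}

theorem adjFun_eq (b : ∀ x, B.sheaf.stalk x) {x y : X} {g k : G} (hk : 𝒢.inv g = k)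
    (hs : 𝒢.s g = x) (hr : 𝒢.r g = y) (h1 : 𝒢.s k = y) (h2 : 𝒢.r k = x) :
    adjFun B β b g = β x (B.act k h1 h2 (b y)) := by
  subst hk hs hr
  rfl

theorem germ_adjFun_congr {b b' : ∀ x, B.sheaf.stalk x} {x : X} (h : ∀ᶠ y in 𝓝 x, b y = b' y) :
    germ 𝒢 x (adjFun B β b) = germ 𝒢 x (adjFun B β b') := by
  rw [germ_eq_iff]
  filter_upwards [h] with y hy g hg
  subst hg
  simp only [adjFun, hy]

variable (B) in
theorem exists_localSec (x : X) (v : B.sheaf.stalk x) : ∃ b : ∀ y, B.sheaf.stalk y, b x = v ∧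
    ∀ᶠ y in 𝓝 x, ContinuousAt (fun y => (⟨y, b y⟩ : Total B.sheaf.stalk)) y := by
  let _ : ∀ x, Inhabited (B.sheaf.stalk x) := fun x => ⟨0⟩
  exact exists_section_through B.sheaf.isLocalHomeomorph_base x v

/-- The homomorphism of stalks to the coinduced sheaf given by a family of homomorphisms. -/
noncomputable def adjStalk (x : X) : B.sheaf.stalk x →+ (coindSheaf 𝒢 J).stalk x :=
  AddMonoidHom.mk' (fun v => germ 𝒢 x (adjFun B β (B.exists_localSec x v).choose)) fun v w => by
    have h1 := (B.exists_localSec x v).choose_spec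
    have h2 := (B.exists_localSec x w).choose_spec
    have h3 := (B.exists_localSec x (v + w)).choose_spec
    set b₁ := (B.exists_localSec x v).choose
    set b₂ := (B.exists_localSec x w).choose
    set b₃ := (B.exists_localSec x (v + w)).choose
    have h4 := eventually_eq_of_eq (b := fun y : X => y) B.sheaf.isLocalHomeomorph_base
      h3.2.self_of_nhds
      (AbSheaf.continuousAt_add (b := fun y : X => y) h1.2.self_of_nhds h2.2.self_of_nhds)
      (by rw [h1.1, h2.1, h3.1])
    rw [germ_adjFun_congr β h4, ← germ_add]
    congr 1
    funext g
    simp only [adjFun, map_add, Pi.add_apply]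

theorem adjStalk_eq {x : X} {b : ∀ y, B.sheaf.stalk y}
    (hb : ContinuousAt (fun y => (⟨y, b y⟩ : Total B.sheaf.stalk)) x) :
    adjStalk β x (b x) = germ 𝒢 x (adjFun B β b) := by
  have h1 := (B.exists_localSec x (b x)).choose_spec
  exact germ_adjFun_congr β (eventually_eq_of_eq (b := fun y : X => y)
    B.sheaf.isLocalHomeomorph_base h1.2.self_of_nhds hb h1.1)

theorem evalOne_adjStalk {x : X} (v : B.sheaf.stalk x) : evalOne x (adjStalk β x v) = β x v := by
  obtain ⟨b, rfl, hb⟩ := B.exists_localSec x v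
  rw [adjStalk_eq β hb.self_of_nhds, evalOne_germ,
    adjFun_eq β b (𝒢.inv_one x) (𝒢.s_one x) (𝒢.r_one x) (𝒢.s_one x) (𝒢.r_one x), B.act_one]

/-- Take a section `b` through `v` and a local section `σ` through `g`. The section `b'(y) = σ(y) ·
b(s(σ y))` passes through `g v`, and near `r g` its function on arrows is the translate by `σ` of
that of `b`, because `k⁻¹ σ(r k)` is the inverse of `σ(r k)⁻¹ k`. -/
theorem adjStalk_act (h : 𝒢.IsEtale) {x y : X} (g : G) (hs : 𝒢.s g = x) (hr : 𝒢.r g = y)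
    (v : B.sheaf.stalk x) :
    adjStalk β y (B.act g hs hr v) = coindAct h g hs hr (adjStalk β x v) := by
  classical
  subst hs hr
  obtain ⟨b, rfl, hb⟩ := B.exists_localSec (𝒢.s g) v
  obtain ⟨σ, hσ⟩ := h.exists_isLoc g
  rw [adjStalk_eq β hb.self_of_nhds, coindAct_germ h _ _ hσ]
  let b' : ∀ y, B.sheaf.stalk y := fun y =>
    if e : 𝒢.r (σ y) = y then B.act (σ y) rfl e (b (𝒢.s (σ y))) else 0
  have hb' : ∀ {y : X} {k : G} (_ : σ y = k) (hr : 𝒢.r k = y), b' y = B.act k rfl hr (b (𝒢.s k)) := by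
    rintro y k rfl hr
    exact dif_pos hr
  have hsσ : ContinuousAt (fun z => 𝒢.s (σ z)) (𝒢.r g) :=
    h.continuous_s.continuousAt.comp hσ.continuousAt
  have hbc : ContinuousAt (fun y => (⟨y, b' y⟩ : Total B.sheaf.stalk)) (𝒢.r g) := by
    let q : X → {p : G × Total B.sheaf.stalk // 𝒢.s p.1 = p.2.base} := fun z =>
      ⟨(σ z, ⟨𝒢.s (σ z), b (𝒢.s (σ z))⟩), rfl⟩
    have hq : ContinuousAt q (𝒢.r g) := by
      refine Topology.IsInducing.subtypeVal.continuousAt_iff.2 (hσ.continuousAt.prodMk ?_)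
      refine ContinuousAt.comp (f := fun z => 𝒢.s (σ z))
        (g := fun y => (⟨y, b y⟩ : Total B.sheaf.stalk)) ?_ hsσ
      rw [hσ.apply]
      exact hb.self_of_nhds
    refine (B.continuous_act.continuousAt.comp hq).congr ?_
    filter_upwards [hσ.eventually] with z hz
    have hz : 𝒢.r (σ z) = z := hz.2
    change (⟨𝒢.r (σ z), B.act (σ z) rfl rfl (b (𝒢.s (σ z)))⟩ : Total B.sheaf.stalk) = ⟨z, b' z⟩
    rw [hb' rfl hz]
    generalize σ z = k at hz
    subst hz
    rfl
  rw [← hb' hσ.apply rfl, adjStalk_eq β hbc, germ_eq_iff]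
  filter_upwards [hσ.eventually] with z hz k hk
  subst hk
  have hz : 𝒢.r (σ (𝒢.r k)) = 𝒢.r k := hz.2
  rw [translate_apply rfl hz.symm]
  rw [adjFun_eq β b (𝒢.inv_mul_inv hz) (𝒢.s_mul _ _ _) ((𝒢.r_mul _ _ _).trans (𝒢.r_inv _))
    (𝒢.s_mul _ _ _) ((𝒢.r_mul _ _ _).trans (𝒢.r_inv _))]
  rw [adjFun, hb' rfl hz]
  exact congrArg _ (B.act_mul' ((𝒢.s_inv k).trans hz.symm) rfl _ _ _ _ _ _ _).symm

variable (B) in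
/-- The morphism to a coinduced sheaf given by a family of homomorphisms. -/
noncomputable def adj (h : 𝒢.IsEtale) : B.Hom (coind J h) where
  φ x := adjStalk β x
  continuous_φ := by
    rw [continuous_iff_continuousAt]
    rintro ⟨x, v⟩
    obtain ⟨b, rfl, hb⟩ := B.exists_localSec x v
    have hbase := B.sheaf.continuous_base
    refine ((isSection_germ (adjFun B β b)).comp hbase).continuousAt.congr ?_
    have e1 := eventually_eq_of_eq (b := fun e : Total B.sheaf.stalk => e.base)
      (s := fun e => e.val) (t := fun e => b e.base) (z₀ := ⟨x, b x⟩)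
      B.sheaf.isLocalHomeomorph_base continuousAt_id
      (hb.self_of_nhds.comp (f := fun e : Total B.sheaf.stalk => e.base) (x := ⟨x, b x⟩)
        hbase.continuousAt) rfl
    filter_upwards [e1, (hbase.continuousAt (x := ⟨x, b x⟩)).eventually hb] with e h1 h2
    exact congrArg (Total.mk e.base) ((adjStalk_eq β h2).symm.trans (congrArg _ h1.symm))
  equivariant g hs hr v := adjStalk_act β h g hs hr v

/-- A morphism to a coinduced sheaf is determined by its values at the units. -/
theorem Hom.ext_coind (h : 𝒢.IsEtale) (φ ψ : B.Hom (coind J h))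
    (he : ∀ x v, evalOne x (φ.φ x v) = evalOne x (ψ.φ x v)) (x : X) (v : B.sheaf.stalk x) :
    φ.φ x v = ψ.φ x v := by
  have key : ∀ φ : B.Hom (coind J h), φ.φ x v =
      adjStalk (fun x => (evalOne x).comp (φ.φ x)) x v := by
    intro φ
    obtain ⟨b, rfl, hb⟩ := B.exists_localSec x v
    obtain ⟨f, hf⟩ := exists_germ (φ.φ x (b x))
    rw [adjStalk_eq _ hb.self_of_nhds]
    refine Eq.trans hf (germ_eq_iff.2 ?_)
    have h1 := eventually_eq_germ (b := fun y : X => y) (s := fun y => φ.φ y (b y))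
      (φ.continuous_φ.continuousAt.comp hb.self_of_nhds) hf
    filter_upwards [h1] with y hy g hg
    subst hg
    -- By equivariance `φ (g⁻¹ b) = g⁻¹ φ(b)`, and the value of `g⁻¹ φ(b)` at the unit is the value
    -- at `g` of the function that represents `φ(b)`.
    change _ = evalOne _ (φ.φ _ (B.act _ _ _ _))
    rw [φ.equivariant]
    refine (Eq.trans (congrArg (fun w => evalOne _
      (coindAct h (𝒢.inv g) (𝒢.s_inv g) (𝒢.r_inv g) w)) hy) ?_).symm
    rw [evalOne_coindAct, 𝒢.inv_inv]
  have h1 : (fun x => (evalOne x).comp (φ.φ x)) = fun x => (evalOne x).comp (ψ.φ x) :=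
    funext fun x => AddMonoidHom.ext (he x)
  rw [key φ, key ψ, h1]

/-- One direction is evaluation at the unit. For the other, if `β` kills `v` then, the kernels being
open and invariant, it kills `g⁻¹ b(r g)` for all `g` with range near `x`, where `b` is a section
through `v`. -/
theorem adj_eq_zero_iff (h : 𝒢.IsEtale)
    (hK : IsOpen {e : Total B.sheaf.stalk | β e.base e.val = 0})
    (hinv : ∀ {x y : X} (g : G) (hs : 𝒢.s g = x) (hr : 𝒢.r g = y) (v : B.sheaf.stalk x),
      β x v = 0 → β y (B.act g hs hr v) = 0) (x : X) (v : B.sheaf.stalk x) :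
    (B.adj β h).φ x v = 0 ↔ β x v = 0 := by
  refine ⟨fun h0 => ?_, fun h0 => ?_⟩
  · rw [← evalOne_adjStalk]
    exact (congrArg (evalOne x) h0).trans (map_zero _)
  · obtain ⟨b, rfl, hb⟩ := B.exists_localSec x v
    refine (adjStalk_eq β hb.self_of_nhds).trans ((germ_eq_iff (f' := 0)).2 ?_)
    filter_upwards [hb.self_of_nhds.eventually (hK.mem_nhds h0)] with y hy g hg
    subst hg
    exact hinv _ _ _ _ hy

end Adjoint

end GSheaf

/-! ### Resolutions by coinduced sheaves -/

section Resolution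

theorem exists_extend_of_injective {J : AddCommGrpCat.{u}} [Injective J] {M M' : Type u}
    [AddCommGroup M] [AddCommGroup M'] (f : M →+ M') (β : M →+ J) (h : f.ker ≤ β.ker) :
    ∃ β' : M' →+ J, ∀ v, β' (f v) = β v := by
  let γ : f.range →+ J := f.rangeRestrict.liftOfSurjective f.rangeRestrict_surjective
    ⟨β, by rwa [AddMonoidHom.ker_rangeRestrict]⟩
  let i : AddCommGrpCat.of f.range ⟶ AddCommGrpCat.of M' := AddCommGrpCat.ofHom f.range.subtype
  have : Mono i := (AddCommGrpCat.mono_iff_injective i).2 Subtype.val_injective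
  refine ⟨(Injective.factorThru (AddCommGrpCat.ofHom γ) i).hom, fun v => ?_⟩
  have h1 := ConcreteCategory.congr_hom (Injective.comp_factorThru (AddCommGrpCat.ofHom γ) i)
    (f.rangeRestrict v)
  refine h1.trans ?_
  exact AddMonoidHom.liftOfRightInverse_comp_apply _ _ _ _ _

variable {X G : Type u} [TopologicalSpace X] [TopologicalSpace G] {𝒢 : Grpd X G}

/-- Morphisms into `coind J` are arbitrary families of homomorphisms from the stalks to `J`, so the
extension problem is solved stalk by stalk by injectivity of `J`. Asking only that `φ` kill the
kernel of `f`, rather than that `f` be injective, allows `f` to be a differential of a resolution.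
-/
theorem GSheaf.Hom.exists_extend (h : 𝒢.IsEtale) {J : AddCommGrpCat.{u}} [Injective J]
    {B B' : GSheaf 𝒢} (f : B.Hom B') (φ : B.Hom (GSheaf.coind J h))
    (hk : ∀ x v, f.φ x v = 0 → φ.φ x v = 0) :
    ∃ φ' : B'.Hom (GSheaf.coind J h), ∀ x v, φ'.φ x (f.φ x v) = φ.φ x v := by
  choose β hβ using fun x => exists_extend_of_injective (f.φ x)
    ((GSheaf.evalOne (𝒢 := 𝒢) (J := J) x).comp (φ.φ x))
    fun v hv => (congrArg (GSheaf.evalOne x) (hk x v hv)).trans (map_zero _)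
  refine ⟨B'.adj β h, ?_⟩
  let ψ : B.Hom (GSheaf.coind J h) :=
    { φ := fun x => ((B'.adj β h).φ x).comp (f.φ x)
      continuous_φ := (B'.adj β h).continuous_φ.comp f.continuous_φ
      equivariant := fun g hs hr v => by
        simp only [AddMonoidHom.comp_apply, f.equivariant, (B'.adj β h).equivariant] }
  exact GSheaf.Hom.ext_coind h ψ φ fun x v => (GSheaf.evalOne_adjStalk β _).trans (hβ x v)

/-- A `𝒢`-sheaf with an invariant subsheaf. -/
structure GSheaf.Pair (𝒢 : Grpd X G) where
  S : GSheaf 𝒢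
  K : ∀ x, AddSubgroup (S.sheaf.stalk x)
  isOpen : IsOpen {e : Total S.sheaf.stalk | e.val ∈ K e.base}
  act_mem : ∀ {x y : X} (g : G) (hs : 𝒢.s g = x) (hr : 𝒢.r g = y) (v : S.sheaf.stalk x),
    v ∈ K x → S.act g hs hr v ∈ K y

namespace GSheaf.Pair

variable (P : GSheaf.Pair 𝒢)

/-- An injective group that contains all stalks of the quotient. -/
noncomputable def inj : AddCommGrpCat.{u} :=
  Injective.under (AddCommGrpCat.of (∀ x, P.S.sheaf.stalk x ⧸ P.K x))

instance : Injective P.inj := inferInstanceAs (Injective (Injective.under _))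

open Classical in
/-- The family of homomorphisms to the injective group. -/
noncomputable def toInj (x : X) : P.S.sheaf.stalk x →+ P.inj :=
  (Injective.ι (AddCommGrpCat.of (∀ x, P.S.sheaf.stalk x ⧸ P.K x))).hom.comp
    ((AddMonoidHom.single (fun x => P.S.sheaf.stalk x ⧸ P.K x) x).comp
      (QuotientAddGroup.mk' (P.K x)))

theorem toInj_eq_zero_iff (x : X) (v : P.S.sheaf.stalk x) : P.toInj x v = 0 ↔ v ∈ P.K x := by
  have hi := (AddCommGrpCat.mono_iff_injective
    (Injective.ι (AddCommGrpCat.of (∀ x, P.S.sheaf.stalk x ⧸ P.K x)))).1 inferInstance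
  refine (map_eq_zero_iff _ hi).trans ?_
  refine Iff.trans ?_ (QuotientAddGroup.eq_zero_iff v)
  classical
  exact Pi.single_eq_zero_iff (i := x)

/-- The embedding of the quotient in a coinduced sheaf. -/
noncomputable def toCoind (h : 𝒢.IsEtale) : P.S.Hom (GSheaf.coind P.inj h) := P.S.adj P.toInj h

/-- The two conditions of `adj_eq_zero_iff` are the openness and invariance of the subsheaf. With
`K` the range of the preceding map, this equality of kernels is the exactness of the resolution. -/
theorem toCoind_eq_zero_iff (h : 𝒢.IsEtale) (x : X) (v : P.S.sheaf.stalk x) :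
    (P.toCoind h).φ x v = 0 ↔ v ∈ P.K x := by
  refine (GSheaf.adj_eq_zero_iff P.toInj h ?_ (fun g hs hr v hv => ?_) x v).trans
    (P.toInj_eq_zero_iff x v)
  · simpa only [toInj_eq_zero_iff] using P.isOpen
  · rw [toInj_eq_zero_iff] at hv ⊢
    exact P.act_mem g hs hr v hv

/-- If `b` is a section through a preimage of `w`, then `α b` is a section through `w`, and every
element of the étale space near `w` lies on it. -/
theorem isOpen_range {S T : GSheaf 𝒢} (α : S.Hom T) :
    IsOpen {e : Total T.sheaf.stalk | e.val ∈ (α.φ e.base).range} := by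
  rw [isOpen_iff_mem_nhds]
  rintro ⟨x, w⟩ hw
  obtain ⟨v, rfl⟩ : w ∈ (α.φ x).range := hw
  obtain ⟨b, rfl, hb⟩ := S.exists_localSec x v
  have hbase := T.sheaf.continuous_base
  have e1 := eventually_eq_of_eq (b := fun e : Total T.sheaf.stalk => e.base)
    (s := fun e => e.val) (t := fun e => α.φ e.base (b e.base)) (z₀ := ⟨x, α.φ x (b x)⟩)
    T.sheaf.isLocalHomeomorph_base continuousAt_id
    ((α.continuous_φ.continuousAt.comp hb.self_of_nhds).comp
      (f := fun e : Total T.sheaf.stalk => e.base) (x := ⟨x, α.φ x (b x)⟩)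
      hbase.continuousAt) rfl
  filter_upwards [e1] with e he
  exact ⟨_, he.symm⟩

/-- The next step of the coinduced resolution. -/
noncomputable def next (h : 𝒢.IsEtale) : GSheaf.Pair 𝒢 where
  S := GSheaf.coind P.inj h
  K x := ((P.toCoind h).φ x).range
  isOpen := isOpen_range _
  act_mem := by
    rintro x y g hs hr _ ⟨v, rfl⟩
    exact ⟨_, (P.toCoind h).equivariant g hs hr v⟩

/-- The iterated steps of the coinduced resolution. -/
noncomputable def iter (h : 𝒢.IsEtale) : ℕ → GSheaf.Pair 𝒢
  | 0 => P.next h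
  | n + 1 => (iter h n).next h

end GSheaf.Pair

/-- A `𝒢`-sheaf with its zero subsheaf. -/
def GSheaf.pairBot (A : GSheaf 𝒢) : GSheaf.Pair 𝒢 where
  S := A
  K _ := ⊥
  isOpen := by
    rw [isOpen_iff_mem_nhds]
    rintro ⟨x, v⟩ hv
    obtain rfl : v = 0 := hv
    exact eventually_eq_of_eq A.sheaf.isLocalHomeomorph_base
      (b := fun e : Total A.sheaf.stalk => e.base) (s := fun e => e.val) (t := fun e => 0)
      (z₀ := ⟨x, 0⟩) continuousAt_id (AbSheaf.continuousAt_zero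
        A.sheaf.continuous_base.continuousAt) rfl
  act_mem g hs hr v hv := by
    rw [AddSubgroup.mem_bot] at hv ⊢
    rw [hv, map_zero]

/-- The canonical resolution by coinduced sheaves. -/
noncomputable def GSheaf.resolution (A : GSheaf 𝒢) (h : 𝒢.IsEtale) : GComplex 𝒢 where
  S n := (A.pairBot.iter h n).S
  d n := (A.pairBot.iter h n).toCoind h
  d_d n x v := ((A.pairBot.iter h (n + 1)).toCoind_eq_zero_iff h x _).2 ⟨v, rfl⟩

theorem GSheaf.exists_resolution_eq (A : GSheaf 𝒢) (h : 𝒢.IsEtale) (n : ℕ) :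
    ∃ (J : AddCommGrpCat.{u}) (_ : Injective J), (A.resolution h).S n = GSheaf.coind J h := by
  cases n with
  | zero => exact ⟨A.pairBot.inj, inferInstance, rfl⟩
  | succ n => exact ⟨(A.pairBot.iter h n).inj, inferInstance, rfl⟩

theorem GSheaf.resolution_isCSoftResolution (A : GSheaf 𝒢) (h : 𝒢.IsEtale) :
    (A.resolution h).IsCSoftResolution A := by
  refine ⟨fun q => ?_, A.pairBot.toCoind h, fun x => ⟨?_, ?_, fun q => ?_⟩⟩
  · obtain ⟨J, _, e⟩ := A.exists_resolution_eq h q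
    rw [e]
    exact GSheaf.isCSoft_coindSheaf
  · rw [injective_iff_map_eq_zero]
    exact fun v hv => (A.pairBot.toCoind_eq_zero_iff h x v).1 hv
  · exact fun v => (A.pairBot.iter h 0).toCoind_eq_zero_iff h x v
  · exact fun v => (A.pairBot.iter h (q + 1)).toCoind_eq_zero_iff h x v

/-- A morphism of complexes of `𝒢`-sheaves. -/
structure GComplex.Hom (C D : GComplex 𝒢) where
  f : ∀ q, (C.S q).Hom (D.S q)
  comm : ∀ q x v, (f (q + 1)).φ x ((C.d q).φ x v) = (D.d q).φ x ((f q).φ x v)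

theorem GSheaf.resolution_exists_extend (A : GSheaf 𝒢) (h : 𝒢.IsEtale) (n : ℕ) {B B' : GSheaf 𝒢}
    (f : B.Hom B') (φ : B.Hom ((A.resolution h).S n)) (hk : ∀ x v, f.φ x v = 0 → φ.φ x v = 0) :
    ∃ φ' : B'.Hom ((A.resolution h).S n), ∀ x v, φ'.φ x (f.φ x v) = φ.φ x v := by
  obtain ⟨J, _, e⟩ := A.exists_resolution_eq h n
  revert φ
  rw [e]
  exact fun φ hk => f.exists_extend h φ hk

/-- The composition of morphisms of `𝒢`-sheaves. -/
def GSheaf.Hom.comp {S T U : GSheaf 𝒢} (β : T.Hom U) (α : S.Hom T) : S.Hom U where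
  φ x := (β.φ x).comp (α.φ x)
  continuous_φ := β.continuous_φ.comp α.continuous_φ
  equivariant g hs hr v := by
    simp only [AddMonoidHom.comp_apply, α.equivariant, β.equivariant]

/-- Every resolution maps to the canonical one. -/
theorem GComplex.exists_hom_resolution {A : GSheaf 𝒢} {C : GComplex 𝒢}
    {ε : A.Hom (C.S 0)} (hε : ∀ x, Function.Injective (ε.φ x) ∧
      Function.Exact (ε.φ x) ((C.d 0).φ x) ∧
      ∀ q, Function.Exact ((C.d q).φ x) ((C.d (q + 1)).φ x))
    {D : GComplex 𝒢} {ε' : A.Hom (D.S 0)} (hε' : ∀ x v, (D.d 0).φ x (ε'.φ x v) = 0)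
    (hD : ∀ (n : ℕ) {B B' : GSheaf 𝒢} (f : B.Hom B') (φ : B.Hom (D.S n)),
      (∀ x v, f.φ x v = 0 → φ.φ x v = 0) →
      ∃ φ' : B'.Hom (D.S n), ∀ x v, φ'.φ x (f.φ x v) = φ.φ x v) :
    ∃ F : C.Hom D, ∀ x v, (F.f 0).φ x (ε.φ x v) = ε'.φ x v := by
  -- The recursion carries along exactly the hypothesis of the next extension: `d ∘ f` kills the
  -- kernel of the differential of `C`. Exactness of `C` and `d ∘ d = 0` in `D` renew it.
  let P : ℕ → Type u := fun q => {f : (C.S q).Hom (D.S q) //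
    ∀ x v, (C.d q).φ x v = 0 → (D.d q).φ x (f.φ x v) = 0}
  obtain ⟨f₀, hf₀⟩ := hD 0 ε ε' fun x v hv => by
    rw [(hε x).1 (hv.trans (map_zero _).symm), map_zero]
  let p₀ : P 0 := ⟨f₀, fun x v hv => by
    obtain ⟨a, rfl⟩ := ((hε x).2.1 v).1 hv
    rw [hf₀, hε']⟩
  have hstep : ∀ (q : ℕ) (p : P q), ∃ p' : P (q + 1), ∀ x v,
      p'.1.φ x ((C.d q).φ x v) = (D.d q).φ x (p.1.φ x v) := by
    intro q p
    obtain ⟨f', hf'⟩ := hD (q + 1) (C.d q) ((D.d q).comp p.1) p.2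
    refine ⟨⟨f', fun x v hv => ?_⟩, hf'⟩
    obtain ⟨w, rfl⟩ := ((hε x).2.2 q v).1 hv
    rw [hf']
    exact D.d_d q x _
  choose g hg using hstep
  let F : ∀ q, P q := fun q => Nat.rec p₀ (fun q p => g q p) q
  exact ⟨⟨fun q => (F q).1, fun q => hg q (F q)⟩, hf₀⟩

end Resolution

end EtaleHomology

namespace EtaleHomology

/-! ### Elements of total complexes -/

section TotalComplex

open ComplexShape

/-- Double complexes of abelian groups with entries in bidegrees `(q, p)`. -/
abbrev Bicomplex : Type (u + 1) :=
  HomologicalComplex₂ AddCommGrpCat.{u} (ComplexShape.up ℕ) (ComplexShape.down ℕ)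

namespace Bicomplex

variable (K L : Bicomplex.{u})

/-- The total complex. -/
noncomputable abbrev tot : ChainComplex AddCommGrpCat.{u} ℤ := K.total (ComplexShape.down ℤ)

/-- The bidegrees of total degree `n`. -/
abbrev Idx (n : ℤ) : Type := {i : ℕ × ℕ // (i.2 : ℤ) - i.1 = n}

/-- The inclusion of an entry in the total complex. -/
noncomputable def inc {n : ℤ} (i : Idx n) : (K.X i.1.1).X i.1.2 →+ K.tot.X n :=
  (K.ιTotal (ComplexShape.down ℤ) i.1.1 i.1.2 n i.2).hom

/-- The components of an element of the total complex, as a homomorphism. -/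
noncomputable def compsHom (n : ℤ) :
    K.tot.X n ⟶ AddCommGrpCat.of (Π₀ i : Idx n, (K.X i.1.1).X i.1.2) :=
  K.totalDesc fun q p h => AddCommGrpCat.ofHom
    (DFinsupp.singleAddHom (fun i : Idx n => (K.X i.1.1).X i.1.2) ⟨(q, p), h⟩)

theorem compsHom_inc {n : ℤ} (i : Idx n) (a : (K.X i.1.1).X i.1.2) :
    (K.compsHom n).hom (K.inc i a) = DFinsupp.single i a :=
  ConcreteCategory.congr_hom (K.ι_totalDesc (c₁₂ := ComplexShape.down ℤ)
    (fun q p h => AddCommGrpCat.ofHom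
      (DFinsupp.singleAddHom (fun i : Idx n => (K.X i.1.1).X i.1.2) ⟨(q, p), h⟩))
    i.1.1 i.1.2 i.2) a

variable {K L}

theorem hom_ext {n : ℤ} {A : Type u} [AddCommGroup A] {f g : K.tot.X n →+ A}
    (h : ∀ i a, f (K.inc i a) = g (K.inc i a)) : f = g := by
  have : AddCommGrpCat.ofHom f = AddCommGrpCat.ofHom g :=
    HomologicalComplex₂.total.hom_ext _ fun q p hqp =>
      AddCommGrpCat.hom_ext (AddMonoidHom.ext fun a => h ⟨(q, p), hqp⟩ a)
  exact congrArg AddCommGrpCat.Hom.hom this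

variable (K) in
/-- The elements of the total complex are finitely supported families. -/
noncomputable def comps (n : ℤ) : K.tot.X n ≃+ Π₀ i : Idx n, (K.X i.1.1).X i.1.2 :=
  AddMonoidHom.toAddEquiv (K.compsHom n).hom (DFinsupp.liftAddHom fun i => K.inc i)
    (hom_ext fun i a => by
      rw [AddMonoidHom.comp_apply, compsHom_inc, DFinsupp.liftAddHom_apply_single]
      rfl)
    (DFinsupp.addHom_ext fun i a => by
      rw [AddMonoidHom.comp_apply, DFinsupp.liftAddHom_apply_single, compsHom_inc]
      rfl)

@[simp] theorem comps_inc {n : ℤ} (i : Idx n) (a : (K.X i.1.1).X i.1.2) :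
    K.comps n (K.inc i a) = DFinsupp.single i a := K.compsHom_inc i a

/-- The map induced on total complexes. -/
noncomputable def mapTot (f : K ⟶ L) (n : ℤ) : K.tot.X n →+ L.tot.X n :=
  ((HomologicalComplex₂.total.map f (ComplexShape.down ℤ)).f n).hom

theorem mapTot_inc (f : K ⟶ L) {n : ℤ} (i : Idx n) (a : (K.X i.1.1).X i.1.2) :
    mapTot f n (K.inc i a) = L.inc i (((f.f i.1.1).f i.1.2).hom a) :=
  ConcreteCategory.congr_hom
    (HomologicalComplex₂.ιTotal_map K L f (ComplexShape.down ℤ) i.1.1 i.1.2 n i.2) a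

theorem comps_mapTot (f : K ⟶ L) {n : ℤ} (x : K.tot.X n) (i : Idx n) :
    L.comps n (mapTot f n x) i = ((f.f i.1.1).f i.1.2).hom (K.comps n x i) := by
  classical
  have : (DFinsupp.evalAddMonoidHom i).comp ((L.comps n).toAddMonoidHom.comp (mapTot f n)) =
      ((f.f i.1.1).f i.1.2).hom.comp
        ((DFinsupp.evalAddMonoidHom i).comp (K.comps n).toAddMonoidHom) := by
    refine hom_ext fun j a => ?_
    change L.comps n (mapTot f n (K.inc j a)) i =
      ((f.f i.1.1).f i.1.2).hom (K.comps n (K.inc j a) i)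
    rw [mapTot_inc, comps_inc, comps_inc]
    by_cases h : j = i
    · subst h
      rw [DFinsupp.single_eq_same, DFinsupp.single_eq_same]
    · rw [DFinsupp.single_eq_of_ne (Ne.symm h), DFinsupp.single_eq_of_ne (Ne.symm h), map_zero]
  exact DFunLike.congr_fun this x

/-- The differential of the total complex. -/
noncomputable def dTot (K : Bicomplex.{u}) (n : ℤ) : K.tot.X (n + 1) →+ K.tot.X n :=
  (K.tot.d (n + 1) n).hom

theorem dTot_dTot (n : ℤ) (x : K.tot.X (n + 1 + 1)) : K.dTot n (K.dTot (n + 1) x) = 0 :=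
  ConcreteCategory.congr_hom (K.tot.d_comp_d (n + 1 + 1) (n + 1) n) x

theorem mapTot_dTot (f : K ⟶ L) (n : ℤ) (x : K.tot.X (n + 1)) :
    mapTot f n (K.dTot n x) = L.dTot n (mapTot f (n + 1) x) :=
  (ConcreteCategory.congr_hom
    ((HomologicalComplex₂.total.map f (ComplexShape.down ℤ)).comm (n + 1) n) x).symm

/-- The elements of the total complex with components in degrees `p < P` only. -/
def fil (K : Bicomplex.{u}) (P : ℕ) (n : ℤ) : AddSubgroup (K.tot.X n) where
  carrier := {x | ∀ i : Idx n, P ≤ i.1.2 → K.comps n x i = 0}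
  zero_mem' i _ := by rw [map_zero]; rfl
  add_mem' hx hy i hi := by rw [map_add, DFinsupp.add_apply, hx i hi, hy i hi, add_zero]
  neg_mem' hx i hi := by rw [map_neg, DFinsupp.neg_apply, hx i hi, neg_zero]

theorem inc_mem_fil {P : ℕ} {n : ℤ} (i : Idx n) (a : (K.X i.1.1).X i.1.2) (h : i.1.2 < P) :
    K.inc i a ∈ K.fil P n := by
  classical
  intro j hj
  rw [comps_inc, DFinsupp.single_eq_of_ne]
  rintro rfl
  omega

theorem exists_mem_fil {n : ℤ} (x : K.tot.X n) : ∃ P, x ∈ K.fil P n := by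
  classical
  refine ⟨(K.comps n x).support.sup (fun i => i.1.2) + 1, fun i hi => ?_⟩
  by_contra h
  have := Finset.le_sup (f := fun i : Idx n => i.1.2) (DFinsupp.mem_support_iff.2 h)
  omega

theorem eq_zero_of_mem_fil {n : ℤ} {x : K.tot.X n} (hx : x ∈ K.fil 0 n) : x = 0 :=
  (K.comps n).map_eq_zero_iff.1 (DFinsupp.ext fun i => hx i (Nat.zero_le _))

theorem fil_induction {P : ℕ} {n : ℤ} {A : AddSubgroup (K.tot.X n)}
    (h : ∀ i a, i.1.2 < P → K.inc i a ∈ A) : K.fil P n ≤ A := by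
  classical
  intro x hx
  have h1 : x = ∑ i ∈ (K.comps n x).support, K.inc i (K.comps n x i) := by
    apply (K.comps n).injective
    rw [map_sum]
    simp only [comps_inc]
    exact (DFinsupp.sum_single (f := K.comps n x)).symm
  rw [h1]
  refine A.sum_mem fun i hi => h i _ ?_
  by_contra hP
  exact DFinsupp.mem_support_iff.1 hi (hx i (not_lt.1 hP))

/-- Only one entry with second index `P` has total degree `n`, so removing its component lowers the
filtration. -/
theorem sub_inc_mem_fil {P : ℕ} {n : ℤ} {x : K.tot.X n} (hx : x ∈ K.fil (P + 1) n) (q : ℕ)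
    (h : (P : ℤ) - q = n) : x - K.inc ⟨(q, P), h⟩ (K.comps n x ⟨(q, P), h⟩) ∈ K.fil P n := by
  classical
  intro i hi
  rw [map_sub, comps_inc, DFinsupp.sub_apply]
  by_cases hi' : i = ⟨(q, P), h⟩
  · subst hi'
    rw [DFinsupp.single_eq_same, sub_self]
  · rw [DFinsupp.single_eq_of_ne hi', sub_zero]
    refine hx i ?_
    by_contra hlt
    refine hi' (Subtype.ext (Prod.ext ?_ ?_))
    · have := i.2
      dsimp only
      omega
    · dsimp only
      omega

/-- For `P < n` the first index of an entry `(q, P)` of degree `n` would be the negative number `P -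
n`, so there is no such entry. -/
theorem mem_fil_of_lt {P : ℕ} {n : ℤ} {x : K.tot.X n} (hx : x ∈ K.fil (P + 1) n)
    (h : (P : ℤ) < n) : x ∈ K.fil P n := by
  intro i hi
  refine hx i ?_
  have := i.2
  omega

/-- The differential in the `p`-direction lands in index `p - 1`. Modulo lower filtration only the
`q`-differential remains, and it carries the sign `+1`. -/
theorem dTot_inc {n : ℤ} (q p : ℕ) (h : (p : ℤ) - q = n + 1) (h' : (p : ℤ) - (q + 1 : ℕ) = n)
    (a : (K.X q).X p) : K.dTot n (K.inc ⟨(q, p), h⟩ a) -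
      K.inc ⟨(q + 1, p), h'⟩ (((K.d q (q + 1)).f p).hom a) ∈ K.fil p n := by
  have h1 : K.dTot n (K.inc ⟨(q, p), h⟩ a) =
      (K.d₁ (ComplexShape.down ℤ) q p n).hom a + (K.d₂ (ComplexShape.down ℤ) q p n).hom a := by
    have e1 := ConcreteCategory.congr_hom
      (K.ι_D₁ (ComplexShape.down ℤ) (n + 1) n q p h) a
    have e2 := ConcreteCategory.congr_hom
      (K.ι_D₂ (ComplexShape.down ℤ) (n + 1) n q p h) a
    exact congrArg₂ (· + ·) e1 e2
  have h2 : (K.d₁ (ComplexShape.down ℤ) q p n).hom a =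
      K.inc ⟨(q + 1, p), h'⟩ (((K.d q (q + 1)).f p).hom a) := by
    rw [K.d₁_eq (ComplexShape.down ℤ) (i₁ := q) (i₁' := q + 1) rfl p n h']
    change (((1 : ℤ) • _ : (K.X q).X p ⟶ K.tot.X n)).hom a = _
    rw [one_smul]
    rfl
  rw [h1, h2, add_sub_cancel_left]
  cases p with
  | zero =>
    rw [K.d₂_eq_zero]
    · exact zero_mem _
    · simp
  | succ p =>
    have h3 : (p : ℤ) - q = n := by omega
    rw [K.d₂_eq (ComplexShape.down ℤ) q (i₂ := p + 1) (i₂' := p) rfl n h3]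
    have h4 := (K.fil (p + 1) n).zsmul_mem
      (inc_mem_fil ⟨(q, p), h3⟩ (((K.X q).d (p + 1) p).hom a) (Nat.lt_succ_self p))
      (((-1 : ℤˣ) ^ q : ℤˣ) : ℤ)
    exact h4

theorem dTot_mem_fil {P : ℕ} {n : ℤ} {x : K.tot.X (n + 1)} (hx : x ∈ K.fil P (n + 1)) :
    K.dTot n x ∈ K.fil P n := by
  refine fil_induction (A := (K.fil P n).comap (K.dTot n)) ?_ hx
  rintro ⟨⟨q, p⟩, h⟩ a (hp : p < P)
  dsimp only at h
  have h' : (p : ℤ) - (q + 1 : ℕ) = n := by omega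
  have h1 := dTot_inc (K := K) q p h h' a
  have h2 : K.dTot n (K.inc ⟨(q, p), h⟩ a) ∈ K.fil P n := by
    have h3 : K.fil p n ≤ K.fil P n := fun y hy i hi => hy i (by omega)
    have h4 := (K.fil P n).add_mem (h3 h1)
      (inc_mem_fil ⟨(q + 1, p), h'⟩ (((K.d q (q + 1)).f p).hom a) hp)
    rwa [sub_add_cancel] at h4
  exact h2

/-- The top component of the differential. -/
theorem comps_dTot {P : ℕ} {n : ℤ} {x : K.tot.X (n + 1)} (hx : x ∈ K.fil (P + 1) (n + 1)) (q : ℕ)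
    (h : (P : ℤ) - q = n + 1) (h' : (P : ℤ) - (q + 1 : ℕ) = n) :
    K.comps n (K.dTot n x) ⟨(q + 1, P), h'⟩ =
      ((K.d q (q + 1)).f P).hom (K.comps (n + 1) x ⟨(q, P), h⟩) := by
  classical
  have h1 := dTot_mem_fil (sub_inc_mem_fil hx q h)
  have h2 := dTot_inc (K := K) q P h h' (K.comps (n + 1) x ⟨(q, P), h⟩)
  have h3 := (K.fil P n).add_mem h1 h2
  rw [map_sub, sub_add_sub_cancel] at h3
  have h4 := h3 ⟨(q + 1, P), h'⟩ le_rfl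
  rw [map_sub, comps_inc, DFinsupp.sub_apply, DFinsupp.single_eq_same, sub_eq_zero] at h4
  exact h4

/-- The mapping cones of the restrictions of `f` to the complexes with fixed `p` are acyclic. -/
structure ColumnAcyclic (f : K ⟶ L) : Prop where
  zero : ∀ (p : ℕ) (x : (K.X 0).X p), ((K.d 0 1).f p).hom x = 0 → ((f.f 0).f p).hom x = 0 → x = 0
  succ : ∀ (q p : ℕ) (x : (K.X (q + 1)).X p) (y : (L.X q).X p),
    ((K.d (q + 1) (q + 2)).f p).hom x = 0 →
    ((f.f (q + 1)).f p).hom x = ((L.d q (q + 1)).f p).hom y →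
    ∃ (x' : (K.X q).X p) (q' : ℕ) (y' : (L.X q').X p), ((K.d q (q + 1)).f p).hom x' = x ∧
      ((f.f q).f p).hom x' + ((L.d q' q).f p).hom y' = y

/-- The hypotheses say that `(x, y)` is a cycle of the mapping cone of `f`. Its component in the top
index `p = P` is a cycle of the cone in that column, hence a boundary there; subtracting the
corresponding boundary in the total complexes pushes `(x, y)` into the indices `p < P`, and
induction on `P` applies. -/
theorem exists_of_mem_fil {f : K ⟶ L} (hf : ColumnAcyclic f) (n : ℤ) (P : ℕ) :
    ∀ (x : K.tot.X (n + 1)) (y : L.tot.X (n + 1 + 1)), x ∈ K.fil P (n + 1) →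
      y ∈ L.fil P (n + 1 + 1) → K.dTot n x = 0 → mapTot f (n + 1) x = L.dTot (n + 1) y →
      ∃ (x' : K.tot.X (n + 1 + 1)) (y' : L.tot.X (n + 1 + 1 + 1)), K.dTot (n + 1) x' = x ∧
        mapTot f (n + 1 + 1) x' + L.dTot (n + 1 + 1) y' = y := by
  classical
  induction P with
  | zero =>
    intro x y hx hy _ _
    refine ⟨0, 0, ?_, ?_⟩
    · rw [map_zero, eq_zero_of_mem_fil hx]
    · rw [map_zero, map_zero, add_zero, eq_zero_of_mem_fil hy]
  | succ P ih =>
    intro x y hx hy hdx hxy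
    by_cases hP : (P : ℤ) < n + 1
    · exact ih x y (mem_fil_of_lt hx hP) (mem_fil_of_lt hy (by omega)) hdx hxy
    · obtain ⟨q, hq⟩ : ∃ q : ℕ, (P : ℤ) - q = n + 1 := ⟨(P - (n + 1)).toNat, by omega⟩
      have hx1 := sub_inc_mem_fil hx q hq
      have hdx' := comps_dTot hx q hq (by push_cast; omega)
      rw [hdx, map_zero, DFinsupp.zero_apply] at hdx'
      have hfx := comps_mapTot f x ⟨(q, P), hq⟩
      rw [hxy] at hfx
      cases q with
      | zero =>
        -- For `q = 0` the partner `y` would need a component in row `-1`, so it has none at `P`,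
        -- and acyclicity forces the top component of `x` to vanish.
        have hy1 := mem_fil_of_lt hy (by omega)
        rw [dTot_mem_fil hy1 _ le_rfl] at hfx
        rw [hf.zero P _ hdx'.symm hfx.symm, map_zero, sub_zero] at hx1
        exact ih x y hx1 hy1 hdx hxy
      | succ q =>
        have hq' : (P : ℤ) - q = n + 1 + 1 := by push_cast at hq; omega
        rw [comps_dTot hy q hq' hq] at hfx
        obtain ⟨a, q', b, ha, hb⟩ := hf.succ q P _ _ hdx'.symm hfx.symm
        obtain ⟨z, hz⟩ : ∃ z : L.tot.X (n + 1 + 1 + 1), L.dTot (n + 1 + 1) z -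
            L.inc ⟨(q, P), hq'⟩ (((L.d q' q).f P).hom b) ∈ L.fil P (n + 1 + 1) := by
          -- The index `q'` in `ColumnAcyclic` is free, so that `q = 0` needs no predecessor; unless
          -- `q' + 1 = q` the differential is zero and `z = 0` will do.
          by_cases hqq : q' + 1 = q
          · subst hqq
            exact ⟨L.inc ⟨(q', P), by push_cast at hq'; dsimp only; omega⟩ b, dTot_inc q' P _ hq' b⟩
          · refine ⟨0, ?_⟩
            have h0 : ((L.d q' q).f P).hom b = 0 := by
              rw [L.shape q' q hqq]
              rfl
            rw [h0, map_zero, map_zero, sub_zero]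
            exact zero_mem _
        have hy1 := sub_inc_mem_fil hy q hq'
        have hda := dTot_inc (K := K) q P hq' hq a
        have g1 : x - K.dTot (n + 1) (K.inc ⟨(q, P), hq'⟩ a) ∈ K.fil P (n + 1) := by
          rw [ha] at hda
          have := sub_mem hx1 hda
          rwa [sub_sub_sub_cancel_right] at this
        have g2 : y - mapTot f _ (K.inc ⟨(q, P), hq'⟩ a) - L.dTot (n + 1 + 1) z ∈
            L.fil P (n + 1 + 1) := by
          rw [← hb, map_add] at hy1
          rw [mapTot_inc]
          have := sub_mem hy1 hz
          convert this using 1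
          abel
        obtain ⟨x', y', hx', hy'⟩ := ih _ _ g1 g2
          (by rw [map_sub, hdx, dTot_dTot, sub_zero])
          (by rw [map_sub, map_sub, map_sub, hxy, dTot_dTot, sub_zero, mapTot_dTot])
        refine ⟨x' + K.inc ⟨(q, P), hq'⟩ a, y' + z, ?_, ?_⟩
        · rw [map_add, hx', sub_add_cancel]
        · rw [map_add, map_add, add_add_add_comm, hy']
          abel

/-- Here the total complex must be the direct sum: `x` and `y` meet only finitely many values of
`p`, so a common filtration bound exists. -/
theorem exists_of_columnAcyclic {f : K ⟶ L} (hf : ColumnAcyclic f) (n : ℤ) (x : K.tot.X (n + 1))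
    (y : L.tot.X (n + 1 + 1)) (hx : K.dTot n x = 0)
    (hxy : mapTot f (n + 1) x = L.dTot (n + 1) y) :
    ∃ (x' : K.tot.X (n + 1 + 1)) (y' : L.tot.X (n + 1 + 1 + 1)), K.dTot (n + 1) x' = x ∧
      mapTot f (n + 1 + 1) x' + L.dTot (n + 1 + 1) y' = y := by
  obtain ⟨P, hP⟩ := exists_mem_fil x
  obtain ⟨P', hP'⟩ := exists_mem_fil y
  exact exists_of_mem_fil hf n (max P P') x y (fun i hi => hP i (by omega))
    (fun i hi => hP' i (by omega)) hx hxy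

theorem isIso_homologyMap {f : K ⟶ L} (hf : ColumnAcyclic f) (n : ℤ) :
    IsIso (HomologicalComplex.homologyMap
      (HomologicalComplex₂.total.map f (ComplexShape.down ℤ)) n) := by
  have hm : Mono (HomologicalComplex.homologyMap
      (HomologicalComplex₂.total.map f (ComplexShape.down ℤ)) n) := by
    obtain ⟨n, rfl⟩ : ∃ m, n = m + 1 := ⟨n - 1, by omega⟩
    rw [HomologicalComplex.mono_homologyMap_iff_up_to_refinements _ (n + 1 + 1) (n + 1) n
      (ChainComplex.prev _ _) ((ComplexShape.down ℤ).next_eq' rfl)]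
    intro A x hx y hxy
    -- The kernel of `g` is the group of pairs `(a, x')` with `x(a) = d x'`. It is the refinement of
    -- `A` on which a preimage is chosen, and it surjects onto `A` by acyclicity.
    let g : A × K.tot.X (n + 1 + 1) →+ K.tot.X (n + 1) :=
      x.hom.comp (AddMonoidHom.fst _ _) - (K.dTot (n + 1)).comp (AddMonoidHom.snd _ _)
    refine ⟨AddCommGrpCat.of g.ker,
      AddCommGrpCat.ofHom ((AddMonoidHom.fst _ _).comp g.ker.subtype),
      (AddCommGrpCat.epi_iff_surjective _).2 fun a => ?_,
      AddCommGrpCat.ofHom ((AddMonoidHom.snd _ _).comp g.ker.subtype),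
      AddCommGrpCat.hom_ext (AddMonoidHom.ext fun a => ?_)⟩
    · obtain ⟨x', y', h1, -⟩ := exists_of_columnAcyclic hf n (x.hom a) (y.hom a)
        (ConcreteCategory.congr_hom hx a) (ConcreteCategory.congr_hom hxy a)
      exact ⟨⟨(a, x'), sub_eq_zero.2 h1.symm⟩, rfl⟩
    · exact sub_eq_zero.1 a.2
  have he : Epi (HomologicalComplex.homologyMap
      (HomologicalComplex₂.total.map f (ComplexShape.down ℤ)) n) := by
    -- For surjectivity the acyclicity statement is used with `x = 0`, so that `y` is a cycle; with
    -- `x` in degree `m + 1` it sits in degree `m + 2`.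
    obtain ⟨n, rfl⟩ : ∃ m, n = m + 1 + 1 := ⟨n - 2, by omega⟩
    rw [HomologicalComplex.epi_homologyMap_iff_up_to_refinements _ (n + 1 + 1 + 1) (n + 1 + 1)
      (n + 1) (ChainComplex.prev _ _) ((ComplexShape.down ℤ).next_eq' rfl)]
    intro A y hy
    let g : A × K.tot.X (n + 1 + 1) × L.tot.X (n + 1 + 1 + 1) →+
        K.tot.X (n + 1) × L.tot.X (n + 1 + 1) :=
      ((K.dTot (n + 1)).comp ((AddMonoidHom.fst _ _).comp (AddMonoidHom.snd _ _))).prod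
        (y.hom.comp (AddMonoidHom.fst _ _) -
          ((mapTot f (n + 1 + 1)).comp ((AddMonoidHom.fst _ _).comp (AddMonoidHom.snd _ _)) +
          (L.dTot (n + 1 + 1)).comp ((AddMonoidHom.snd _ _).comp (AddMonoidHom.snd _ _))))
    refine ⟨AddCommGrpCat.of g.ker,
      AddCommGrpCat.ofHom ((AddMonoidHom.fst _ _).comp g.ker.subtype),
      (AddCommGrpCat.epi_iff_surjective _).2 fun a => ?_,
      AddCommGrpCat.ofHom ((AddMonoidHom.fst _ _).comp ((AddMonoidHom.snd _ _).comp g.ker.subtype)),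
      AddCommGrpCat.hom_ext (AddMonoidHom.ext fun a => ?_),
      AddCommGrpCat.ofHom ((AddMonoidHom.snd _ _).comp ((AddMonoidHom.snd _ _).comp g.ker.subtype)),
      AddCommGrpCat.hom_ext (AddMonoidHom.ext fun a => ?_)⟩
    · obtain ⟨x', y', h1, h2⟩ := exists_of_columnAcyclic hf n 0 (y.hom a) (map_zero _)
        ((map_zero _).trans (ConcreteCategory.congr_hom hy a).symm)
      exact ⟨⟨(a, x', y'), Prod.ext h1 (sub_eq_zero.2 h2.symm)⟩, rfl⟩
    · exact congrArg Prod.fst a.2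
    · exact sub_eq_zero.1 (congrArg Prod.snd a.2)
  exact isIso_of_mono_of_epi _

end Bicomplex

end TotalComplex

end EtaleHomology

namespace EtaleHomology

/-! ### Comparison of resolutions -/

theorem _root_.IsLocalHomeomorph.locallyCompactSpace {X Y : Type*} [TopologicalSpace X]
    [TopologicalSpace Y] [T2Space Y] [LocallyCompactSpace X] {f : Y → X}
    (hf : IsLocalHomeomorph f) : LocallyCompactSpace Y := by
  have : WeaklyLocallyCompactSpace Y := by
    refine ⟨fun y => ?_⟩
    obtain ⟨e, hy, rfl⟩ := hf y
    obtain ⟨K, hK, hKt, hKc⟩ := local_compact_nhds (e.open_target.mem_nhds (e.map_source hy))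
    refine ⟨e.symm '' K, hKc.image_of_continuousOn (e.continuousOn_symm.mono hKt), ?_⟩
    have h1 : ∀ᶠ z in 𝓝 y, e z ∈ K := (e.continuousAt hy).eventually hK
    filter_upwards [h1, e.open_source.mem_nhds hy] with z hz hzs
    exact ⟨_, hz, e.left_inv hzs⟩
  infer_instance

namespace Grpd.IsEtale

variable {X G : Type u} [TopologicalSpace X] [TopologicalSpace G] {𝒢 : Grpd X G}

theorem locallyCompact_base (h : 𝒢.IsEtale) : LocallyCompactSpace X := by
  have := h.t2
  have := h.locallyCompact
  exact (Function.LeftInverse.isClosedEmbedding 𝒢.r_one h.isLocalHomeomorph_r.continuous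
    h.continuous_one).locallyCompactSpace

theorem locallyCompact_str (h : 𝒢.IsEtale) (n : ℕ) : LocallyCompactSpace (Str 𝒢 n) := by
  have := h.t2_str (n := n)
  have := h.locallyCompact_base
  exact (h.isLocalHomeomorph_obj (n := n) 0).locallyCompactSpace

end Grpd.IsEtale

/-! ### Mapping cones of complexes of soft sheaves. -/

namespace AbSheaf

variable {Y : Type u} [TopologicalSpace Y]

/-- The sheaves of the mapping cone of a morphism of complexes. -/
def cone (S T : ℕ → AbSheaf Y) : ℕ → AbSheaf Y
  | 0 => S 0
  | q + 1 => (S (q + 1)).prod (T q)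

/-- The differential of the mapping cone. -/
def coneD (S T : ℕ → AbSheaf Y) (dS : ∀ q y, (S q).stalk y →+ (S (q + 1)).stalk y)
    (dT : ∀ q y, (T q).stalk y →+ (T (q + 1)).stalk y)
    (f : ∀ q y, (S q).stalk y →+ (T q).stalk y) :
    ∀ q y, (cone S T q).stalk y →+ (cone S T (q + 1)).stalk y
  | 0, y => (dS 0 y).prod (f 0 y)
  | q + 1, y => ((dS (q + 1) y).comp (AddMonoidHom.fst _ _)).prod
      ((f (q + 1) y).comp (AddMonoidHom.fst _ _) - (dT q y).comp (AddMonoidHom.snd _ _))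

theorem continuous_fst_prod (S T : AbSheaf Y) : Continuous fun e : Total (S.prod T).stalk =>
    (⟨e.base, (show S.stalk e.base × T.stalk e.base from e.val).1⟩ : Total S.stalk) :=
  ((continuous_prod_iff S T).1 continuous_id).1

theorem continuous_snd_prod (S T : AbSheaf Y) : Continuous fun e : Total (S.prod T).stalk =>
    (⟨e.base, (show S.stalk e.base × T.stalk e.base from e.val).2⟩ : Total T.stalk) :=
  ((continuous_prod_iff S T).1 continuous_id).2

theorem continuous_sub' {S : AbSheaf Y} {Z : Type*} [TopologicalSpace Z] {b : Z → Y}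
    {s t : ∀ z, S.stalk (b z)} (hs : Continuous fun z => (⟨b z, s z⟩ : Total S.stalk))
    (ht : Continuous fun z => (⟨b z, t z⟩ : Total S.stalk)) :
    Continuous fun z => (⟨b z, s z - t z⟩ : Total S.stalk) :=
  continuous_iff_continuousAt.2 fun _ => continuousAt_sub hs.continuousAt ht.continuousAt

/-- A morphism of bounded below complexes of soft sheaves with exact mapping cone induces a
morphism of complexes of compactly supported sections with exact mapping cone. -/
theorem exists_sectionsC_of_cone [T2Space Y] [LocallyCompactSpace Y] {S T : ℕ → AbSheaf Y}
    {dS : ∀ q y, (S q).stalk y →+ (S (q + 1)).stalk y}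
    {dT : ∀ q y, (T q).stalk y →+ (T (q + 1)).stalk y}
    {f : ∀ q y, (S q).stalk y →+ (T q).stalk y}
    (hdS : ∀ q, Continuous fun e : Total (S q).stalk =>
      (⟨e.base, dS q e.base e.val⟩ : Total (S (q + 1)).stalk))
    (hdT : ∀ q, Continuous fun e : Total (T q).stalk =>
      (⟨e.base, dT q e.base e.val⟩ : Total (T (q + 1)).stalk))
    (hf : ∀ q, Continuous fun e : Total (S q).stalk =>
      (⟨e.base, f q e.base e.val⟩ : Total (T q).stalk))
    (hS : ∀ q, (S q).Soft fun _ => ⊤) (hT : ∀ q, (T q).Soft fun _ => ⊤)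
    (ddS : ∀ q y v, dS (q + 1) y (dS q y v) = 0) (ddT : ∀ q y v, dT (q + 1) y (dT q y v) = 0)
    (hfd : ∀ q y v, f (q + 1) y (dS q y v) = dT q y (f q y v))
    (e0 : ∀ y v, dS 0 y v = 0 → f 0 y v = 0 → v = 0)
    (e1 : ∀ y v w, dS 1 y v = 0 → f 1 y v = dT 0 y w → ∃ v', dS 0 y v' = v ∧ f 0 y v' = w)
    (e2 : ∀ q y v w, dS (q + 2) y v = 0 → f (q + 2) y v = dT (q + 1) y w →
      ∃ v' w', dS (q + 1) y v' = v ∧ f (q + 1) y v' - dT q y w' = w) :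
    (∀ s ∈ (S 1).sectionsC, ∀ t ∈ (T 0).sectionsC, (∀ y, dS 1 y (s y) = 0) →
      (∀ y, f 1 y (s y) = dT 0 y (t y)) →
      ∃ s' ∈ (S 0).sectionsC, (∀ y, dS 0 y (s' y) = s y) ∧ ∀ y, f 0 y (s' y) = t y) ∧
    ∀ q, ∀ s ∈ (S (q + 2)).sectionsC, ∀ t ∈ (T (q + 1)).sectionsC,
      (∀ y, dS (q + 2) y (s y) = 0) → (∀ y, f (q + 2) y (s y) = dT (q + 1) y (t y)) →
      ∃ s' ∈ (S (q + 1)).sectionsC, ∃ t' ∈ (T q).sectionsC, (∀ y, dS (q + 1) y (s' y) = s y) ∧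
        ∀ y, f (q + 1) y (s' y) - dT q y (t' y) = t y := by
  have hcont : ∀ q, Continuous fun e : Total (cone S T q).stalk =>
      (⟨e.base, coneD S T dS dT f q e.base e.val⟩ : Total (cone S T (q + 1)).stalk) := by
    intro q
    cases q with
    | zero =>
      exact (continuous_prod_iff (S 1) (T 0)
        (g := fun e : Total (S 0).stalk => (⟨e.base, (dS 0 e.base e.val, f 0 e.base e.val)⟩ :
          Total ((S 1).ProdStalk (T 0))))).2 ⟨hdS 0, hf 0⟩
    | succ q =>
      have h1 := continuous_fst_prod (S (q + 1)) (T q)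
      have h2 := continuous_snd_prod (S (q + 1)) (T q)
      refine (continuous_prod_iff (S (q + 2)) (T (q + 1))
        (g := fun e : Total ((S (q + 1)).ProdStalk (T q)) => (⟨e.base, (dS (q + 1) e.base e.val.1,
          f (q + 1) e.base e.val.1 - dT q e.base e.val.2)⟩ :
          Total ((S (q + 2)).ProdStalk (T (q + 1)))))).2 ⟨(hdS (q + 1)).comp h1, ?_⟩
      exact continuous_sub' ((hf (q + 1)).comp h1) ((hdT q).comp h2)
  have hsoft : ∀ q, (cone S T q).Soft fun _ => ⊤ := by
    intro q
    cases q with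
    | zero => exact hS 0
    | succ q => exact soft_prod (hS _) (hT _)
  have hinj : ∀ y, Function.Injective (coneD S T dS dT f 0 y) := by
    intro y
    rw [injective_iff_map_eq_zero]
    exact fun v hv => e0 y v (congrArg Prod.fst hv) (congrArg Prod.snd hv)
  -- The cone is `S⁰ → S¹ ⊕ T⁰ → S² ⊕ T¹ → ⋯` with `(v, w) ↦ (d v, f v - d w)`. The hypotheses `e1`
  -- and `e2` are its exactness in degree 1 and above, and `e0` is injectivity at the start.
  have hex : ∀ q y, Function.Exact (coneD S T dS dT f q y) (coneD S T dS dT f (q + 1) y) := by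
    intro q y
    cases q with
    | zero =>
      rintro ⟨v, w⟩
      constructor
      · intro h
        obtain ⟨v', h1, h2⟩ := e1 y v w (congrArg Prod.fst h) (sub_eq_zero.1 (congrArg Prod.snd h))
        exact ⟨v', Prod.ext h1 h2⟩
      · rintro ⟨v', h⟩
        obtain rfl : dS 0 y v' = v := congrArg Prod.fst h
        obtain rfl : f 0 y v' = w := congrArg Prod.snd h
        exact Prod.ext (ddS 0 y v') (sub_eq_zero.2 (hfd 0 y v'))
    | succ q =>
      rintro ⟨v, w⟩
      constructor
      · intro h
        obtain ⟨v', w', h1, h2⟩ := e2 q y v w (congrArg Prod.fst h)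
          (sub_eq_zero.1 (congrArg Prod.snd h))
        exact ⟨(v', w'), Prod.ext h1 h2⟩
      · rintro ⟨⟨v', w'⟩, h⟩
        obtain rfl : dS (q + 1) y v' = v := congrArg Prod.fst h
        obtain rfl : f (q + 1) y v' - dT q y w' = w := congrArg Prod.snd h
        refine Prod.ext (ddS _ y v') (sub_eq_zero.2 ?_)
        change f (q + 2) y (dS (q + 1) y v') = dT (q + 1) y (f (q + 1) y v' - dT q y w')
        rw [map_sub, ddT, sub_zero, hfd]
  have key := exists_sectionsC_of_exact (cone S T) (coneD S T dS dT f) hcont hsoft hinj hex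
  refine ⟨fun s hs t ht h1 h2 => ?_, fun q s hs t ht h1 h2 => ?_⟩
  · obtain ⟨s', hs', he⟩ := key 0 (t := fun y => (s y, t y))
      (mem_sectionsC_prod_iff.2 ⟨hs, ht⟩) fun y => Prod.ext (h1 y) (sub_eq_zero.2 (h2 y))
    exact ⟨s', hs', fun y => congrArg Prod.fst (he y), fun y => congrArg Prod.snd (he y)⟩
  · obtain ⟨s', hs', he⟩ := key (q + 1) (t := fun y => (s y, t y))
      (mem_sectionsC_prod_iff.2 ⟨hs, ht⟩) fun y => Prod.ext (h1 y) (sub_eq_zero.2 (h2 y))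
    have hs'' := mem_sectionsC_prod_iff (S := S (q + 1)) (T := T q).1 hs'
    exact ⟨_, hs''.1, _, hs''.2, fun y => congrArg Prod.fst (he y),
      fun y => congrArg Prod.snd (he y)⟩

end AbSheaf

theorem SheafSpace.push_id {Y : Type u} [TopologicalSpace Y] [T2Space Y] {S T : AbSheaf Y}
    (hid : IsLocalHomeomorph (id : Y → Y)) (φ : ∀ y, S.stalk y →+ T.stalk y)
    (hφ : Continuous fun e : Total S.stalk => (⟨e.base, φ e.base e.val⟩ : Total T.stalk))
    (t : ∀ y, S.stalk y) (y : Y) :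
    push (P := ⟨Y, S⟩) (Q := ⟨Y, T⟩) ⟨id, hid, φ, hφ⟩ t y = φ y (t y) := by
  let _ : Unique {z : Y // id z = y} := ⟨⟨⟨y, rfl⟩⟩, fun z => Subtype.ext z.2⟩
  exact finsum_unique _

open Opposite

theorem sectionsBicomplex_d_f (N : ℕ → SimplicialObject SheafSpace.{u}) (d : ∀ q, N q ⟶ N (q + 1))
    (hd : ∀ q n y v, SheafSpace.Hom.φ ((d q ≫ d (q + 1)).app n) y v = 0) (q p : ℕ) :
    ((sectionsBicomplex N d hd).d q (q + 1)).f p =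
      SheafSpace.sectionsFunctor.map ((d q).app (op (SimplexCategory.mk p))) := by
  change ((AlgebraicTopology.alternatingFaceMapComplex AddCommGrpCat.{u}).map
    ((sectionsComplex N d hd).d q (q + 1))).f p = _
  rw [sectionsComplex_d]
  rfl

variable {X G : Type u} [TopologicalSpace X] [TopologicalSpace G] {𝒢 : Grpd X G}

/-- The map `x_0` on strings is a local homeomorphism, so it is locally injective and
`soft_pullback` applies. -/
theorem GSheaf.soft_onStr {S : GSheaf 𝒢} (hS : S.sheaf.IsCSoft) (h : 𝒢.IsEtale) (n : ℕ) :
    (S.onStr n).Soft fun _ => ⊤ := by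
  have := h.t2_base
  have := h.t2_str (n := n)
  have := h.locallyCompact_str n
  exact AbSheaf.soft_pullback hS.soft _ fun a => exists_injOn (h.isLocalHomeomorph_obj 0) a

/-- The compactly supported sections of `S_p`, as elements of the double complex. -/
theorem GSheaf.Hom.sections_map_apply {S T : GSheaf 𝒢} (α : S.Hom T) (h : 𝒢.IsEtale) (p : ℕ)
    (t : (S.onStr p).sectionsC) (a : Grpd.Str 𝒢 p) :
    ((SheafSpace.sectionsFunctor.map ((α.nerve h).app (op (SimplexCategory.mk p)))).hom t :
      (T.onStr p).sectionsC).1 a = α.φ (a.obj 0) (t.1 a) :=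
  have := h.t2_str (n := p)
  SheafSpace.push_id (S := S.onStr p) (T := T.onStr p) _ _ _ t.1 a

namespace GComplex

theorem bicomplex_d_f (C : GComplex 𝒢) (h : 𝒢.IsEtale) (q p : ℕ) :
    ((C.bicomplex h).d q (q + 1)).f p =
      SheafSpace.sectionsFunctor.map (((C.d q).nerve h).app (op (SimplexCategory.mk p))) :=
  sectionsBicomplex_d_f _ _ _ q p

/-- A resolution of `A`, with specified augmentation. -/
def IsResolution (C : GComplex 𝒢) {A : GSheaf 𝒢} (ε : A.Hom (C.S 0)) : Prop :=
  ∀ x, Function.Injective (ε.φ x) ∧ Function.Exact (ε.φ x) ((C.d 0).φ x) ∧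
    ∀ q, Function.Exact ((C.d q).φ x) ((C.d (q + 1)).φ x)

namespace Hom

variable {C D : GComplex 𝒢} (F : C.Hom D)

/-- The map of double complexes induced by a morphism of complexes of `𝒢`-sheaves. -/
noncomputable def bicomplex (h : 𝒢.IsEtale) : C.bicomplex h ⟶ D.bicomplex h :=
  sectionsBicomplexMap (fun q => (F.f q).nerve h) fun q => NatTrans.ext (funext fun _ =>
    SheafSpace.Hom.ext rfl (heq_of_eq (funext fun a => AddMonoidHom.ext fun v =>
      (F.comm q (a.obj 0) v).symm)))

/-- A morphism of resolutions over the identity of `A` has an exact mapping cone on stalks: this is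
the diagram chase in `e0`, `e1` and `e2`. All sheaves of the cone are soft, so exactness passes to
compactly supported sections on each space of strings. -/
theorem columnAcyclic (h : 𝒢.IsEtale) {A : GSheaf 𝒢} {ε : A.Hom (C.S 0)} {ε' : A.Hom (D.S 0)}
    (hC : ∀ q, (C.S q).sheaf.IsCSoft) (hD : ∀ q, (D.S q).sheaf.IsCSoft)
    (hε : C.IsResolution ε) (hε' : D.IsResolution ε')
    (hF : ∀ x v, (F.f 0).φ x (ε.φ x v) = ε'.φ x v) :
    Bicomplex.ColumnAcyclic (F.bicomplex h) := by
  have e0 : ∀ x v, (C.d 0).φ x v = 0 → (F.f 0).φ x v = 0 → v = 0 := by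
    intro x v h1 h2
    obtain ⟨a, rfl⟩ := ((hε x).2.1 v).1 h1
    rw [hF] at h2
    rw [(hε' x).1 (h2.trans (map_zero _).symm), map_zero]
  have e1 : ∀ x v w, (C.d 1).φ x v = 0 → (F.f 1).φ x v = (D.d 0).φ x w →
      ∃ v', (C.d 0).φ x v' = v ∧ (F.f 0).φ x v' = w := by
    intro x v w h1 h2
    obtain ⟨v, rfl⟩ := ((hε x).2.2 0 v).1 h1
    rw [F.comm, eq_comm, ← sub_eq_zero, ← map_sub] at h2
    obtain ⟨a, ha⟩ := ((hε' x).2.1 _).1 h2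
    -- In degree 0 the discrepancy between `w` and the image of `v` is a cocycle, so it comes from
    -- `a` in `A`. Adding `ε a` to `v` removes it without changing `d v`.
    refine ⟨v + ε.φ x a, ?_, ?_⟩
    · rw [map_add, (hε x).2.1.apply_apply_eq_zero, add_zero]
    · rw [map_add, hF, ha, add_sub_cancel]
  have e2 : ∀ q x v w, (C.d (q + 2)).φ x v = 0 → (F.f (q + 2)).φ x v = (D.d (q + 1)).φ x w →
      ∃ v' w', (C.d (q + 1)).φ x v' = v ∧ (F.f (q + 1)).φ x v' - (D.d q).φ x w' = w := by
    intro q x v w h1 h2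
    obtain ⟨v, rfl⟩ := ((hε x).2.2 (q + 1) v).1 h1
    rw [F.comm, ← sub_eq_zero, ← map_sub] at h2
    obtain ⟨w', hw'⟩ := ((hε' x).2.2 q _).1 h2
    exact ⟨v, w', rfl, by rw [hw', sub_sub_cancel]⟩
  have key : ∀ p : ℕ, _ := fun p =>
    have := h.t2_str (n := p)
    have := h.locallyCompact_str p
    AbSheaf.exists_sectionsC_of_cone (Y := Grpd.Str 𝒢 p) (S := fun q => (C.S q).onStr p)
      (T := fun q => (D.S q).onStr p) (dS := fun q a => (C.d q).φ (a.obj 0))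
      (dT := fun q a => (D.d q).φ (a.obj 0)) (f := fun q a => (F.f q).φ (a.obj 0))
      (fun q => (((C.d q).nerve h).app (op (SimplexCategory.mk p))).continuous_φ)
      (fun q => (((D.d q).nerve h).app (op (SimplexCategory.mk p))).continuous_φ)
      (fun q => (((F.f q).nerve h).app (op (SimplexCategory.mk p))).continuous_φ)
      (fun q => GSheaf.soft_onStr (hC q) h p) (fun q => GSheaf.soft_onStr (hD q) h p)
      (fun q a v => C.d_d q (a.obj 0) v) (fun q a v => D.d_d q (a.obj 0) v)
      (fun q a v => F.comm q (a.obj 0) v) (fun a => e0 (a.obj 0)) (fun a => e1 (a.obj 0))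
      (fun q a => e2 q (a.obj 0))
  have dC : ∀ (q p : ℕ) (t : ((C.S q).onStr p).sectionsC) (a : Grpd.Str 𝒢 p),
      ((((C.bicomplex h).d q (q + 1)).f p).hom t : ((C.S (q + 1)).onStr p).sectionsC).1 a =
        (C.d q).φ (a.obj 0) (t.1 a) := by
    intro q p t a
    exact (congrArg (fun F => (F.hom t : ((C.S (q + 1)).onStr p).sectionsC).1 a)
      (C.bicomplex_d_f h q p)).trans ((C.d q).sections_map_apply h p t a)
  have dD : ∀ (q p : ℕ) (t : ((D.S q).onStr p).sectionsC) (a : Grpd.Str 𝒢 p),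
      ((((D.bicomplex h).d q (q + 1)).f p).hom t : ((D.S (q + 1)).onStr p).sectionsC).1 a =
        (D.d q).φ (a.obj 0) (t.1 a) := by
    intro q p t a
    exact (congrArg (fun F => (F.hom t : ((D.S (q + 1)).onStr p).sectionsC).1 a)
      (D.bicomplex_d_f h q p)).trans ((D.d q).sections_map_apply h p t a)
  have dF : ∀ (q p : ℕ) (t : ((C.S q).onStr p).sectionsC) (a : Grpd.Str 𝒢 p),
      ((((F.bicomplex h).f q).f p).hom t : ((D.S q).onStr p).sectionsC).1 a =
        (F.f q).φ (a.obj 0) (t.1 a) := fun q p t a => (F.f q).sections_map_apply h p t a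
  constructor
  · intro p (x : ((C.S 0).onStr p).sectionsC) h1 h2
    refine Subtype.ext (funext fun a => e0 _ _ ?_ ?_)
    · exact (dC 0 p x a).symm.trans (congrArg (fun t : ((C.S 1).onStr p).sectionsC => t.1 a) h1)
    · exact (dF 0 p x a).symm.trans (congrArg (fun t : ((D.S 0).onStr p).sectionsC => t.1 a) h2)
  · intro q p (x : ((C.S (q + 1)).onStr p).sectionsC) (y : ((D.S q).onStr p).sectionsC) h1 h2
    have h1' : ∀ a, (C.d (q + 1)).φ (Grpd.Str.obj a 0) (x.1 a) = 0 := fun a =>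
      (dC (q + 1) p x a).symm.trans
        (congrArg (fun t : ((C.S (q + 2)).onStr p).sectionsC => t.1 a) h1)
    have h2' : ∀ a, (F.f (q + 1)).φ (Grpd.Str.obj a 0) (x.1 a) = (D.d q).φ (a.obj 0) (y.1 a) :=
      fun a => (dF (q + 1) p x a).symm.trans
        ((congrArg (fun t : ((D.S (q + 1)).onStr p).sectionsC => t.1 a) h2).trans (dD q p y a))
    cases q with
    | zero =>
      obtain ⟨s', hs', h3, h4⟩ := (key p).1 x.1 x.2 y.1 y.2 h1' h2'
      let s : ((C.S 0).onStr p).sectionsC := ⟨s', hs'⟩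
      refine ⟨s, 0, (0 : ((D.S 0).onStr p).sectionsC), ?_, ?_⟩
      · exact Subtype.ext (funext fun a => (dC 0 p s a).trans (h3 a))
      · refine (congrArg ((((F.bicomplex h).f 0).f p).hom s + ·)
          (map_zero (((D.bicomplex h).d 0 0).f p).hom)).trans ((add_zero _).trans ?_)
        exact Subtype.ext (funext fun a => (dF 0 p s a).trans (h4 a))
    | succ q =>
      obtain ⟨s', hs', t', ht', h3, h4⟩ := (key p).2 q x.1 x.2 y.1 y.2 h1' h2'
      let s : ((C.S (q + 1)).onStr p).sectionsC := ⟨s', hs'⟩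
      let t : ((D.S q).onStr p).sectionsC := ⟨t', ht'⟩
      -- The cone has `f s - d t` where `ColumnAcyclic` has a sum, hence the sign.
      refine ⟨s, q, -t, ?_, ?_⟩
      · exact Subtype.ext (funext fun a => (dC (q + 1) p s a).trans (h3 a))
      · refine (congrArg ((((F.bicomplex h).f (q + 1)).f p).hom s + ·)
          (map_neg (((D.bicomplex h).d q (q + 1)).f p).hom t)).trans
          ((sub_eq_add_neg _ _).symm.trans ?_)
        refine Subtype.ext (funext fun a => Eq.trans ?_ (h4 a))
        exact congrArg₂ (fun v w : (D.S (q + 1)).sheaf.stalk (a.obj 0) => v - w)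
          (dF (q + 1) p s a) (dD q p t a)

end Hom

end GComplex

end EtaleHomology

namespace EtaleHomology

/-! ### The short exact sequence of an open subgroupoid -/

namespace Bicomplex

variable {K L M : Bicomplex.{u}}

/-- Preimages are used only on the finite support of `y`, so the resulting family is again finitely
supported. -/
theorem exists_mapTot_eq (f : K ⟶ L) {n : ℤ} (y : L.tot.X n)
    (h : ∀ i, ∃ a, ((f.f i.1.1).f i.1.2).hom a = L.comps n y i) : ∃ x, mapTot f n x = y := by
  classical
  choose a ha using h
  refine ⟨(K.comps n).symm (DFinsupp.mk (L.comps n y).support fun i => a i),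
    (L.comps n).injective (DFinsupp.ext fun i => ?_)⟩
  rw [comps_mapTot, AddEquiv.apply_symm_apply, DFinsupp.mk_apply]
  split_ifs with hi
  · exact ha i
  · rw [map_zero, DFinsupp.notMem_support_iff.1 hi]

theorem total_map_comp_eq_zero (f : K ⟶ L) (g : L ⟶ M)
    (h : ∀ q p a, ((g.f q).f p).hom (((f.f q).f p).hom a) = 0) :
    HomologicalComplex₂.total.map f (ComplexShape.down ℤ) ≫
      HomologicalComplex₂.total.map g (ComplexShape.down ℤ) = 0 := by
  refine HomologicalComplex.hom_ext _ _ fun n => AddCommGrpCat.hom_ext (hom_ext fun i a => ?_)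
  change mapTot g n (mapTot f n (K.inc i a)) = 0
  rw [mapTot_inc, mapTot_inc, h, map_zero]

theorem injective_mapTot {f : K ⟶ L} (hi : ∀ q p, Function.Injective ((f.f q).f p).hom) (n : ℤ) :
    Function.Injective (mapTot f n) := fun x y hxy =>
  (K.comps n).injective (DFinsupp.ext fun i => hi _ _ (by
    rw [← comps_mapTot, ← comps_mapTot, hxy]))

theorem exact_mapTot {f : K ⟶ L} {g : L ⟶ M}
    (he : ∀ q p, Function.Exact ((f.f q).f p).hom ((g.f q).f p).hom)
    (w : HomologicalComplex₂.total.map f (ComplexShape.down ℤ) ≫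
      HomologicalComplex₂.total.map g (ComplexShape.down ℤ) = 0) (n : ℤ) :
    Function.Exact (mapTot f n) (mapTot g n) := by
  refine fun y => ⟨fun hy => exists_mapTot_eq f y fun i => (he _ _ _).1 ?_, ?_⟩
  · rw [← comps_mapTot, hy, map_zero]
    rfl
  · rintro ⟨x, rfl⟩
    exact ConcreteCategory.congr_hom (HomologicalComplex.congr_hom w n) x

theorem shortExact_total (f : K ⟶ L) (g : L ⟶ M)
    (hi : ∀ q p, Function.Injective ((f.f q).f p).hom)
    (he : ∀ q p, Function.Exact ((f.f q).f p).hom ((g.f q).f p).hom)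
    (hs : ∀ q p, Function.Surjective ((g.f q).f p).hom)
    (w : HomologicalComplex₂.total.map f (ComplexShape.down ℤ) ≫
      HomologicalComplex₂.total.map g (ComplexShape.down ℤ) = 0) :
    (ShortComplex.mk _ _ w).ShortExact := by
  refine HomologicalComplex.shortExact_of_degreewise_shortExact _ fun n =>
    { exact := ?_
      mono_f := (AddCommGrpCat.mono_iff_injective _).2 ?_
      epi_g := (AddCommGrpCat.epi_iff_surjective _).2 ?_ }
  · exact (ShortComplex.ab_exact_iff_function_exact _).2 (exact_mapTot he w n)
  · exact injective_mapTot hi n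
  · exact fun y => exists_mapTot_eq g y fun i => hs _ _ _

end Bicomplex

namespace SheafSpace

variable {P Q : SheafSpace.{u}}

theorem push_apply_of_injective (F : Hom P Q) (hF : Function.Injective F.f)
    (t : ∀ y, P.sheaf.stalk y) (y : P.carrier) : push F t (F.f y) = F.φ y (t y) := by
  let _ : Unique {z // F.f z = F.f y} := ⟨⟨⟨y, rfl⟩⟩, fun z => Subtype.ext (hF z.2)⟩
  exact finsum_unique _

theorem push_eq_zero (F : Hom P Q) (t : ∀ y, P.sheaf.stalk y) {z : Q.carrier}
    (hz : z ∉ Set.range F.f) : push F t z = 0 := by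
  by_contra h
  obtain ⟨y, -, hy⟩ := push_ne_zero F h
  exact hz ⟨y, hy⟩

end SheafSpace

open Opposite

section

variable {Y H X G : Type u} [TopologicalSpace Y] [TopologicalSpace H] [TopologicalSpace X]
  [TopologicalSpace G] {ℋ : Grpd Y H} {𝒢 : Grpd X G}

theorem Grpd.Hom.injective_str {F : ℋ.Hom 𝒢} (ho : Function.Injective F.obj)
    (ha : Function.Injective F.arr) (n : ℕ) :
    Function.Injective (F.str : Grpd.Str ℋ n → Grpd.Str 𝒢 n) := fun _ _ h =>
  Grpd.Str.ext (funext fun i => ho (congrFun (congrArg Grpd.Str.obj h) i))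
    (funext fun i => funext fun j => ha (congrFun (congrFun (congrArg Grpd.Str.arr h) i) j))

/-- The pullback of a section along the map of spaces of strings induced by a homomorphism. -/
theorem GSheaf.isSection_comp_str {S : GSheaf 𝒢} (hH : ℋ.IsEtale) (F : ℋ.Hom 𝒢) {n : ℕ}
    {t : ∀ a, (S.onStr n).stalk a} (ht : (S.onStr n).IsSection t) :
    ((S.pullback hH F).onStr n).IsSection fun a => t (F.str a) :=
  (S.pullback hH F).sheaf.continuous_pullback_mk (fun a : Grpd.Str ℋ n => a.obj 0) continuous_id
    (S.sheaf.continuous_pullback_mk F.obj (Grpd.Str.continuous_obj 0)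
      ((S.sheaf.continuous_pullbackProj _).comp (ht.comp F.continuous_str)))

end

/-! ### Extension by zero and projection to the quotient sheaf, on compactly supported sections. -/

namespace OpenSubgroupoid

variable {X G : Type u} [TopologicalSpace X] [TopologicalSpace G] {𝒢 : Grpd X G}
  (𝒢' : OpenSubgroupoid 𝒢)

theorem injective_incl_str (n : ℕ) :
    Function.Injective (𝒢'.incl.str : Grpd.Str 𝒢'.grpd n → Grpd.Str 𝒢 n) :=
  Grpd.Hom.injective_str Function.injective_id Subtype.val_injective n

theorem range_incl_str (n : ℕ) : Set.range (𝒢'.incl.str : Grpd.Str 𝒢'.grpd n → _) = 𝒢'.str n := by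
  ext a
  constructor
  · rintro ⟨a, rfl⟩ i j
    exact (a.arr i j).2
  · intro ha
    exact ⟨⟨a.obj, fun i j => ⟨a.arr i j, ha i j⟩, a.r_arr, a.s_arr,
      fun i => Subtype.ext (a.arr_self i), fun i j k => Subtype.ext (a.arr_mul i j k)⟩, rfl⟩

/-- Extension by zero of compactly supported sections. -/
noncomputable def inclSections (S : GSheaf 𝒢) (h : 𝒢.IsEtale) (p : ℕ) :
    ((S.pullback (isEtale h) 𝒢'.incl).onStr p).sectionsC →+ (S.onStr p).sectionsC :=
  (SheafSpace.sectionsFunctor.map ((S.nerveMap (isEtale h) h 𝒢'.incl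
    (Homeomorph.refl X).isLocalHomeomorph).app (op (SimplexCategory.mk p)))).hom

/-- The projection of compactly supported sections to the quotient sheaf. -/
noncomputable def quotSections (S : GSheaf 𝒢) (h : 𝒢.IsEtale) (p : ℕ) :
    (S.onStr p).sectionsC →+ (𝒢'.sub S p).quotient.sectionsC :=
  (SheafSpace.sectionsFunctor.map ((𝒢'.toRelNerve S h).app (op (SimplexCategory.mk p)))).hom

variable {S : GSheaf 𝒢} (h : 𝒢.IsEtale) {p : ℕ}

theorem inclSections_apply (t : ((S.pullback (isEtale h) 𝒢'.incl).onStr p).sectionsC)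
    (a : Grpd.Str 𝒢'.grpd p) : (𝒢'.inclSections S h p t).1 (𝒢'.incl.str a) = t.1 a :=
  SheafSpace.push_apply_of_injective ((S.nerveMap (isEtale h) h 𝒢'.incl
    (Homeomorph.refl X).isLocalHomeomorph).app (op (SimplexCategory.mk p)))
    (𝒢'.injective_incl_str p) t.1 a

theorem inclSections_eq_zero (t : ((S.pullback (isEtale h) 𝒢'.incl).onStr p).sectionsC)
    {a : Grpd.Str 𝒢 p} (ha : a ∉ 𝒢'.str p) : (𝒢'.inclSections S h p t).1 a = 0 :=
  SheafSpace.push_eq_zero ((S.nerveMap (isEtale h) h 𝒢'.incl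
    (Homeomorph.refl X).isLocalHomeomorph).app (op (SimplexCategory.mk p))) t.1
    (by rw [← range_incl_str] at ha; exact ha)

theorem quotSections_apply (t : (S.onStr p).sectionsC) (a : Grpd.Str 𝒢 p) :
    (𝒢'.quotSections S h p t).1 a = QuotientAddGroup.mk (s := (𝒢'.sub S p).sub a) (t.1 a) :=
  have := h.t2_str (n := p)
  SheafSpace.push_id (S := S.onStr p) (T := (𝒢'.sub S p).quotient) _
    (fun a => QuotientAddGroup.mk' ((𝒢'.sub S p).sub a)) (𝒢'.sub S p).continuous_proj t.1 a

theorem quotSections_eq_zero_iff (t : (S.onStr p).sectionsC) :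
    𝒢'.quotSections S h p t = 0 ↔ ∀ a ∉ 𝒢'.str p, t.1 a = 0 := by
  constructor
  · intro ht a ha
    have h1 := congrArg (fun t : (𝒢'.sub S p).quotient.sectionsC => t.1 a) ht
    rw [quotSections_apply] at h1
    exact (QuotientAddGroup.eq_zero_iff (N := (𝒢'.sub S p).sub a) (t.1 a)).1 h1 ha
  · intro ht
    refine Subtype.ext (funext fun a => ?_)
    rw [quotSections_apply]
    exact (QuotientAddGroup.eq_zero_iff (N := (𝒢'.sub S p).sub a) (t.1 a)).2 (ht a)

theorem injective_inclSections : Function.Injective (𝒢'.inclSections S h p) := fun s t hst =>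
  Subtype.ext (funext fun a => by
    rw [← inclSections_apply 𝒢' h s, ← inclSections_apply 𝒢' h t, hst])

/-- A section that dies in the quotient vanishes off `(𝒢')^(p)`. Its compact support then lies in
this open subspace and stays compact there, as the inclusion is an open embedding; so the section is
the extension by zero of its restriction. -/
theorem exact_sections : Function.Exact (𝒢'.inclSections S h p) (𝒢'.quotSections S h p) := by
  intro t
  rw [quotSections_eq_zero_iff]
  constructor
  · intro ht
    have hsupp : {a | t.1 a ≠ 0} ⊆ Set.range (𝒢'.incl.str : Grpd.Str 𝒢'.grpd p → _) := by
      rw [range_incl_str]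
      exact fun a ha => by_contra fun h' => ha (ht a h')
    have hemb := (𝒢'.incl.isLocalHomeomorph_str (n := p) (isEtale h) h
      (Homeomorph.refl X).isLocalHomeomorph).isOpenEmbedding_of_injective (𝒢'.injective_incl_str p)
    let s : ((S.pullback (isEtale h) 𝒢'.incl).onStr p).sectionsC :=
      ⟨fun a => t.1 (𝒢'.incl.str a), GSheaf.isSection_comp_str (isEtale h) 𝒢'.incl t.2.1,
        (hemb.isInducing.isCompact_preimage_iff hsupp).2 t.2.2⟩
    refine ⟨s, Subtype.ext (funext fun a => ?_)⟩
    by_cases ha : a ∈ 𝒢'.str p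
    · rw [← range_incl_str] at ha
      obtain ⟨a, rfl⟩ := ha
      exact 𝒢'.inclSections_apply h s a
    · rw [inclSections_eq_zero 𝒢' h _ ha, ht a ha]
  · rintro ⟨s, rfl⟩ a ha
    exact 𝒢'.inclSections_eq_zero h s ha

/-- The kernel of the projection to the quotient is the extension by zero of a soft sheaf, which is
soft by `soft_extByZero`; sections with compact support therefore lift. -/
theorem surjective_quotSections (hS : S.sheaf.IsCSoft) :
    Function.Surjective (𝒢'.quotSections S h p) := by
  intro t
  have := h.t2_str (n := p)
  have := h.locallyCompact_str p
  have hker : (fun a => (QuotientAddGroup.mk' ((𝒢'.sub S p).sub a)).ker) = (𝒢'.sub S p).sub :=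
    funext fun a => QuotientAddGroup.ker_mk' _
  obtain ⟨s, hs, he⟩ := AbSheaf.exists_lift_sectionsC (S := S.onStr p)
    (T := (𝒢'.sub S p).quotient) (α := fun a => QuotientAddGroup.mk' ((𝒢'.sub S p).sub a))
    (𝒢'.sub S p).continuous_proj
    ((congrArg (S.onStr p).Soft hker).mpr
      (AbSheaf.soft_extByZero (GSheaf.soft_onStr hS h p) (𝒢'.isOpen_str p))) t.2
    fun a => QuotientAddGroup.mk_surjective _
  exact ⟨⟨s, hs⟩, Subtype.ext (funext fun a => (𝒢'.quotSections_apply h ⟨s, hs⟩ a).trans (he a))⟩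

variable (C : GComplex 𝒢)

theorem inclTotal_comp_quotTotal : 𝒢'.inclTotal C h ≫ 𝒢'.quotTotal C h = 0 :=
  Bicomplex.total_map_comp_eq_zero _ _ fun q p a =>
    (𝒢'.exact_sections (S := C.S q) h (p := p)).apply_apply_eq_zero a

theorem shortExact_total {C : GComplex 𝒢} (hC : ∀ q, (C.S q).sheaf.IsCSoft) :
    (ShortComplex.mk _ _ (𝒢'.inclTotal_comp_quotTotal h C)).ShortExact :=
  Bicomplex.shortExact_total (𝒢'.inclBicomplex C h) (𝒢'.quotBicomplex C h)
    (fun q p => 𝒢'.injective_inclSections (S := C.S q) h (p := p))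
    (fun q p => 𝒢'.exact_sections (S := C.S q) h (p := p))
    (fun q p => 𝒢'.surjective_quotSections h (p := p) (hC q)) _

theorem exact_homology {C : GComplex 𝒢} (hse : (ShortComplex.mk _ _
    (𝒢'.inclTotal_comp_quotTotal h C)).ShortExact) (n : ℤ) :
    Function.Exact (HomologicalComplex.homologyMap (𝒢'.inclTotal C h) n)
      (HomologicalComplex.homologyMap (𝒢'.quotTotal C h) n) ∧
    Function.Exact (HomologicalComplex.homologyMap (𝒢'.quotTotal C h) (n + 1))
      (hse.δ (n + 1) n rfl) ∧
    Function.Exact (hse.δ (n + 1) n rfl)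
      (HomologicalComplex.homologyMap (𝒢'.inclTotal C h) n) :=
  ⟨(ShortComplex.ab_exact_iff_function_exact _).1 (hse.homology_exact₂ n),
    (ShortComplex.ab_exact_iff_function_exact _).1 (hse.homology_exact₃ (n + 1) n rfl),
    (ShortComplex.ab_exact_iff_function_exact _).1 (hse.homology_exact₁ (n + 1) n rfl)⟩

end OpenSubgroupoid

end EtaleHomology

namespace EtaleHomology

open Opposite

/-! ### Independence of the resolution -/

theorem sectionsBicomplexMap_comp_eq {N N₁ N₂ N' : ℕ → SimplicialObject SheafSpace.{u}}
    {d : ∀ q, N q ⟶ N (q + 1)} {d₁ : ∀ q, N₁ q ⟶ N₁ (q + 1)} {d₂ : ∀ q, N₂ q ⟶ N₂ (q + 1)}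
    {d' : ∀ q, N' q ⟶ N' (q + 1)}
    {hd : ∀ q n y v, SheafSpace.Hom.φ ((d q ≫ d (q + 1)).app n) y v = 0}
    {hd₁ : ∀ q n y v, SheafSpace.Hom.φ ((d₁ q ≫ d₁ (q + 1)).app n) y v = 0}
    {hd₂ : ∀ q n y v, SheafSpace.Hom.φ ((d₂ q ≫ d₂ (q + 1)).app n) y v = 0}
    {hd' : ∀ q n y v, SheafSpace.Hom.φ ((d' q ≫ d' (q + 1)).app n) y v = 0}
    {α₁ : ∀ q, N q ⟶ N₁ q} {β₁ : ∀ q, N₁ q ⟶ N' q} {α₂ : ∀ q, N q ⟶ N₂ q}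
    {β₂ : ∀ q, N₂ q ⟶ N' q} (hα₁ : ∀ q, α₁ q ≫ d₁ q = d q ≫ α₁ (q + 1))
    (hβ₁ : ∀ q, β₁ q ≫ d' q = d₁ q ≫ β₁ (q + 1)) (hα₂ : ∀ q, α₂ q ≫ d₂ q = d q ≫ α₂ (q + 1))
    (hβ₂ : ∀ q, β₂ q ≫ d' q = d₂ q ≫ β₂ (q + 1)) (h : ∀ q, α₁ q ≫ β₁ q = α₂ q ≫ β₂ q) :
    sectionsBicomplexMap (hd := hd) (hd' := hd₁) α₁ hα₁ ≫
        sectionsBicomplexMap (hd' := hd') β₁ hβ₁ =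
      sectionsBicomplexMap (hd := hd) (hd' := hd₂) α₂ hα₂ ≫
        sectionsBicomplexMap (hd' := hd') β₂ hβ₂ := by
  refine (Functor.map_comp _ _ _).symm.trans (Eq.trans ?_ (Functor.map_comp _ _ _))
  refine congrArg _ (HomologicalComplex.hom_ext _ _ fun q => ?_)
  exact (Functor.whiskerRight_comp _ _ _).symm.trans
    ((congrArg (fun β => Functor.whiskerRight β SheafSpace.sectionsFunctor) (h q)).trans
      (Functor.whiskerRight_comp _ _ _))

section

variable {Y H X G : Type u} [TopologicalSpace Y] [TopologicalSpace H] [TopologicalSpace X]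
  [TopologicalSpace G] {ℋ : Grpd Y H} {𝒢 : Grpd X G}

/-- The pullback of a morphism of complexes. -/
def GComplex.Hom.pullback {C D : GComplex 𝒢} (F : C.Hom D) (hH : ℋ.IsEtale) (ι : ℋ.Hom 𝒢) :
    (C.pullback hH ι).Hom (D.pullback hH ι) where
  f q := (F.f q).pullback hH ι
  comm q x v := F.comm q (ι.obj x) v

/-- Pullback does not change stalks, so exactness is immediate, and softness survives because the
map on base spaces is injective. This serves both the inclusion of `𝒢'` and `ι : ℋ → 𝒢`. -/
theorem GComplex.IsCSoftResolution.pullback {C : GComplex 𝒢} {A : GSheaf 𝒢}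
    (hC : C.IsCSoftResolution A) (hG : 𝒢.IsEtale) (hH : ℋ.IsEtale) (ι : ℋ.Hom 𝒢)
    (hι : Function.Injective ι.obj) :
    (C.pullback hH ι).IsCSoftResolution (A.pullback hH ι) := by
  have := hG.t2_base
  have := hH.t2_base
  have := hH.locallyCompact_base
  obtain ⟨h1, ε, hε⟩ := hC
  exact ⟨fun q => (AbSheaf.soft_pullback (h1 q).soft ι.continuous_obj
    fun y => ⟨Set.univ, Filter.univ_mem, hι.injOn⟩).isCSoft, ε.pullback hH ι,
    fun x => hε (ι.obj x)⟩

end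

variable {X G : Type u} [TopologicalSpace X] [TopologicalSpace G] {𝒢 : Grpd X G}

/-- The map of relative double complexes induced by a morphism of complexes of `𝒢`-sheaves. -/
noncomputable def GComplex.Hom.relBicomplex {C D : GComplex 𝒢} (F : C.Hom D) (h : 𝒢.IsEtale)
    (𝒢' : OpenSubgroupoid 𝒢) : 𝒢'.relBicomplex C h ⟶ 𝒢'.relBicomplex D h :=
  sectionsBicomplexMap (fun q => 𝒢'.relNerveHom (F.f q) h) fun q => NatTrans.ext (funext fun n =>
    SheafSpace.Hom.ext_quotient (P := (C.S q).strSpace h n.unop.len) (𝒢'.sub (C.S q) n.unop.len)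
      rfl fun a v => congrArg (fun w => (𝒢'.sub (D.S (q + 1)) n.unop.len).proj ⟨a, w⟩)
        (F.comm q (a.obj 0) v).symm)


namespace GComplex.Hom

variable {C D : GComplex 𝒢} (F : C.Hom D) (h : 𝒢.IsEtale) (𝒢' : OpenSubgroupoid 𝒢)

/-- The restriction of a morphism of complexes to an open subgroupoid. -/
def res : (𝒢'.res C h).Hom (𝒢'.res D h) := F.pullback (OpenSubgroupoid.isEtale h) 𝒢'.incl

theorem res_bicomplex_comp_incl :
    (F.res h 𝒢').bicomplex (OpenSubgroupoid.isEtale h) ≫ 𝒢'.inclBicomplex D h =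
      𝒢'.inclBicomplex C h ≫ F.bicomplex h :=
  sectionsBicomplexMap_comp_eq _ _ _ _ fun _ => rfl

theorem bicomplex_comp_quot :
    F.bicomplex h ≫ 𝒢'.quotBicomplex D h = 𝒢'.quotBicomplex C h ≫ F.relBicomplex h 𝒢' :=
  sectionsBicomplexMap_comp_eq _ _ _ _ fun _ => rfl

/-- The map induced on total complexes. -/
noncomputable abbrev total :
    (C.bicomplex h).total (ComplexShape.down ℤ) ⟶ (D.bicomplex h).total (ComplexShape.down ℤ) :=
  HomologicalComplex₂.total.map (F.bicomplex h) _

/-- The map induced on relative total complexes. -/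
noncomputable abbrev relTotal : (𝒢'.relBicomplex C h).total (ComplexShape.down ℤ) ⟶
    (𝒢'.relBicomplex D h).total (ComplexShape.down ℤ) :=
  HomologicalComplex₂.total.map (F.relBicomplex h 𝒢') _

/-- The morphism of short exact sequences of total complexes. -/
noncomputable def shortComplexHom : ShortComplex.mk _ _ (𝒢'.inclTotal_comp_quotTotal h C) ⟶
    ShortComplex.mk _ _ (𝒢'.inclTotal_comp_quotTotal h D) where
  τ₁ := (F.res h 𝒢').total (OpenSubgroupoid.isEtale h)
  τ₂ := F.total h
  τ₃ := F.relTotal h 𝒢'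
  comm₁₂ := (HomologicalComplex₂.total.map_comp _ _ _).symm.trans ((congrArg
    (fun f => HomologicalComplex₂.total.map f _) (F.res_bicomplex_comp_incl h 𝒢')).trans
      (HomologicalComplex₂.total.map_comp _ _ _))
  comm₂₃ := (HomologicalComplex₂.total.map_comp _ _ _).symm.trans ((congrArg
    (fun f => HomologicalComplex₂.total.map f _) (F.bicomplex_comp_quot h 𝒢')).trans
      (HomologicalComplex₂.total.map_comp _ _ _))

/-- The five lemma for the morphism of long exact sequences induced by `F`. -/
theorem isIso_homologyMap_relTotal (hC : ∀ q, (C.S q).sheaf.IsCSoft)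
    (hD : ∀ q, (D.S q).sheaf.IsCSoft)
    (h1 : ∀ n, IsIso (HomologicalComplex.homologyMap
      ((F.res h 𝒢').total (OpenSubgroupoid.isEtale h)) n))
    (h2 : ∀ n, IsIso (HomologicalComplex.homologyMap (F.total h) n)) (n : ℤ) :
    IsIso (HomologicalComplex.homologyMap (F.relTotal h 𝒢') n) :=
  HomologicalComplex.HomologySequence.isIso_homologyMap_τ₃ (F.shortComplexHom h 𝒢')
    (𝒢'.shortExact_total h hC) (𝒢'.shortExact_total h hD) n
    (@IsIso.epi_of_iso _ _ _ _ _ (h1 n)) (h2 n) (fun j _ => h1 j)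
    fun j _ => @IsIso.mono_of_iso _ _ _ _ _ (h2 j)

end GComplex.Hom

/-- Every c-soft resolution is compared with the canonical one. Restricted to `𝒢'` both remain
c-soft resolutions, and the restricted comparison map is still over the identity of `A`, so it also
induces isomorphisms; the relative case follows by the five lemma. -/
theorem GComplex.IsCSoftResolution.exists_hom {C : GComplex 𝒢} {A : GSheaf 𝒢}
    (hC : C.IsCSoftResolution A) (h : 𝒢.IsEtale) (𝒢' : OpenSubgroupoid 𝒢) :
    ∃ F : C.Hom (A.resolution h),
      (∀ n, IsIso (HomologicalComplex.homologyMap (F.total h) n)) ∧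
      ∀ n, IsIso (HomologicalComplex.homologyMap (F.relTotal h 𝒢') n) := by
  have hR := A.resolution_isCSoftResolution h
  have hC' := hC.pullback h (OpenSubgroupoid.isEtale h) 𝒢'.incl Function.injective_id
  have hR' := hR.pullback h (OpenSubgroupoid.isEtale h) 𝒢'.incl Function.injective_id
  obtain ⟨hCs, ε, hε⟩ := hC
  obtain ⟨hRs, ε', hε'⟩ := hR
  obtain ⟨F, hF⟩ := GComplex.exists_hom_resolution hε
    (fun x v => (hε' x).2.1.apply_apply_eq_zero v) (A.resolution_exists_extend h)
  have h2 := Bicomplex.isIso_homologyMap (F.columnAcyclic h hCs hRs hε hε' hF)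
  have h1 := Bicomplex.isIso_homologyMap ((F.res h 𝒢').columnAcyclic (OpenSubgroupoid.isEtale h)
    (ε := ε.pullback (OpenSubgroupoid.isEtale h) 𝒢'.incl)
    (ε' := ε'.pullback (OpenSubgroupoid.isEtale h) 𝒢'.incl) hC'.1 hR'.1 hε hε' hF)
  exact ⟨F, h2, F.isIso_homologyMap_relTotal h 𝒢' hCs hRs h1 h2⟩

theorem GComplex.IsCSoftResolution.nonempty_iso {C C' : GComplex 𝒢} {A : GSheaf 𝒢}
    (hC : C.IsCSoftResolution A) (hC' : C'.IsCSoftResolution A) (h : 𝒢.IsEtale)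
    (𝒢' : OpenSubgroupoid 𝒢) (n : ℤ) : Nonempty (C.homology h n ≅ C'.homology h n) ∧
      Nonempty (𝒢'.relHomology C h n ≅ 𝒢'.relHomology C' h n) := by
  obtain ⟨F, hF, hF'⟩ := hC.exists_hom h 𝒢'
  obtain ⟨F₁, hF₁, hF₁'⟩ := hC'.exists_hom h 𝒢'
  exact ⟨⟨@asIso _ _ _ _ _ (hF n) ≪≫ (@asIso _ _ _ _ _ (hF₁ n)).symm⟩,
    ⟨@asIso _ _ _ _ _ (hF' n) ≪≫ (@asIso _ _ _ _ _ (hF₁' n)).symm⟩⟩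

end EtaleHomology

namespace EtaleHomology

/-! ### The groupoid of a regular inclusion -/

theorem isLocalHomeomorph_of_isOpenMap {E B : Type*} [TopologicalSpace E] [TopologicalSpace B]
    {p : E → B} (hc : Continuous p) (ho : IsOpenMap p) (hi : ∀ e, ∃ U ∈ 𝓝 e, Set.InjOn p U) :
    IsLocalHomeomorph p := by
  rw [isLocalHomeomorph_iff_isOpenEmbedding_restrict]
  intro e
  obtain ⟨U, hU, hUi⟩ := hi e
  exact ⟨interior U, interior_mem_nhds.2 hU, .of_continuous_injective_isOpenMap
    (hc.comp continuous_subtype_val) (Set.injOn_iff_injective.1 (hUi.mono interior_subset))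
    (ho.comp isOpen_interior.isOpenMap_subtype_val)⟩

namespace OpenSubgroupoid

variable {X G : Type u} [TopologicalSpace X] [TopologicalSpace G] {𝒢 : Grpd X G}
  (𝒢' : OpenSubgroupoid 𝒢)

theorem continuous_range : Continuous 𝒢'.range := continuous_coinduced_rng

theorem surjective_range : Function.Surjective 𝒢'.range := by
  rintro ⟨_, g, hg, rfl⟩
  exact ⟨⟨g, hg⟩, rfl⟩

variable {𝒢'}

/-- Otherwise `a⁻¹ = (a⁻¹ g) g⁻¹` would lie in `𝒢'`, and so would `a`. -/
theorem mul_inv_mem_compl {a g : G} (ha : a ∈ 𝒢'.compl) (hg : g ∈ 𝒢'.carrier)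
    (e : 𝒢.s (𝒢.inv a) = 𝒢.r g) : 𝒢.mul (𝒢.inv a) g e ∈ 𝒢'.compl := by
  intro h
  refine 𝒢'.inv_mem_compl ha ?_
  have h2 := 𝒢'.mul_mem _ h _ (𝒢'.inv_mem _ hg) ((𝒢.s_mul _ _ _).trans (𝒢.r_inv g).symm)
  rw [𝒢.mul_assoc _ _ _ e (𝒢.r_inv g).symm] at h2
  have : ∀ (u : G) (x : X) (hu : u = 𝒢.one x) (hx : x = 𝒢.s (𝒢.inv a))
      (e' : 𝒢.s (𝒢.inv a) = 𝒢.r u), 𝒢.mul (𝒢.inv a) u e' = 𝒢.inv a := by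
    rintro u x rfl rfl _
    exact 𝒢.mul_one _
  rwa [this _ _ (𝒢.mul_inv g) e.symm] at h2

/-- An arrow `g` of `𝒢'` with the range of some `a` in `Δ` factors as `a (a⁻¹ g)`, a product of two
arrows of `Δ`. So the topology of `ℋ` is a quotient topology for a surjective map. -/
theorem exists_pair_or_compl (g : 𝒢'.Arr) :
    (∃ p, 𝒢'.pairMul p = g) ∨ ∃ a, 𝒢'.ofCompl a = g := by
  by_cases hg : g.1 ∈ 𝒢'.carrier
  · obtain ⟨a, ha, har⟩ := g.2.1
    have e : 𝒢.s (𝒢.inv a) = 𝒢.r g.1 := (𝒢.s_inv a).trans har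
    have e' : 𝒢.s a = 𝒢.r (𝒢.mul (𝒢.inv a) g.1 e) := by rw [𝒢.r_mul, 𝒢.r_inv]
    have hm : 𝒢.mul a (𝒢.mul (𝒢.inv a) g.1 e) e' = g.1 := by
      have := 𝒢.inv_mul_mul (g := 𝒢.inv a) e rfl
      simpa only [𝒢.inv_inv] using this
    exact .inl ⟨⟨(a, 𝒢.mul (𝒢.inv a) g.1 e), ha, mul_inv_mem_compl ha hg e, e', hm.symm ▸ hg⟩,
      Subtype.ext hm⟩
  · exact .inr ⟨⟨g.1, hg⟩, rfl⟩

theorem continuous_ofCompl : Continuous 𝒢'.ofCompl :=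
  (continuous_coinduced_rng (f := Sum.elim 𝒢'.pairMul 𝒢'.ofCompl)).comp continuous_inr

theorem continuous_pairMul : Continuous 𝒢'.pairMul :=
  (continuous_coinduced_rng (f := Sum.elim 𝒢'.pairMul 𝒢'.ofCompl)).comp continuous_inl

/-- Inversion on `Δ`. -/
def complInv (g : 𝒢'.compl) : 𝒢'.compl := ⟨𝒢.inv g.1, 𝒢'.inv_mem_compl g.2⟩

variable (h : 𝒢.IsEtale)
include h

theorem continuous_complInv : Continuous (complInv (𝒢' := 𝒢')) :=
  (h.continuous_inv.comp continuous_subtype_val).subtype_mk _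

/-- Local injectivity is inherited from `r` on `𝒢`; openness is the regularity hypothesis. -/
theorem isLocalHomeomorph_range (hR : 𝒢'.IsRegular) : IsLocalHomeomorph 𝒢'.range := by
  refine isLocalHomeomorph_of_isOpenMap 𝒢'.continuous_range hR fun g => ?_
  obtain ⟨U, hU, hi⟩ := exists_injOn h.isLocalHomeomorph_r g.1
  refine ⟨_, continuous_subtype_val.continuousAt.preimage_mem_nhds hU, fun a ha b hb hab => ?_⟩
  exact Subtype.ext (hi ha hb (congrArg Subtype.val hab))

theorem continuous_base_val : Continuous fun x : 𝒢'.Base => (x.1 : X) :=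
  (𝒢'.excisiveHom h).continuous_obj

theorem continuous_arr_val : Continuous fun g : 𝒢'.Arr => (g.1 : G) :=
  (𝒢'.excisiveHom h).continuous_arr

theorem t2_excisiveBase : T2Space 𝒢'.Base :=
  have := h.t2_base
  T2Space.of_injective_continuous Subtype.val_injective (continuous_base_val h)

theorem locallyCompact_excisiveBase (hR : 𝒢'.IsRegular) : LocallyCompactSpace 𝒢'.Base :=
  have := h.locallyCompact
  have : LocallyCompactSpace 𝒢'.compl := 𝒢'.isOpen.isClosed_compl.locallyCompactSpace
  IsOpenQuotientMap.locallyCompactSpace ⟨𝒢'.surjective_range, 𝒢'.continuous_range, hR⟩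

theorem continuous_excisive_r : Continuous 𝒢'.excisive.r :=
  continuous_coinduced_dom.2 (continuous_sum_dom.2
    ⟨(𝒢'.continuous_range.comp ((continuous_fst.comp continuous_subtype_val).subtype_mk
      fun p : 𝒢'.Pairs => p.2.1)).congr fun _ => Subtype.ext (𝒢.r_mul _ _ _).symm,
    𝒢'.continuous_range⟩)

theorem continuous_excisive_s : Continuous 𝒢'.excisive.s :=
  continuous_coinduced_dom.2 (continuous_sum_dom.2
    ⟨(𝒢'.continuous_range.comp ((continuous_complInv h).comp
      ((continuous_snd.comp continuous_subtype_val).subtype_mk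
        fun p : 𝒢'.Pairs => p.2.2.1))).congr
          fun _ => Subtype.ext ((𝒢.r_inv _).trans (𝒢.s_mul _ _ _).symm),
    (𝒢'.continuous_range.comp (continuous_complInv h)).congr fun _ => Subtype.ext (𝒢.r_inv _)⟩)

/-- A local section of the multiplication of pairs, through a given pair. -/
theorem exists_section_pairs (hR : 𝒢'.IsRegular) (p : 𝒢'.Pairs) :
    ∃ π : 𝒢'.Base → 𝒢'.Pairs, ContinuousAt π (𝒢'.range ⟨p.1.1, p.2.1⟩) ∧
      π (𝒢'.range ⟨p.1.1, p.2.1⟩) = p ∧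
      ∀ᶠ x in 𝓝 (𝒢'.range ⟨p.1.1, p.2.1⟩), 𝒢'.range ⟨(π x).1.1, (π x).2.1⟩ = x := by
  classical
  obtain ⟨⟨g₁, g₂⟩, hg₁, hg₂, e, hm⟩ := p
  dsimp only at hg₁ hg₂ e hm ⊢
  set x₀ := 𝒢'.range ⟨g₁, hg₁⟩ with hx₀
  obtain ⟨τ, hτ, hτe, hτr⟩ := exists_localSection (isLocalHomeomorph_range h hR) ⟨g₁, hg₁⟩
  obtain ⟨τ', hτ', hτe', hτr'⟩ := exists_localSection (isLocalHomeomorph_range h hR) ⟨g₂, hg₂⟩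
  rw [← hx₀] at hτ hτe hτr
  -- The first factor is `τ(x)`; its source, written as the range of its inverse in `Δ`, is a point
  -- `σ(x)` of `r(Δ)`, over which `τ'` supplies the second factor.
  let σ : 𝒢'.Base → 𝒢'.Base := fun x => 𝒢'.range (complInv (τ x))
  have hσ : ContinuousAt σ x₀ :=
    (𝒢'.continuous_range.comp (continuous_complInv h)).continuousAt.comp hτ
  have hσe : σ x₀ = 𝒢'.range ⟨g₂, hg₂⟩ := by
    refine Subtype.ext ?_
    change 𝒢.r (𝒢.inv (τ x₀).1) = 𝒢.r g₂
    rw [hτe, 𝒢.r_inv, e]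
  have hτσ : ContinuousAt (fun x => τ' (σ x)) x₀ :=
    ContinuousAt.comp (g := τ') (by rw [hσe]; exact hτ') hσ
  have hτσe : τ' (σ x₀) = ⟨g₂, hg₂⟩ := by rw [hσe, hτe']
  have hcomp : ∀ᶠ x in 𝓝 x₀, 𝒢.s (τ x).1 = 𝒢.r (τ' (σ x)).1 := by
    have : ∀ᶠ x in 𝓝 x₀, 𝒢'.range (τ' (σ x)) = σ x := hσ.eventually (by rw [hσe]; exact hτr')
    filter_upwards [this] with x hx
    rw [← 𝒢.r_inv]
    exact (congrArg Subtype.val hx).symm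
  let f : 𝒢'.Base → G × G := fun x =>
    if 𝒢.s (τ x).1 = 𝒢.r (τ' (σ x)).1 then ((τ x).1, (τ' (σ x)).1) else (g₁, g₂)
  have hfe : ∀ x, 𝒢.s (f x).1 = 𝒢.r (f x).2 := by
    intro x
    by_cases hx : 𝒢.s (τ x).1 = 𝒢.r (τ' (σ x)).1
    · simp only [f, if_pos hx]
      exact hx
    · simp only [f, if_neg hx]
      exact e
  have hfc : ∀ x, (f x).1 ∈ 𝒢'.compl ∧ (f x).2 ∈ 𝒢'.compl := by
    intro x
    by_cases hx : 𝒢.s (τ x).1 = 𝒢.r (τ' (σ x)).1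
    · simp only [f, if_pos hx]
      exact ⟨(τ x).2, (τ' (σ x)).2⟩
    · simp only [f, if_neg hx]
      exact ⟨hg₁, hg₂⟩
  have hfτ : ∀ᶠ x in 𝓝 x₀, f x = ((τ x).1, (τ' (σ x)).1) := by
    filter_upwards [hcomp] with x hx
    exact if_pos hx
  have hf : ContinuousAt f x₀ :=
    ((continuous_subtype_val.continuousAt.comp hτ).prodMk
      (continuous_subtype_val.continuousAt.comp hτσ)).congr (hfτ.mono fun x hx => hx.symm)
  have hf₀ : f x₀ = (g₁, g₂) := by
    rw [hfτ.self_of_nhds, hτe, hτσe]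
  have hmem : ∀ᶠ x in 𝓝 x₀, 𝒢.mul (f x).1 (f x).2 (hfe x) ∈ 𝒢'.carrier := by
    refine (h.continuousAt_mul hfe hf.fst hf.snd).preimage_mem_nhds (𝒢'.isOpen.mem_nhds ?_)
    convert hm using 2 <;> rw [hf₀]
  -- As `𝒢'` is open, the product stays in `𝒢'` near `x₀`; elsewhere the given pair is used again.
  let π : 𝒢'.Base → 𝒢'.Pairs := fun x =>
    if hx : 𝒢.mul (f x).1 (f x).2 (hfe x) ∈ 𝒢'.carrier then
      ⟨f x, (hfc x).1, (hfc x).2, hfe x, hx⟩ else ⟨(g₁, g₂), hg₁, hg₂, e, hm⟩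
  have hπ : ∀ᶠ x in 𝓝 x₀, (π x).1 = f x := by
    filter_upwards [hmem] with x hx
    simp only [π, dif_pos hx]
  refine ⟨π, IsInducing.subtypeVal.continuousAt_iff.2 (hf.congr (hπ.mono fun x hx => hx.symm)),
    Subtype.ext (hπ.self_of_nhds.trans hf₀), ?_⟩
  filter_upwards [hπ, hfτ, hτr] with x h1 h2 h3
  refine Subtype.ext ?_
  change 𝒢.r (π x).1.1 = x.1
  rw [h1, h2]
  exact congrArg Subtype.val h3

/-- Local injectivity comes from `𝒢`. Local sections through arrows of `Δ` come from regularity, and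
those through arrows of `ℋ'` are products of local sections through two factors in `Δ`. -/
theorem isLocalHomeomorph_excisive_r (hR : 𝒢'.IsRegular) : IsLocalHomeomorph 𝒢'.excisive.r := by
  refine isLocalHomeomorph_of_sections _ (continuous_excisive_r h) (fun g => ?_) fun g => ?_
  · obtain ⟨U, hU, hi⟩ := exists_injOn h.isLocalHomeomorph_r g.1
    refine ⟨_, (continuous_arr_val h).continuousAt.preimage_mem_nhds hU, fun a ha b hb hab => ?_⟩
    exact Subtype.ext (hi ha hb (congrArg Subtype.val hab))
  · obtain ⟨p, rfl⟩ | ⟨a, rfl⟩ := exists_pair_or_compl g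
    · obtain ⟨π, hπ, hπe, hπr⟩ := exists_section_pairs h hR p
      have hr : ∀ p : 𝒢'.Pairs, 𝒢'.excisive.r (𝒢'.pairMul p) = 𝒢'.range ⟨p.1.1, p.2.1⟩ :=
        fun p => Subtype.ext (𝒢.r_mul _ _ _)
      refine ⟨fun x => 𝒢'.pairMul (π x), ?_, ?_, ?_⟩
      · rw [hr]
        exact continuous_pairMul.continuousAt.comp hπ
      · exact congrArg _ ((congrArg π (hr p)).trans hπe)
      · rw [hr]
        filter_upwards [hπr] with x hx
        rw [hr, hx]
    · obtain ⟨τ, hτ, hτe, hτr⟩ := exists_localSection (isLocalHomeomorph_range h hR) a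
      exact ⟨fun x => 𝒢'.ofCompl (τ x), continuous_ofCompl.continuousAt.comp hτ,
        congrArg _ hτe, hτr⟩

/-- The topology of `ℋ` may be finer than that induced by `𝒢`, but continuity into `ℋ` can be tested
on the arrow in `𝒢` and the range in `r(Δ)`: if `σ` is a local section of the range map of `ℋ`
through `f z`, then `f` equals `σ ∘ r ∘ f` near `z`, since both have nearby images in `𝒢` with equal
ranges. -/
theorem continuousAt_arr (hR : 𝒢'.IsRegular) {Z : Type*} [TopologicalSpace Z] {f : Z → 𝒢'.Arr}
    {z : Z} (h1 : ContinuousAt (fun z => (f z).1) z)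
    (h2 : ContinuousAt (fun z => 𝒢'.excisive.r (f z)) z) : ContinuousAt f z := by
  obtain ⟨σ, hσ, hσe, hσr⟩ := exists_localSection (isLocalHomeomorph_excisive_r h hR) (f z)
  have h3 : ContinuousAt (fun z => σ (𝒢'.excisive.r (f z))) z :=
    ContinuousAt.comp (g := σ) hσ h2
  obtain ⟨U, hU, hi⟩ := exists_injOn h.isLocalHomeomorph_r (f z).1
  have h4 : ∀ᶠ z in 𝓝 z, (σ (𝒢'.excisive.r (f z))).1 ∈ U :=
    ((continuous_arr_val h).continuousAt.comp h3).preimage_mem_nhds (by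
      change U ∈ 𝓝 (σ (𝒢'.excisive.r (f z))).1
      rwa [hσe])
  refine h3.congr ?_
  filter_upwards [h4, h1.preimage_mem_nhds hU, h2.eventually hσr] with w hw1 hw2 hw3
  exact Subtype.ext (hi hw1 hw2 (congrArg Subtype.val hw3))

theorem isEtale_excisive (hR : 𝒢'.IsRegular) : 𝒢'.excisive.IsEtale := by
  have := h.t2
  have := t2_excisiveBase (𝒢' := 𝒢') h
  have := locallyCompact_excisiveBase h hR
  have hT : T2Space 𝒢'.Arr :=
    T2Space.of_injective_continuous Subtype.val_injective (continuous_arr_val h)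
  have hr := isLocalHomeomorph_excisive_r h hR
  have hv := continuous_arr_val (𝒢' := 𝒢') h
  refine ⟨hT, hr.locallyCompactSpace, hr, continuous_excisive_s h, ?_, ?_, ?_⟩
  · exact continuous_iff_continuousAt.2 fun x => continuousAt_arr h hR
      (h.continuous_one.comp (continuous_base_val h)).continuousAt
      (continuousAt_id.congr (.of_forall fun x => (𝒢'.excisive.r_one x).symm))
  · exact continuous_iff_continuousAt.2 fun x => continuousAt_arr h hR
      (h.continuous_inv.comp hv).continuousAt
      ((continuous_excisive_s h).continuousAt.congr
        (.of_forall fun g => (𝒢'.excisive.r_inv g).symm))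
  · refine continuous_iff_continuousAt.2 fun x => continuousAt_arr h hR ?_ ?_
    · exact h.continuousAt_mul _
        (hv.comp (continuous_fst.comp continuous_subtype_val)).continuousAt
        (hv.comp (continuous_snd.comp continuous_subtype_val)).continuousAt
    · refine ((continuous_excisive_r h).comp
        (continuous_fst.comp continuous_subtype_val)).continuousAt.congr
          (.of_forall fun p => (𝒢'.excisive.r_mul _ _ p.2).symm)

end OpenSubgroupoid

end EtaleHomology

namespace EtaleHomology

/-! ### Excision for sections of quotients by extensions by zero -/

namespace AbSheaf

section

variable {Y : Type u} [TopologicalSpace Y] {S : AbSheaf Y}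

theorem tr_apply (s : ∀ y, S.stalk y) {y z : Y} (h : y = z) : S.tr h (s y) = s z := by
  subst h
  rfl

theorem Sub.exists_lift_near (N : S.Sub) {t : ∀ y, N.quotient.stalk y} {y : Y}
    (ht : ContinuousAt (fun y => (⟨y, t y⟩ : Total N.quotient.stalk)) y) :
    ∃ s : ∀ y, S.stalk y, ContinuousAt (fun y => (⟨y, s y⟩ : Total S.stalk)) y ∧
      ∀ᶠ z in 𝓝 y, t z = QuotientAddGroup.mk (s := N.sub z) (s z) := by
  let _ : ∀ x, Inhabited (S.stalk x) := fun x => ⟨0⟩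
  obtain ⟨v, hv⟩ := QuotientAddGroup.mk_surjective (s := N.sub y) (t y)
  obtain ⟨s, hs, hsc⟩ := exists_section_through S.isLocalHomeomorph_base y v
  refine ⟨s, hsc.self_of_nhds, ?_⟩
  refine eventually_eq_of_eq N.isLocalHomeomorph_base_quotient (b := fun y : Y => y) (s := t)
    (t := fun z => QuotientAddGroup.mk (s := N.sub z) (s z)) ht
    (N.continuous_proj.continuousAt.comp hsc.self_of_nhds) ?_
  rw [hs]
  exact hv.symm

theorem quotient_extByZero_eq_zero {U : Set Y} {hU : IsOpen U} {y : Y} (hy : y ∈ U)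
    (w : (S.extByZero U hU).quotient.stalk y) : w = 0 := by
  obtain ⟨v, rfl⟩ := QuotientAddGroup.mk_surjective (s := (S.extByZero U hU).sub y) w
  exact (QuotientAddGroup.eq_zero_iff (N := (S.extByZero U hU).sub y) v).2 fun h => absurd hy h

end

variable {Y Y' : Type u} [TopologicalSpace Y] [TopologicalSpace Y']

/-- An injective continuous map `f : Y' → Y` with a sheaf isomorphism `f^* S ≅ S'`, that restricts
to a homeomorphism between the complements of the open sets `U' = f⁻¹ U` and `U`. -/
structure Excision (S : AbSheaf Y) (S' : AbSheaf Y') (U : Set Y) (U' : Set Y') where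
  f : Y' → Y
  isOpen : IsOpen U
  isOpen' : IsOpen U'
  continuous_f : Continuous f
  injective_f : Function.Injective f
  mem_iff : ∀ y, f y ∈ U ↔ y ∈ U'
  g : {y // y ∉ U} → Y'
  continuous_g : Continuous g
  f_g : ∀ y, f (g y) = y.1
  θ : ∀ y, S.stalk (f y) ≃+ S'.stalk y
  continuousAt_iff : ∀ {Z : Type u} [TopologicalSpace Z] {b : Z → Y'} {v : ∀ z, S.stalk (f (b z))}
    {z : Z}, ContinuousAt b z →
      (ContinuousAt (fun z => (⟨b z, θ _ (v z)⟩ : Total S'.stalk)) z ↔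
        ContinuousAt (fun z => (⟨f (b z), v z⟩ : Total S.stalk)) z)

namespace Excision

variable {S : AbSheaf Y} {S' : AbSheaf Y'} {U : Set Y} {U' : Set Y'} (E : Excision S S' U U')

/-- The quotient of `S` by the extension by zero of its restriction to `U`. -/
abbrev Q : AbSheaf Y := (S.extByZero U E.isOpen).quotient

/-- The quotient of `S'` by the extension by zero of its restriction to `U'`. -/
abbrev Q' : AbSheaf Y' := (S'.extByZero U' E.isOpen').quotient

theorem θ_mem_iff (y : Y') (v : S.stalk (E.f y)) :
    E.θ y v ∈ (S'.extByZero U' E.isOpen').sub y ↔ v ∈ (S.extByZero U E.isOpen).sub (E.f y) := by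
  change (y ∉ U' → E.θ y v = 0) ↔ (E.f y ∉ U → v = 0)
  rw [E.mem_iff, EmbeddingLike.map_eq_zero_iff]

/-- The isomorphism of stalks of the quotient sheaves. -/
def ψ (y : Y') : E.Q.stalk (E.f y) →+ E.Q'.stalk y :=
  QuotientAddGroup.map ((S.extByZero U E.isOpen).sub (E.f y)) ((S'.extByZero U' E.isOpen').sub y)
    (E.θ y).toAddMonoidHom fun v hv => (E.θ_mem_iff y v).2 hv

theorem ψ_mk (y : Y') (v : S.stalk (E.f y)) :
    E.ψ y (QuotientAddGroup.mk (s := (S.extByZero U E.isOpen).sub (E.f y)) v) =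
      QuotientAddGroup.mk (s := (S'.extByZero U' E.isOpen').sub y) (E.θ y v) := rfl

theorem injective_ψ (y : Y') : Function.Injective (E.ψ y) := by
  rw [injective_iff_map_eq_zero]
  intro w hw
  obtain ⟨v, rfl⟩ := QuotientAddGroup.mk_surjective (s := (S.extByZero U E.isOpen).sub (E.f y)) w
  exact (QuotientAddGroup.eq_zero_iff (N := (S.extByZero U E.isOpen).sub (E.f y)) v).2
    ((E.θ_mem_iff y v).1
      ((QuotientAddGroup.eq_zero_iff (N := (S'.extByZero U' E.isOpen').sub y) (E.θ y v)).1 hw))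

theorem surjective_ψ (y : Y') : Function.Surjective (E.ψ y) := by
  intro w
  obtain ⟨v, rfl⟩ := QuotientAddGroup.mk_surjective (s := (S'.extByZero U' E.isOpen').sub y) w
  refine ⟨QuotientAddGroup.mk (s := (S.extByZero U E.isOpen).sub (E.f y)) ((E.θ y).symm v), ?_⟩
  rw [ψ_mk, AddEquiv.apply_symm_apply]

theorem g_f {y : Y'} (hy : E.f y ∉ U) : E.g ⟨E.f y, hy⟩ = y := E.injective_f (E.f_g _)

/-- Continuity is checked on local lifts to `S`. The quotient has zero stalks over `U`, so the
support of the restriction lies in the image under `g` of the support of `t`, a compact subset of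
the complement of `U`. -/
theorem restrict_mem {t : ∀ y, E.Q.stalk y} (ht : t ∈ E.Q.sectionsC) :
    (fun y => E.ψ y (t (E.f y))) ∈ E.Q'.sectionsC := by
  have hsec : E.Q'.IsSection fun y => E.ψ y (t (E.f y)) := by
    refine continuous_iff_continuousAt.2 fun y => ?_
    obtain ⟨s, hs, hst⟩ := Sub.exists_lift_near (S.extByZero U E.isOpen)
      (ht.1.continuousAt (x := E.f y))
    have h1 : ContinuousAt (fun y => (⟨y, E.θ y (s (E.f y))⟩ : Total S'.stalk)) y :=
      (E.continuousAt_iff (b := fun y => y) continuousAt_id).2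
        (hs.comp (f := E.f) E.continuous_f.continuousAt)
    refine ((S'.extByZero U' E.isOpen').continuous_proj.continuousAt.comp h1).congr ?_
    filter_upwards [E.continuous_f.continuousAt.eventually hst] with z hz
    rw [hz, ψ_mk]
    rfl
  refine ⟨hsec, ?_⟩
  have hK : IsCompact {y : {y // y ∉ U} | t y.1 ≠ 0} :=
    (IsInducing.subtypeVal.isCompact_preimage_iff (K := {y | t y ≠ 0}) fun y hy =>
      ⟨⟨y, fun hyU => hy (quotient_extByZero_eq_zero hyU _)⟩, rfl⟩).2 ht.2
  refine (hK.image E.continuous_g).of_isClosed_subset hsec.isClosed_ne_zero fun y hy => ?_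
  have hy' : t (E.f y) ≠ 0 := fun h0 => hy ((congrArg (E.ψ y) h0).trans (map_zero _))
  have hyU : E.f y ∉ U := fun hyU => hy' (quotient_extByZero_eq_zero hyU _)
  exact ⟨⟨E.f y, hyU⟩, hy', E.g_f hyU⟩

/-- The restriction of compactly supported sections along `f`. -/
def restrict : E.Q.sectionsC →+ E.Q'.sectionsC :=
  AddMonoidHom.mk' (fun t => ⟨fun y => E.ψ y (t.1 (E.f y)), E.restrict_mem t.2⟩) fun s t =>
    Subtype.ext (funext fun y => map_add (E.ψ y) (s.1 (E.f y)) (t.1 (E.f y)))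

theorem injective_restrict : Function.Injective E.restrict := by
  rw [injective_iff_map_eq_zero]
  intro t ht
  refine Subtype.ext (funext fun y => ?_)
  by_cases hy : y ∈ U
  · exact quotient_extByZero_eq_zero hy _
  · have h1 : ∀ y, E.ψ y (t.1 (E.f y)) = 0 := fun y =>
      congrArg (fun t : E.Q'.sectionsC => t.1 y) ht
    have h2 : t.1 (E.f (E.g ⟨y, hy⟩)) = 0 := E.injective_ψ _ ((h1 _).trans (map_zero _).symm)
    rwa [E.f_g] at h2

/-- The preimage is transported along `g` off `U` and is zero on `U`, where the stalks vanish
anyway. The point is continuity at a boundary point of `U`, which needs a section of `S` on a full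
neighbourhood. -/
theorem surjective_restrict : Function.Surjective E.restrict := by
  classical
  intro u
  choose t' ht' using fun y => E.surjective_ψ y (u.1 y)
  let t : ∀ y, E.Q.stalk y := fun y => if hy : y ∈ U then 0 else E.Q.tr (E.f_g ⟨y, hy⟩) (t' (E.g _))
  have ht : ∀ y, E.ψ y (t (E.f y)) = u.1 y := by
    intro y
    by_cases hy : E.f y ∈ U
    · rw [quotient_extByZero_eq_zero hy (t (E.f y)), map_zero,
        quotient_extByZero_eq_zero ((E.mem_iff y).1 hy) (u.1 y)]
    · have : ∀ z (hz : z = y) (e : E.f z = E.f y), E.Q.tr e (t' z) = t' y := by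
        rintro z rfl e
        rfl
      simp only [t, dif_neg hy]
      rw [this _ (E.g_f hy), ht']
  have hsec : E.Q.IsSection t := by
    refine continuous_iff_continuousAt.2 fun y => ?_
    by_cases hy : y ∈ U
    · refine (continuousAt_zero (S := E.Q) (continuousAt_id (x := y))).congr ?_
      filter_upwards [E.isOpen.mem_nhds hy] with z hz
      rw [quotient_extByZero_eq_zero hz (t z)]
      rfl
    · obtain ⟨s', hs', hsu⟩ := Sub.exists_lift_near (S'.extByZero U' E.isOpen')
        (u.2.1.continuousAt (x := E.g ⟨y, hy⟩))
      let _ : ∀ x, Inhabited (S.stalk x) := fun x => ⟨0⟩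
      -- Transporting the local lift `s'` of `u` gives a section of `S` along the complement of `U`
      -- only. The section `σ` of `S` through its value at `y` is defined in all directions, agrees
      -- with it along the complement near `y`, and on `U` its class is zero like that of every
      -- section; so it represents `t` near `y`.
      obtain ⟨σ, hσ, hσc⟩ := exists_section_through S.isLocalHomeomorph_base
        (E.f (E.g ⟨y, hy⟩)) ((E.θ _).symm (s' (E.g ⟨y, hy⟩)))
      have hgc := E.continuous_g.continuousAt (x := ⟨y, hy⟩)
      have h1 : ContinuousAt (fun z : {y // y ∉ U} => (⟨E.f (E.g z), (E.θ _).symm (s' (E.g z))⟩ :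
          Total S.stalk)) ⟨y, hy⟩ := by
        rw [← E.continuousAt_iff (b := E.g) hgc]
        simp only [AddEquiv.apply_symm_apply]
        exact hs'.comp (f := E.g) hgc
      have h2 : ∀ᶠ z in 𝓝 (⟨y, hy⟩ : {y // y ∉ U}), σ (E.f (E.g z)) = (E.θ _).symm (s' (E.g z)) :=
        eventually_eq_of_eq S.isLocalHomeomorph_base (b := fun z => E.f (E.g z))
          (hσc.self_of_nhds.comp (f := fun z => E.f (E.g z)) (E.continuous_f.continuousAt.comp hgc))
          h1 hσ
      have h3 := h2.and (hgc.eventually hsu)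
      rw [E.f_g] at hσc
      refine ((S.extByZero U E.isOpen).continuous_proj.continuousAt.comp
        hσc.self_of_nhds).congr ?_
      obtain ⟨V, hV, hVs⟩ := (mem_nhds_subtype _ _ _).1 h3
      filter_upwards [hV] with z hz
      refine congrArg (Total.mk z) ?_
      by_cases hzU : z ∈ U
      · exact (quotient_extByZero_eq_zero (S := S) (hU := E.isOpen) hzU _).trans
          (quotient_extByZero_eq_zero hzU _).symm
      · obtain ⟨h4, h5⟩ := hVs (show (⟨z, hzU⟩ : {y // y ∉ U}) ∈ _ from hz)
        have h6 : t' (E.g ⟨z, hzU⟩) =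
            QuotientAddGroup.mk (s := (S.extByZero U E.isOpen).sub _) (σ (E.f (E.g ⟨z, hzU⟩))) := by
          refine E.injective_ψ _ ?_
          rw [ht', h5, ψ_mk, h4, AddEquiv.apply_symm_apply]
        simp only [t, dif_neg hzU, h6]
        exact (tr_apply (S := E.Q)
          (fun z => QuotientAddGroup.mk (s := (S.extByZero U E.isOpen).sub z) (σ z)) _).symm
  refine ⟨⟨t, hsec, ?_⟩, Subtype.ext (funext ht)⟩
  refine (u.2.2.image E.continuous_f).of_isClosed_subset hsec.isClosed_ne_zero fun y hy => ?_
  have hyU : y ∉ U := fun hyU => hy (quotient_extByZero_eq_zero hyU _)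
  refine ⟨E.g ⟨y, hyU⟩, fun h0 => hy ?_, E.f_g _⟩
  have h1 := E.injective_ψ _ (((ht _).trans h0).trans (map_zero _).symm)
  rwa [E.f_g] at h1

variable {Z Z' : Type u} [TopologicalSpace Z] [TopologicalSpace Z'] {T : AbSheaf Z}
  {T' : AbSheaf Z'} {V : Set Z} {V' : Set Z'} {E} {D : Excision T T' V V'}
  [T2Space Y] [T2Space Y'] [T2Space Z] [T2Space Z']

/-- Restriction commutes with push-forward. -/
theorem restrict_push {F : SheafSpace.Hom ⟨Y, E.Q⟩ ⟨Z, D.Q⟩}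
    {F' : SheafSpace.Hom ⟨Y', E.Q'⟩ ⟨Z', D.Q'⟩}
    (hf : ∀ y, F.f (E.f y) = D.f (F'.f y)) (hU : ∀ y ∈ U, F.f y ∈ V)
    (hφ : ∀ y w, D.ψ (F'.f y) (D.Q.tr (hf y) (F.φ (E.f y) w)) = F'.φ y (E.ψ y w))
    (t : E.Q.sectionsC) :
    D.restrict (SheafSpace.pushHom F t) = SheafSpace.pushHom F' (E.restrict t) := by
  refine Subtype.ext (funext fun z => ?_)
  change D.ψ z (SheafSpace.push F t.1 (D.f z)) = SheafSpace.push F' (E.restrict t).1 z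
  by_cases hz : z ∈ V'
  · exact (quotient_extByZero_eq_zero hz _).trans (quotient_extByZero_eq_zero hz _).symm
  · rw [← D.mem_iff] at hz
    rw [SheafSpace.push, AddMonoidHom.map_finsum _ (SheafSpace.finite_support_push F t.2 (D.f z))]
    symm
    -- Points of the fibre over `D.f z` lie outside `U`, because `F` maps `U` into `V` and `D.f z`
    -- is not in `V`. Hence each of them is in the image of `E.f`, through `g`, and the two fibres
    -- correspond.
    refine finsum_eq_of_bijective (fun y : {y // F'.f y = z} => (⟨E.f y.1, (hf y.1).trans
      (congrArg D.f y.2)⟩ : {y // F.f y = D.f z})) ⟨fun a b hab => ?_, fun y => ?_⟩ ?_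
    · exact Subtype.ext (E.injective_f (congrArg Subtype.val hab))
    · obtain ⟨y, hy⟩ := y
      have hyU : y ∉ U := fun h => hz (hy ▸ hU y h)
      refine ⟨⟨E.g ⟨y, hyU⟩, D.injective_f ?_⟩, Subtype.ext (E.f_g _)⟩
      rw [← hf, E.f_g, hy]
    · rintro ⟨y, rfl⟩
      exact (hφ y _).symm

end Excision

end AbSheaf

end EtaleHomology

namespace EtaleHomology

open Opposite

/-! ### Excision for regular inclusions -/

/-- The morphism of double complexes induced by a morphism of complexes of simplicial groups. -/
noncomputable def sectionsBicomplexMapOfNat {N N' : ℕ → SimplicialObject SheafSpace.{u}}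
    {d : ∀ q, N q ⟶ N (q + 1)} {d' : ∀ q, N' q ⟶ N' (q + 1)}
    {hd : ∀ q n y v, SheafSpace.Hom.φ ((d q ≫ d (q + 1)).app n) y v = 0}
    {hd' : ∀ q n y v, SheafSpace.Hom.φ ((d' q ≫ d' (q + 1)).app n) y v = 0}
    (β : ∀ q, N q ⋙ SheafSpace.sectionsFunctor ⟶ N' q ⋙ SheafSpace.sectionsFunctor)
    (hβ : ∀ q, β q ≫ Functor.whiskerRight (d' q) SheafSpace.sectionsFunctor =
      Functor.whiskerRight (d q) SheafSpace.sectionsFunctor ≫ β (q + 1)) :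
    sectionsBicomplex N d hd ⟶ sectionsBicomplex N' d' hd' :=
  ((AlgebraicTopology.alternatingFaceMapComplex AddCommGrpCat.{u}).mapHomologicalComplex
    (ComplexShape.up ℕ)).map
    (CochainComplex.ofHom (X := sectionsComplex N d hd) (Y := sectionsComplex N' d' hd') β
      fun q => by
        rw [sectionsComplex_d, sectionsComplex_d]
        exact hβ q)

theorem GSheaf.continuousAt_onStr_pullback_iff {Y H X G : Type u} [TopologicalSpace Y]
    [TopologicalSpace H] [TopologicalSpace X] [TopologicalSpace G] {ℋ : Grpd Y H} {𝒢 : Grpd X G}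
    (S : GSheaf 𝒢) (hH : ℋ.IsEtale) (F : ℋ.Hom 𝒢) {p : ℕ} {Z : Type*} [TopologicalSpace Z]
    {b : Z → Grpd.Str ℋ p} {v : ∀ z, (S.onStr p).stalk (F.str (b z))} {z : Z}
    (hb : ContinuousAt b z) :
    ContinuousAt (fun z => (⟨b z, v z⟩ : Total ((S.pullback hH F).onStr p).stalk)) z ↔
      ContinuousAt (fun z => (⟨F.str (b z), v z⟩ : Total (S.onStr p).stalk)) z := by
  have h1 : ContinuousAt (fun z => (⟨F.str (b z), v z⟩ : Total (S.onStr p).stalk)) z ↔ _ :=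
    S.sheaf.continuousAt_pullback_iff (fun a : Grpd.Str 𝒢 p => a.obj 0)
  have h2 : ContinuousAt (fun z => (⟨b z, v z⟩ : Total ((S.pullback hH F).onStr p).stalk)) z ↔ _ :=
    (S.pullback hH F).sheaf.continuousAt_pullback_iff (fun a : Grpd.Str ℋ p => a.obj 0)
  refine h2.trans (Iff.trans ?_ h1.symm)
  refine ⟨fun h => ⟨F.continuous_str.continuousAt.comp hb,
    ((S.sheaf.continuousAt_pullback_iff F.obj).1 h.2).2⟩, fun h => ⟨hb, ?_⟩⟩
  exact (S.sheaf.continuousAt_pullback_iff F.obj).2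
    ⟨(Grpd.Str.continuous_obj 0).continuousAt.comp hb, h.2⟩

namespace OpenSubgroupoid

variable {X G : Type u} [TopologicalSpace X] [TopologicalSpace G] {𝒢 : Grpd X G}
  {𝒢' : OpenSubgroupoid 𝒢}

/-- If all arrows of the string between `x_l` and the other objects were in `𝒢'`, then so would be
every `arr i j = (arr l i)⁻¹ (arr l j)`. -/
theorem exists_arr_mem_compl {p : ℕ} {a : Grpd.Str 𝒢 p} (ha : a ∉ 𝒢'.str p) (l : Fin (p + 1)) :
    ∃ j, a.arr l j ∈ 𝒢'.compl := by
  by_contra! hc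
  have hl : ∀ j, a.arr l j ∈ 𝒢'.carrier := fun j => by_contra fun h => hc j h
  refine ha fun i j => ?_
  have h1 : 𝒢.inv (a.arr l i) = a.arr i l := by
    have h2 := 𝒢.inv_mul_mul ((a.s_arr l i).trans (a.r_arr i l).symm) (a.arr_mul l i l)
    rw [← h2]
    have : ∀ (u : G) (x : X) (hu : u = 𝒢.one x) (hx : x = 𝒢.s (𝒢.inv (a.arr l i)))
        (e' : 𝒢.s (𝒢.inv (a.arr l i)) = 𝒢.r u),
        𝒢.inv (a.arr l i) = 𝒢.mul (𝒢.inv (a.arr l i)) u e' := by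
      rintro u x rfl rfl _
      exact (𝒢.mul_one _).symm
    exact this _ _ (a.arr_self l) (by rw [𝒢.s_inv, a.r_arr]) _
  rw [← a.arr_mul i l j]
  exact 𝒢'.mul_mem _ (h1 ▸ 𝒢'.inv_mem _ (hl i)) _ (hl j) _

theorem exists_range_eq_obj {p : ℕ} {a : Grpd.Str 𝒢 p} (ha : a ∉ 𝒢'.str p) (l : Fin (p + 1)) :
    ∃ g ∈ 𝒢'.compl, 𝒢.r g = a.obj l :=
  (exists_arr_mem_compl ha l).elim fun j hj => ⟨_, hj, a.r_arr l j⟩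

/-- The strings outside of `𝒢'` as strings in `ℋ`. -/
def strLift (p : ℕ) (a : {a : Grpd.Str 𝒢 p // a ∉ 𝒢'.str p}) : Grpd.Str 𝒢'.excisive p where
  obj l := ⟨a.1.obj l, exists_range_eq_obj a.2 l⟩
  arr i j := ⟨a.1.arr i j, by rw [a.1.r_arr]; exact exists_range_eq_obj a.2 i,
    by rw [a.1.s_arr]; exact exists_range_eq_obj a.2 j⟩
  r_arr i j := Subtype.ext (a.1.r_arr i j)
  s_arr i j := Subtype.ext (a.1.s_arr i j)
  arr_self i := Subtype.ext (a.1.arr_self i)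
  arr_mul i j k := Subtype.ext (a.1.arr_mul i j k)

/-- Since `r(Δ)` carries the quotient topology, continuity of `x_l` in `X` is not enough. The
finitely many closed sets on which `arr l j` lies in `Δ` cover the strings outside `𝒢'`, and on each
of them `x_l` is the range of `arr l j`, which factors continuously through `Δ → r(Δ)`. -/
theorem continuous_strLift_obj (p : ℕ) (l : Fin (p + 1)) :
    Continuous fun a : {a : Grpd.Str 𝒢 p // a ∉ 𝒢'.str p} => (strLift p a).obj l := by
  have hcl : ∀ j, IsClosed {a : {a : Grpd.Str 𝒢 p // a ∉ 𝒢'.str p} | a.1.arr l j ∈ 𝒢'.compl} :=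
    fun j => 𝒢'.isOpen.isClosed_compl.preimage
      ((Grpd.Str.continuous_arr l j).comp continuous_subtype_val)
  refine (locallyFinite_of_finite fun j => {a : {a : Grpd.Str 𝒢 p // a ∉ 𝒢'.str p} |
    a.1.arr l j ∈ 𝒢'.compl}).continuous (Set.eq_univ_of_forall fun a =>
    Set.mem_iUnion.2 (exists_arr_mem_compl a.2 l)) hcl fun j => ?_
  rw [continuousOn_iff_continuous_domRestrict]
  have hc : Continuous fun a : {a : {a : Grpd.Str 𝒢 p // a ∉ 𝒢'.str p} |
      a.1.arr l j ∈ 𝒢'.compl} => 𝒢'.range ⟨a.1.1.arr l j, a.2⟩ :=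
    𝒢'.continuous_range.comp (((Grpd.Str.continuous_arr l j).comp
      (continuous_subtype_val.comp continuous_subtype_val)).subtype_mk _)
  exact hc.congr fun a => Subtype.ext (a.1.1.r_arr l j)

variable (h : 𝒢.IsEtale) (hR : 𝒢'.IsRegular)

include h hR in
theorem continuous_strLift (p : ℕ) : Continuous (strLift (𝒢' := 𝒢') p) :=
  continuous_iff_continuousAt.2 fun _ => Grpd.Str.continuousAt_of
    (fun l => (continuous_strLift_obj p l).continuousAt) fun i j => continuousAt_arr h hR
      ((Grpd.Str.continuous_arr i j).comp continuous_subtype_val).continuousAt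
      ((continuous_strLift_obj p i).continuousAt.congr
        (.of_forall fun _ => ((strLift p _).r_arr i j).symm))

variable (hH : 𝒢'.excisive.IsEtale)

/-- The excision data for the spaces of strings. -/
def strExcision (S : GSheaf 𝒢) (p : ℕ) :
    AbSheaf.Excision (S.onStr p) ((S.pullback hH (𝒢'.excisiveHom h)).onStr p) (𝒢'.str p)
      (𝒢'.excisiveSub.str p) where
  f := (𝒢'.excisiveHom h).str
  isOpen := 𝒢'.isOpen_str p
  isOpen' := 𝒢'.excisiveSub.isOpen_str p
  continuous_f := (𝒢'.excisiveHom h).continuous_str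
  injective_f := Grpd.Hom.injective_str Subtype.val_injective Subtype.val_injective p
  mem_iff _ := Iff.rfl
  g := strLift p
  continuous_g := continuous_strLift h hR p
  f_g _ := rfl
  θ _ := AddEquiv.refl _
  continuousAt_iff := S.continuousAt_onStr_pullback_iff hH (𝒢'.excisiveHom h)

/-- Restriction of sections along `ℋ → 𝒢`, as a morphism of simplicial abelian groups. -/
noncomputable def excisionNat (S : GSheaf 𝒢) :
    𝒢'.relNerve S h ⋙ SheafSpace.sectionsFunctor ⟶
      𝒢'.excisiveSub.relNerve (S.pullback hH (𝒢'.excisiveHom h)) hH ⋙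
        SheafSpace.sectionsFunctor where
  app n := AddCommGrpCat.ofHom (strExcision h hR hH S n.unop.len).restrict
  naturality n m φ := by
    have := h.t2_str (n := n.unop.len)
    have := h.t2_str (n := m.unop.len)
    have := hH.t2_str (n := n.unop.len)
    have := hH.t2_str (n := m.unop.len)
    refine AddCommGrpCat.hom_ext (AddMonoidHom.ext fun t => ?_)
    refine AbSheaf.Excision.restrict_push (E := strExcision h hR hH S n.unop.len)
      (D := strExcision h hR hH S m.unop.len) (F := (𝒢'.relNerve S h).map φ)
      (F' := (𝒢'.excisiveSub.relNerve (S.pullback hH (𝒢'.excisiveHom h)) hH).map φ)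
      (fun _ => rfl) (fun a ha i j => ha _ _) (fun a w => ?_) t
    obtain ⟨v, rfl⟩ := QuotientAddGroup.mk_surjective
      (s := (𝒢'.sub S n.unop.len).sub ((𝒢'.excisiveHom h).str a)) w
    rfl

theorem excisionNat_comp {S T : GSheaf 𝒢} (α : S.Hom T) :
    excisionNat h hR hH S ≫ Functor.whiskerRight (𝒢'.excisiveSub.relNerveHom
        (α.pullback hH (𝒢'.excisiveHom h)) hH) SheafSpace.sectionsFunctor =
      Functor.whiskerRight (𝒢'.relNerveHom α h) SheafSpace.sectionsFunctor ≫
        excisionNat h hR hH T := by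
  refine NatTrans.ext (funext fun n => AddCommGrpCat.hom_ext (AddMonoidHom.ext fun t => ?_))
  have := h.t2_str (n := n.unop.len)
  have := hH.t2_str (n := n.unop.len)
  refine (AbSheaf.Excision.restrict_push (E := strExcision h hR hH S n.unop.len)
    (D := strExcision h hR hH T n.unop.len) (F := (𝒢'.relNerveHom α h).app n)
    (F' := (𝒢'.excisiveSub.relNerveHom (α.pullback hH (𝒢'.excisiveHom h)) hH).app n)
    (fun _ => rfl) (fun a ha => ha) (fun a w => ?_) t).symm
  obtain ⟨v, rfl⟩ := QuotientAddGroup.mk_surjective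
    (s := (𝒢'.sub S n.unop.len).sub ((𝒢'.excisiveHom h).str a)) w
  rfl

/-- The pullback of sections, as a map of relative double complexes. -/
noncomputable def excisionMap (C : GComplex 𝒢) : 𝒢'.relBicomplex C h ⟶
    𝒢'.excisiveSub.relBicomplex (C.pullback hH (𝒢'.excisiveHom h)) hH :=
  sectionsBicomplexMapOfNat (fun q => excisionNat h hR hH (C.S q))
    fun q => excisionNat_comp h hR hH (C.d q)

theorem isPullbackOfSections_excisionMap (C : GComplex 𝒢) :
    𝒢'.IsPullbackOfSections 𝒢'.excisiveSub C h hH (𝒢'.excisiveHom h)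
      (excisionMap h hR hH C) := fun q p _ a _ hv =>
  congrArg ((strExcision h hR hH (C.S q) p).ψ a) hv

/-- The restriction map is bijective in every bidegree, so the map of total complexes is an
isomorphism of complexes, before passing to homology. -/
theorem isIso_homologyMap_excisionMap (C : GComplex 𝒢) (n : ℤ) :
    IsIso (HomologicalComplex.homologyMap
      (HomologicalComplex₂.total.map (excisionMap h hR hH C) (ComplexShape.down ℤ)) n) := by
  have (i : ℤ) : IsIso ((HomologicalComplex₂.total.map (excisionMap h hR hH C)
      (ComplexShape.down ℤ)).f i) := by
    refine (ConcreteCategory.isIso_iff_bijective _).2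
      ⟨Bicomplex.injective_mapTot (f := excisionMap h hR hH C) (fun q p => ?_) i,
        fun y => Bicomplex.exists_mapTot_eq (excisionMap h hR hH C) y fun j => ?_⟩
    · exact (strExcision h hR hH (C.S q) p).injective_restrict
    · exact (strExcision h hR hH (C.S j.1.1) j.1.2).surjective_restrict _
  have := HomologicalComplex.Hom.isIso_of_components (HomologicalComplex₂.total.map
    (excisionMap h hR hH C) (ComplexShape.down ℤ))
  infer_instance

end OpenSubgroupoid

end EtaleHomology

/-! ### Assembly of the three statements. -/

theorem mainTheorem8 {X G : Type u} [TopologicalSpace X] [TopologicalSpace G]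
    (𝒢 : Grpd X G) (h : 𝒢.IsEtale) (𝒢' : OpenSubgroupoid 𝒢) (A : GSheaf 𝒢) :
    ((∃ C : GComplex 𝒢, C.IsCSoftResolution A) ∧
      ∀ C C' : GComplex 𝒢, C.IsCSoftResolution A → C'.IsCSoftResolution A →
        ∀ n : ℤ, Nonempty (C.homology h n ≅ C'.homology h n) ∧
          Nonempty (𝒢'.relHomology C h n ≅ 𝒢'.relHomology C' h n)) ∧
    (∀ C : GComplex 𝒢, C.IsCSoftResolution A →
      (𝒢'.res C h).IsCSoftResolution (A.pullback (OpenSubgroupoid.isEtale h) 𝒢'.incl) ∧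
      (∀ R : GComplex 𝒢'.grpd,
        R.IsCSoftResolution (A.pullback (OpenSubgroupoid.isEtale h) 𝒢'.incl) → ∀ n : ℤ,
          Nonempty (R.homology (OpenSubgroupoid.isEtale h) n ≅
            (𝒢'.res C h).homology (OpenSubgroupoid.isEtale h) n)) ∧
      ∃ (w : 𝒢'.inclTotal C h ≫ 𝒢'.quotTotal C h = 0)
        (hse : (ShortComplex.mk (𝒢'.inclTotal C h) (𝒢'.quotTotal C h) w).ShortExact),
        ∀ n : ℤ,
          Function.Exact (HomologicalComplex.homologyMap (𝒢'.inclTotal C h) n)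
            (HomologicalComplex.homologyMap (𝒢'.quotTotal C h) n) ∧
          Function.Exact (HomologicalComplex.homologyMap (𝒢'.quotTotal C h) (n + 1))
            (hse.δ (n + 1) n rfl) ∧
          Function.Exact (hse.δ (n + 1) n rfl)
            (HomologicalComplex.homologyMap (𝒢'.inclTotal C h) n)) ∧
    (𝒢'.IsRegular → ∃ hH : 𝒢'.excisive.IsEtale,
      ∀ C : GComplex 𝒢, C.IsCSoftResolution A →
        (C.pullback hH (𝒢'.excisiveHom h)).IsCSoftResolution
          (A.pullback hH (𝒢'.excisiveHom h)) ∧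
        (∃ Φ : 𝒢'.relBicomplex C h ⟶
            𝒢'.excisiveSub.relBicomplex (C.pullback hH (𝒢'.excisiveHom h)) hH,
          𝒢'.IsPullbackOfSections 𝒢'.excisiveSub C h hH (𝒢'.excisiveHom h) Φ ∧
          ∀ n : ℤ, IsIso (HomologicalComplex.homologyMap
            (HomologicalComplex₂.total.map Φ (ComplexShape.down ℤ)) n)) ∧
        ∀ T : GComplex 𝒢'.excisive,
          T.IsCSoftResolution (A.pullback hH (𝒢'.excisiveHom h)) → ∀ n : ℤ,
            Nonempty (𝒢'.excisiveSub.relHomology T hH n ≅ 𝒢'.relHomology C h n)) := by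
  have hR := A.resolution_isCSoftResolution h
  refine ⟨⟨⟨_, hR⟩, fun C C' hC hC' => hC.nonempty_iso hC' h 𝒢'⟩, fun C hC => ?_, fun hreg => ?_⟩
  · have hres : (𝒢'.res C h).IsCSoftResolution
        (A.pullback (OpenSubgroupoid.isEtale h) 𝒢'.incl) :=
      hC.pullback h (OpenSubgroupoid.isEtale h) 𝒢'.incl Function.injective_id
    -- Independence of the resolution is proved for absolute and relative groups together, relative
    -- to some open subgroupoid. For the absolute groups of `𝒢'` any choice will do; here it is the
    -- whole groupoid.
    let 𝒰 : OpenSubgroupoid 𝒢'.grpd := ⟨Set.univ, isOpen_univ, fun _ => trivial,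
      fun _ _ => trivial, fun _ _ _ _ _ => trivial⟩
    exact ⟨hres, fun R hR n => (hR.nonempty_iso hres (OpenSubgroupoid.isEtale h) 𝒰 n).1,
      𝒢'.inclTotal_comp_quotTotal h C, 𝒢'.shortExact_total h hC.1,
      𝒢'.exact_homology h (𝒢'.shortExact_total h hC.1)⟩
  · have hH := OpenSubgroupoid.isEtale_excisive h hreg
    refine ⟨hH, fun C hC => ?_⟩
    have hpb := hC.pullback h hH (𝒢'.excisiveHom h) Subtype.val_injective
    have hΦ := OpenSubgroupoid.isIso_homologyMap_excisionMap h hreg hH C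
    exact ⟨hpb, ⟨OpenSubgroupoid.excisionMap h hreg hH C,
      OpenSubgroupoid.isPullbackOfSections_excisionMap h hreg hH C, hΦ⟩, fun T hT n =>
        ((hT.nonempty_iso hpb hH 𝒢'.excisiveSub n).2).map fun e =>
          e ≪≫ (@asIso _ _ _ _ _ (hΦ n)).symm⟩
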